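/- Let $\kappa>0$, $\gamma_1\ge 1$ and $K_3>0$. There is a constant $C>0$, depending only on $\kappa,\gamma_1,K_3$, such that the following holds for all integers $n\ge 1$, $p\ge 2$ with $p\ge n^{\kappa}$, all integers $m\ge 0$ and all real $B_n\ge 1$. Let $X_1,\dots,X_n$ be random vectors in $\mathbb{R}^p$, $X_t=(X_{t,1},\dots,X_{t,p})^{\top}$, with $\mathbb{E}(X_t)=0$, which form an $m$-dependent sequence: $(X_1,\dots,X_r)$ and $(X_s,\dots,X_n)$ are independent whenever $1\le r<s\le n$ and $s-r>m$. Put $S_{n,x}=n^{-1/2}\sum_{t=1}^nX_t$ and $\Xi=\mathrm{Cov}(S_{n,x})$, and assume (a) $\|X_{t,j}\|_{\psi_{\gamma_1}}\le B_n$ for all $t\in\{1,\dots,n\}$ and $j\in\{1,\dots,p\}$, where $\|\xi\|_{\psi_\gamma}:=\inf\{\lambda>0:\mathbb{E}[\exp\{(|\xi|/\lambda)^{\gamma}\}-1]\le 1\}$; (b) $\mathrm{Var}\big(n^{-1/2}\sum_{t=1}^nX_{t,j}\big)\ge K_3$ for all $j\in\{1,\dots,p\}$. Let $G\sim N(0,\Xi)$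 be independent of $X_1,\dots,X_n$. Then $$\varrho_n:=\sup_{u\in\mathbb{R}^p,\ \nu\in[0,1]}\Big|\mathbb{P}\big(\sqrt{\nu}\,S_{n,x}+\sqrt{1-\nu}\,G\le u\big)-\mathbb{P}(G\le u)\Big|\ \le\ C\,\frac{B_n\,(m\vee 1)^{2/3}(\log p)^{7/6}}{n^{1/6}},$$ where inequalities between vectors are coordinatewise. -/

import Mathlib

open MeasureTheory ProbabilityTheory
open scoped ENNReal

noncomputable section

namespace HighDimCLT

/-- The Orlicz quantity `‖ξ‖_{ψ_γ} = inf {lam > 0 : E[ψ_γ(|ξ| / lam)] ≤ 1}`, where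
`ψ_γ(x) = exp (x ^ γ) - 1`. It takes values in `[0, ∞]`, with `inf ∅ = ∞`. -/
def psiNorm {Ω : Type*} [MeasurableSpace Ω] (γ : ℝ) (ξ : Ω → ℝ) (P : Measure Ω) : ℝ≥0∞ :=
  sInf {a : ℝ≥0∞ | ∃ lam : ℝ, 0 < lam ∧ a = ENNReal.ofReal lam ∧
    ∫⁻ ω, ENNReal.ofReal (Real.exp ((|ξ ω| / lam) ^ γ) - 1) ∂P ≤ 1}

/-- The finite sequence `X` is `m`-dependent: whenever `s - r > m`, the segments
`(X_t)_{t ≤ r}` and `(X_t)_{t ≥ s}` are independent. -/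
def IsMDependent {Ω E : Type*} [MeasurableSpace Ω] [MeasurableSpace E] {n : ℕ} (m : ℕ)
    (X : Fin n → Ω → E) (P : Measure Ω) : Prop :=
  ∀ r s : Fin n, (r : ℕ) + m < (s : ℕ) →
    IndepFun (fun ω (t : {t : Fin n // t ≤ r}) => X t ω)
      (fun ω (t : {t : Fin n // s ≤ t}) => X t ω) P

/-- The normalized sum `S_{n,x} = n^{-1/2} ∑_t X_t`. -/
def normalizedSum {Ω : Type*} {n p : ℕ} (X : Fin n → Ω → EuclideanSpace ℝ (Fin p)) (ω : Ω) :
    EuclideanSpace ℝ (Fin p) :=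
  (Real.sqrt n)⁻¹ • ∑ t, X t ω

/-- The long-run covariance matrix `Ξ = Cov(S_{n,x})`. -/
def longRunCov {Ω : Type*} [MeasurableSpace Ω] {n p : ℕ}
    (X : Fin n → Ω → EuclideanSpace ℝ (Fin p)) (P : Measure Ω) : Matrix (Fin p) (Fin p) ℝ :=
  Matrix.of fun j k =>
    covariance (fun ω => normalizedSum X ω j) (fun ω => normalizedSum X ω k) P

/-- The long-run variance `V_{n,j}` of the `j`-th coordinate sequence. -/
def longRunVar {Ω : Type*} [MeasurableSpace Ω] {n p : ℕ}
    (X : Fin n → Ω → EuclideanSpace ℝ (Fin p)) (P : Measure Ω) (j : Fin p) : ℝ :=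
  variance (fun ω => normalizedSum X ω j) P

/-- `ϱ_n = sup_{u ∈ ℝ^p, ν ∈ [0,1]} |P(√ν S_{n,x} + √(1-ν) G ≤ u) - P(G ≤ u)|`, where
`G ∼ N(0, Ξ)` is independent of the data; the pair (data, `G`) is realized on the product of the
original probability space with `(ℝ^p, N(0, Ξ))`. Inequalities of vectors are coordinatewise. -/
def varrho {Ω : Type*} [MeasurableSpace Ω] {n p : ℕ}
    (X : Fin n → Ω → EuclideanSpace ℝ (Fin p)) (P : Measure Ω) : ℝ :=
  ⨆ q : EuclideanSpace ℝ (Fin p) × Set.Icc (0 : ℝ) 1,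
    |(P.prod (multivariateGaussian 0 (longRunCov X P))).real
        {z | ∀ j, (Real.sqrt q.2 • normalizedSum X z.1 + Real.sqrt (1 - q.2) • z.2) j ≤ q.1 j}
      - (multivariateGaussian 0 (longRunCov X P)).real {g | ∀ j, g j ≤ q.1 j}|

end HighDimCLT

end

/-! The proof interpolates between S and G with a smoothed orthant indicator, and lets ϱ reappear on
the right-hand side with a coefficient small enough to be absorbed.

The indicator of {x ≤ u} is replaced by f(x) = g(F(x - u)). Here F is the soft maximum at inverse
temperature β, which exceeds the maximum by at most log p / β, and g falls from 1 to 0 on [δ, 2δ].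
Along Y = sin θ S + cos θ G, with ν = sin² θ, the θ-derivative of E f(Y) is E Df(Y)[cos θ S - sin θ
G]. Gaussian integration by parts (`integral_smoothD1_gaussian`) turns the G-term into the Hessian
contracted with Ξ. The S-term gives the same contraction (`IsMDependent.expansion`): for each t,
dropping from S the indices near t makes the rest independent of X_t, and a second-order Taylor
expansion recovers the covariances. Only third-order remainders survive.

These remainders are small for two reasons. First, third derivatives are Gibbs averages: the weights
sum to one, so no power of p is lost, and they change only by a constant factor under shifts of size
1/β (`gibbs_le_exp_mul`), so they can be evaluated at a vector independent of the increments.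
Second, they vanish unless F lies in [δ, 2δ], so the remainder carries the probability that F(Y - u)
is in [-δ, 4δ]. That probability is at most 2ϱ plus a Gaussian strip probability, which Nazarov's
inequality (`measureReal_gaussian_shift_le`) bounds by a multiple of δ √(log p).

With β of order log p / δ this yields ϱ ≤ C δ √(log p) + E (ϱ + δ √(log p)) + a small error, where E
is of order B³ (m ∨ 1)² (log p)² / (√n δ³). Taking δ a large multiple of B (m ∨ 1)^{2/3} (log
p)^{2/3} n^{-1/6} makes E a small constant. The ϱ on the right is then absorbed
(`IsMDependent.varrho_le`), and δ √(log p) is the stated rate. Local shifts can exceed 1/β only when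
some |X_{t,j}| exceeds a threshold growing with n; exponential tails together with p ≥ n^κ make this
event negligible (`exceed_bound`). -/

open MeasureTheory ProbabilityTheory
open scoped ENNReal

noncomputable section

namespace HighDimCLT

set_option linter.unusedSectionVars false

/-! ### The soft maximum and its Gibbs weights -/

section Softmax

variable {ι : Type*} [Fintype ι]

/-- The Gibbs weights at inverse temperature `β`. -/
def gibbs (β : ℝ) (x : ι → ℝ) (j : ι) : ℝ :=
  Real.exp (β * x j) / ∑ k, Real.exp (β * x k)

/-- The mean of `a` under the Gibbs weights. -/
def gibbsMean (β : ℝ) (x a : ι → ℝ) : ℝ := ∑ j, gibbs β x j * a j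

/-- The soft maximum at inverse temperature `β`. -/
def softmax (β : ℝ) (x : ι → ℝ) : ℝ := β⁻¹ * Real.log (∑ k, Real.exp (β * x k))

lemma partition_pos [Nonempty ι] (β : ℝ) (x : ι → ℝ) : 0 < ∑ k, Real.exp (β * x k) :=
  Finset.sum_pos (fun _ _ => Real.exp_pos _) Finset.univ_nonempty

lemma gibbs_nonneg (β : ℝ) (x : ι → ℝ) (j : ι) : 0 ≤ gibbs β x j :=
  div_nonneg (Real.exp_pos _).le (Finset.sum_nonneg fun _ _ => (Real.exp_pos _).le)

lemma sum_gibbs [Nonempty ι] (β : ℝ) (x : ι → ℝ) : ∑ j, gibbs β x j = 1 := by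
  unfold gibbs
  rw [← Finset.sum_div, div_self (partition_pos β x).ne']

lemma gibbs_le_one [Nonempty ι] (β : ℝ) (x : ι → ℝ) (j : ι) : gibbs β x j ≤ 1 := by
  rw [← sum_gibbs β x]
  exact Finset.single_le_sum (fun k _ => gibbs_nonneg β x k) (Finset.mem_univ j)

lemma gibbsMean_add (β : ℝ) (x a b : ι → ℝ) :
    gibbsMean β x (fun j => a j + b j) = gibbsMean β x a + gibbsMean β x b := by
  simp [gibbsMean, mul_add, Finset.sum_add_distrib]

lemma gibbsMean_sub (β : ℝ) (x a b : ι → ℝ) :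
    gibbsMean β x (fun j => a j - b j) = gibbsMean β x a - gibbsMean β x b := by
  simp [gibbsMean, mul_sub, Finset.sum_sub_distrib]

lemma gibbsMean_mul_left (β : ℝ) (x a : ι → ℝ) (r : ℝ) :
    gibbsMean β x (fun j => r * a j) = r * gibbsMean β x a := by
  simp only [gibbsMean, Finset.mul_sum]
  exact Finset.sum_congr rfl fun j _ => by ring

lemma gibbsMean_const [Nonempty ι] (β : ℝ) (x : ι → ℝ) (r : ℝ) :
    gibbsMean β x (fun _ => r) = r := by
  simp only [gibbsMean, ← Finset.sum_mul, sum_gibbs, one_mul]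

lemma gibbsMean_sum {κ : Type*} (s : Finset κ) (β : ℝ) (x : ι → ℝ) (a : κ → ι → ℝ) :
    gibbsMean β x (fun j => ∑ t ∈ s, a t j) = ∑ t ∈ s, gibbsMean β x (a t) := by
  simp only [gibbsMean, Finset.mul_sum]
  exact Finset.sum_comm

lemma gibbsMean_mono (β : ℝ) (x : ι → ℝ) {a b : ι → ℝ} (h : ∀ j, a j ≤ b j) :
    gibbsMean β x a ≤ gibbsMean β x b :=
  Finset.sum_le_sum fun j _ => mul_le_mul_of_nonneg_left (h j) (gibbs_nonneg β x j)

lemma gibbsMean_nonneg (β : ℝ) (x : ι → ℝ) {a : ι → ℝ} (h : ∀ j, 0 ≤ a j) :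
    0 ≤ gibbsMean β x a :=
  Finset.sum_nonneg fun j _ => mul_nonneg (gibbs_nonneg β x j) (h j)

lemma abs_gibbsMean_le (β : ℝ) (x a : ι → ℝ) :
    |gibbsMean β x a| ≤ gibbsMean β x (fun j => |a j|) := by
  refine (Finset.abs_sum_le_sum_abs _ _).trans (Finset.sum_le_sum fun j _ => ?_)
  rw [abs_mul, abs_of_nonneg (gibbs_nonneg β x j)]

lemma abs_gibbsMean_le_sum [Nonempty ι] (β : ℝ) (x a : ι → ℝ) :
    |gibbsMean β x a| ≤ ∑ j, |a j| := by
  refine (abs_gibbsMean_le β x a).trans (Finset.sum_le_sum fun j _ => ?_)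
  exact mul_le_of_le_one_left (abs_nonneg _) (gibbs_le_one β x j)

/-- Jensen's inequality for the cube. -/
lemma gibbsMean_abs_pow_three_le [Nonempty ι] (β : ℝ) (x a : ι → ℝ) :
    (gibbsMean β x (fun j => |a j|)) ^ 3 ≤ gibbsMean β x (fun j => |a j| ^ 3) :=
  Real.pow_arith_mean_le_arith_mean_pow Finset.univ (gibbs β x) (fun j => |a j|)
    (fun j _ => gibbs_nonneg β x j) (sum_gibbs β x) (fun _ _ => abs_nonneg _) 3

lemma le_softmax {β : ℝ} (hβ : 0 < β) (x : ι → ℝ) (j : ι) : x j ≤ softmax β x := by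
  unfold softmax
  rw [le_inv_mul_iff₀ hβ, Real.le_log_iff_exp_le
    (Finset.sum_pos (fun _ _ => Real.exp_pos _) ⟨j, Finset.mem_univ j⟩)]
  exact Finset.single_le_sum (f := fun k => Real.exp (β * x k))
    (fun k _ => (Real.exp_pos _).le) (Finset.mem_univ j)

/-- The partition function has `Fintype.card ι` terms, none larger than `exp (β c)`. With
`le_softmax` this fixes the smoothing error at log p / β, which has to stay below δ. -/
lemma softmax_le [Nonempty ι] {β : ℝ} (hβ : 0 < β) {x : ι → ℝ} {c : ℝ} (h : ∀ j, x j ≤ c) :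
    softmax β x ≤ c + Real.log (Fintype.card ι) / β := by
  have hc : (0 : ℝ) < Fintype.card ι := by exact_mod_cast Fintype.card_pos
  unfold softmax
  rw [inv_mul_le_iff₀ hβ, Real.log_le_iff_le_exp (partition_pos β x)]
  calc ∑ k, Real.exp (β * x k) ≤ ∑ _k : ι, Real.exp (β * c) :=
        Finset.sum_le_sum fun k _ => Real.exp_le_exp.2 (mul_le_mul_of_nonneg_left (h k) hβ.le)
    _ = Real.exp (β * (c + Real.log (Fintype.card ι) / β)) := by
        rw [mul_add, mul_div_cancel₀ _ hβ.ne', Real.exp_add, Real.exp_log hc]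
        simp [mul_comm]

lemma partition_le {β η : ℝ} (hβ : 0 < β) {x y : ι → ℝ} (h : ∀ j, |x j - y j| ≤ η) :
    ∑ k, Real.exp (β * x k) ≤ Real.exp (β * η) * ∑ k, Real.exp (β * y k) := by
  rw [Finset.mul_sum]
  refine Finset.sum_le_sum fun k _ => ?_
  rw [← Real.exp_add, ← mul_add]
  exact Real.exp_le_exp.2 (mul_le_mul_of_nonneg_left (by linarith [(abs_le.1 (h k)).2]) hβ.le)

lemma softmax_le_add [Nonempty ι] {β η : ℝ} (hβ : 0 < β) {x y : ι → ℝ}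
    (h : ∀ j, |x j - y j| ≤ η) : softmax β x ≤ softmax β y + η := by
  unfold softmax
  rw [inv_mul_le_iff₀ hβ, mul_add, mul_inv_cancel_left₀ hβ.ne']
  refine (Real.log_le_log (partition_pos β x) (partition_le hβ h)).trans ?_
  rw [Real.log_mul (Real.exp_pos _).ne' (partition_pos β y).ne', Real.log_exp, add_comm]

/-- Numerator and denominator each move by a factor of at most `exp (β η)`. For η = 1/β the weights
are stable up to e², which permits evaluating them at a nearby point independent of the increments.
-/
lemma gibbs_le_exp_mul [Nonempty ι] {β η : ℝ} (hβ : 0 < β) {x y : ι → ℝ}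
    (h : ∀ j, |x j - y j| ≤ η) (j : ι) :
    gibbs β x j ≤ Real.exp (2 * (β * η)) * gibbs β y j := by
  unfold gibbs
  rw [← mul_div_assoc, div_le_div_iff₀ (partition_pos β x) (partition_pos β y)]
  have h1 := partition_le hβ (fun j => (abs_sub_comm (y j) (x j)).trans_le (h j))
  have h2 : Real.exp (β * x j) ≤ Real.exp (β * η) * Real.exp (β * y j) := by
    rw [← Real.exp_add, ← mul_add]
    exact Real.exp_le_exp.2 (mul_le_mul_of_nonneg_left (by linarith [(abs_le.1 (h j)).2]) hβ.le)
  calc Real.exp (β * x j) * ∑ k, Real.exp (β * y k)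
      ≤ (Real.exp (β * η) * Real.exp (β * y j)) *
          (Real.exp (β * η) * ∑ k, Real.exp (β * x k)) :=
        mul_le_mul h2 h1 (partition_pos β y).le (by positivity)
    _ = _ := by rw [two_mul, Real.exp_add]; ring

lemma hasDerivAt_partition (β : ℝ) {x : ℝ → ι → ℝ} {v : ι → ℝ} {τ : ℝ}
    (hx : ∀ j, HasDerivAt (fun τ => x τ j) (v j) τ) :
    HasDerivAt (fun τ => ∑ k, Real.exp (β * x τ k))
      (∑ k, Real.exp (β * x τ k) * (β * v k)) τ :=
  HasDerivAt.fun_sum fun k _ => ((hx k).const_mul β).exp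

/-- The gradient of a log-partition function is the vector of Gibbs weights. -/
lemma hasDerivAt_softmax [Nonempty ι] {β : ℝ} (hβ : 0 < β) {x : ℝ → ι → ℝ} {v : ι → ℝ} {τ : ℝ}
    (hx : ∀ j, HasDerivAt (fun τ => x τ j) (v j) τ) :
    HasDerivAt (fun τ => softmax β (x τ)) (gibbsMean β (x τ) v) τ := by
  have h := ((hasDerivAt_partition β hx).log (partition_pos β (x τ)).ne').const_mul β⁻¹
  refine h.congr_deriv ?_
  simp only [gibbsMean, gibbs, Finset.sum_div _ (fun k => Real.exp (β * x τ k) * (β * v k)),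
    Finset.mul_sum]
  refine Finset.sum_congr rfl fun j _ => ?_
  field_simp

/-- Differentiating an exponential family produces β times a covariance under the weights. The
averaged vector may move too, since in the rotation argument point and direction turn together. -/
lemma hasDerivAt_gibbsMean [Nonempty ι] (β : ℝ) {x a : ℝ → ι → ℝ} {v a' : ι → ℝ} {τ : ℝ}
    (hx : ∀ j, HasDerivAt (fun τ => x τ j) (v j) τ)
    (ha : ∀ j, HasDerivAt (fun τ => a τ j) (a' j) τ) :
    HasDerivAt (fun τ => gibbsMean β (x τ) (a τ))
      (gibbsMean β (x τ) a' + β * (gibbsMean β (x τ) (fun j => a τ j * v j)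
        - gibbsMean β (x τ) (a τ) * gibbsMean β (x τ) v)) τ := by
  have hw : ∀ j, HasDerivAt (fun τ => gibbs β (x τ) j)
      (gibbs β (x τ) j * (β * v j) - gibbs β (x τ) j * (β * gibbsMean β (x τ) v)) τ := by
    intro j
    have hZ := partition_pos β (x τ)
    have h := (((hx j).const_mul β).exp).div (hasDerivAt_partition β hx) hZ.ne'
    refine h.congr_deriv ?_
    simp only [gibbsMean, gibbs, div_mul_eq_mul_div, ← Finset.sum_div]
    have : ∑ k, Real.exp (β * x τ k) * (β * v k) = β * ∑ k, Real.exp (β * x τ k) * v k := by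
      rw [Finset.mul_sum]; exact Finset.sum_congr rfl fun k _ => by ring
    rw [this]
    field_simp
  have h := HasDerivAt.fun_sum (u := Finset.univ) fun j _ => (hw j).mul (ha j)
  refine h.congr_deriv ?_
  simp only [sub_mul, Finset.sum_add_distrib, Finset.sum_sub_distrib]
  have e1 : ∑ j, gibbs β (x τ) j * (β * v j) * a τ j
      = β * gibbsMean β (x τ) (fun j => a τ j * v j) := by
    rw [gibbsMean, Finset.mul_sum]; exact Finset.sum_congr rfl fun k _ => by ring
  have e2 : ∑ j, gibbs β (x τ) j * (β * gibbsMean β (x τ) v) * a τ j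
      = β * (gibbsMean β (x τ) (a τ) * gibbsMean β (x τ) v) := by
    calc _ = ∑ j, β * gibbsMean β (x τ) v * (gibbs β (x τ) j * a τ j) :=
          Finset.sum_congr rfl fun k _ => by ring
      _ = _ := by rw [← Finset.mul_sum, ← gibbsMean]; ring
  rw [e1, e2]
  simp only [gibbsMean]
  ring

lemma continuous_gibbs (β : ℝ) (j : ι) : Continuous fun x : ι → ℝ => gibbs β x j := by
  have : Nonempty ι := ⟨j⟩
  unfold gibbs
  exact Continuous.div (by fun_prop) (by fun_prop) fun x => (partition_pos β x).ne'

lemma continuous_softmax [Nonempty ι] (β : ℝ) : Continuous fun x : ι → ℝ => softmax β x := by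
  unfold softmax
  exact continuous_const.mul (Continuous.log (by fun_prop) fun x => (partition_pos β x).ne')

end Softmax

/-! ### Smooth cutoffs composed with the soft maximum -/

/-- A smooth decreasing step from `1` (left of `δ`) to `0` (right of `2δ`) together with its first
three derivatives. -/
structure SmoothCutoff (δ K : ℝ) where
  g0 : ℝ → ℝ
  g1 : ℝ → ℝ
  g2 : ℝ → ℝ
  g3 : ℝ → ℝ
  deriv0 : ∀ y, HasDerivAt g0 (g1 y) y
  deriv1 : ∀ y, HasDerivAt g1 (g2 y) y
  deriv2 : ∀ y, HasDerivAt g2 (g3 y) y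
  eq_one : ∀ y, y ≤ δ → g0 y = 1
  eq_zero : ∀ y, 2 * δ ≤ y → g0 y = 0
  nonneg : ∀ y, 0 ≤ g0 y
  le_one : ∀ y, g0 y ≤ 1
  bound1 : ∀ y, |g1 y| ≤ K * δ⁻¹ * (Set.Icc δ (2 * δ)).indicator 1 y
  bound2 : ∀ y, |g2 y| ≤ K * δ⁻¹ ^ 2 * (Set.Icc δ (2 * δ)).indicator 1 y
  bound3 : ∀ y, |g3 y| ≤ K * δ⁻¹ ^ 3 * (Set.Icc δ (2 * δ)).indicator 1 y

/-- A function that is constant on `y ≤ a` and on `b ≤ y` has derivative vanishing off `[a, b]`. -/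
lemma deriv_eq_zero_of_notMem_Icc {f f' : ℝ → ℝ} {a b c d : ℝ} (hf : ∀ y, HasDerivAt f (f' y) y)
    (ha : ∀ y, y < a → f y = c) (hb : ∀ y, b < y → f y = d) {y : ℝ}
    (hy : y ∉ Set.Icc a b) : f' y = 0 := by
  rw [Set.mem_Icc, not_and_or, not_le, not_le] at hy
  rcases hy with hy | hy
  · exact (hf y).unique ((hasDerivAt_const y c).congr_of_eventuallyEq
      (Filter.eventuallyEq_of_mem (Iio_mem_nhds hy) ha))
  · exact (hf y).unique ((hasDerivAt_const y d).congr_of_eventuallyEq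
      (Filter.eventuallyEq_of_mem (Ioi_mem_nhds hy) hb))

lemma abs_le_mul_indicator {f : ℝ → ℝ} {s : Set ℝ} {K : ℝ} (hK : ∀ y ∈ s, |f y| ≤ K)
    (h0 : ∀ y, y ∉ s → f y = 0) (y : ℝ) : |f y| ≤ K * s.indicator 1 y := by
  by_cases hy : y ∈ s
  · simpa [hy] using hK y hy
  · simp [hy, h0 y hy]

/-- A single profile is rescaled by δ, each derivative costing one factor 1/δ. Hence K can be fixed
before δ, so that the final constant does not depend on the scale. -/
lemma exists_smoothCutoff : ∃ K : ℝ, 1 ≤ K ∧ ∀ δ : ℝ, 0 < δ → Nonempty (SmoothCutoff δ K) := by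
  let t : ℝ → ℝ := fun y => Real.smoothTransition (2 - y)
  have ht : ContDiff ℝ 4 t := Real.smoothTransition.contDiff.comp (contDiff_const.sub contDiff_id)
  have ht1 : ContDiff ℝ 3 (deriv t) := ContDiff.deriv' (n := 3) (by rw [show (3 + 1 : WithTop ℕ∞) = 4 by norm_num]; exact ht)
  have ht2 : ContDiff ℝ 2 (deriv (deriv t)) := ContDiff.deriv' (n := 2) (by rw [show (2 + 1 : WithTop ℕ∞) = 3 by norm_num]; exact ht1)
  have ht3 : ContDiff ℝ 1 (deriv (deriv (deriv t))) :=
    ContDiff.deriv' (n := 1) (by rw [show (1 + 1 : WithTop ℕ∞) = 2 by norm_num]; exact ht2)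
  have d0 : ∀ y, HasDerivAt t (deriv t y) y := fun y =>
    (ht.differentiable (by norm_num) y).hasDerivAt
  have d1 : ∀ y, HasDerivAt (deriv t) (deriv (deriv t) y) y := fun y =>
    (ht1.differentiable (by norm_num) y).hasDerivAt
  have d2 : ∀ y, HasDerivAt (deriv (deriv t)) (deriv (deriv (deriv t)) y) y := fun y =>
    (ht2.differentiable (by norm_num) y).hasDerivAt
  have t_one : ∀ y, y ≤ 1 → t y = 1 := fun y hy =>
    Real.smoothTransition.one_of_one_le (by linarith)
  have t_zero : ∀ y, 2 ≤ y → t y = 0 := fun y hy =>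
    Real.smoothTransition.zero_of_nonpos (by linarith)
  have z1 : ∀ y, y ∉ Set.Icc (1 : ℝ) 2 → deriv t y = 0 := fun y hy =>
    deriv_eq_zero_of_notMem_Icc d0 (fun y hy => t_one y hy.le) (fun y hy => t_zero y hy.le) hy
  have z2 : ∀ y, y ∉ Set.Icc (1 : ℝ) 2 → deriv (deriv t) y = 0 := fun y hy =>
    deriv_eq_zero_of_notMem_Icc d1 (fun y hy => z1 y (by simp [hy]))
      (fun y hy => z1 y (by simp [hy])) hy
  have z3 : ∀ y, y ∉ Set.Icc (1 : ℝ) 2 → deriv (deriv (deriv t)) y = 0 := fun y hy =>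
    deriv_eq_zero_of_notMem_Icc d2 (fun y hy => z2 y (by simp [hy]))
      (fun y hy => z2 y (by simp [hy])) hy
  obtain ⟨K1, hK1⟩ := isCompact_Icc.exists_bound_of_continuousOn
    (s := Set.Icc (1 : ℝ) 2) ht1.continuous.continuousOn
  obtain ⟨K2, hK2⟩ := isCompact_Icc.exists_bound_of_continuousOn
    (s := Set.Icc (1 : ℝ) 2) ht2.continuous.continuousOn
  obtain ⟨K3, hK3⟩ := isCompact_Icc.exists_bound_of_continuousOn
    (s := Set.Icc (1 : ℝ) 2) ht3.continuous.continuousOn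
  refine ⟨max 1 (max K1 (max K2 K3)), le_max_left _ _, fun δ hδ => ?_⟩
  set K := max 1 (max K1 (max K2 K3)) with hK
  have b1 : ∀ y, |deriv t y| ≤ K * (Set.Icc (1 : ℝ) 2).indicator 1 y :=
    abs_le_mul_indicator (fun y hy => (hK1 y hy).trans (by simp [hK])) z1
  have b2 : ∀ y, |deriv (deriv t) y| ≤ K * (Set.Icc (1 : ℝ) 2).indicator 1 y :=
    abs_le_mul_indicator (fun y hy => (hK2 y hy).trans (by simp [hK])) z2
  have b3 : ∀ y, |deriv (deriv (deriv t)) y| ≤ K * (Set.Icc (1 : ℝ) 2).indicator 1 y :=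
    abs_le_mul_indicator (fun y hy => (hK3 y hy).trans (by simp [hK])) z3
  have hind : ∀ y, (Set.Icc (1 : ℝ) 2).indicator (1 : ℝ → ℝ) (δ⁻¹ * y)
      = (Set.Icc δ (2 * δ)).indicator 1 y := by
    intro y
    have : δ⁻¹ * y ∈ Set.Icc (1 : ℝ) 2 ↔ y ∈ Set.Icc δ (2 * δ) := by
      rw [Set.mem_Icc, Set.mem_Icc, le_inv_mul_iff₀ hδ, inv_mul_le_iff₀ hδ, mul_one, mul_comm δ 2]
    simp [Set.indicator_apply, this]
  have hδi : (0 : ℝ) ≤ δ⁻¹ := by positivity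
  have hs : ∀ {f f' : ℝ → ℝ}, (∀ y, HasDerivAt f (f' y) y) → ∀ r y,
      HasDerivAt (fun y => r * f (δ⁻¹ * y)) ((r * δ⁻¹) * f' (δ⁻¹ * y)) y := by
    intro f f' hf r y
    have h := ((hf (δ⁻¹ * y)).comp y ((hasDerivAt_id y).const_mul δ⁻¹)).const_mul r
    exact h.congr_deriv (by ring)
  have hb : ∀ {f : ℝ → ℝ}, (∀ y, |f y| ≤ K * (Set.Icc (1 : ℝ) 2).indicator 1 y) → ∀ r ≥ 0,
      ∀ y, |r * f (δ⁻¹ * y)| ≤ K * r * (Set.Icc δ (2 * δ)).indicator 1 y := by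
    intro f hf r hr y
    rw [abs_mul, abs_of_nonneg hr, ← hind y, mul_right_comm, mul_comm]
    exact mul_le_mul_of_nonneg_right (hf _) hr
  refine ⟨{ g0 := fun y => 1 * t (δ⁻¹ * y)
            g1 := fun y => (1 * δ⁻¹) * deriv t (δ⁻¹ * y)
            g2 := fun y => (1 * δ⁻¹ * δ⁻¹) * deriv (deriv t) (δ⁻¹ * y)
            g3 := fun y => (1 * δ⁻¹ * δ⁻¹ * δ⁻¹) * deriv (deriv (deriv t)) (δ⁻¹ * y)
            deriv0 := hs d0 _
            deriv1 := hs d1 _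
            deriv2 := hs d2 _
            eq_one := fun y hy => ?_
            eq_zero := fun y hy => ?_
            nonneg := fun y => ?_
            le_one := fun y => ?_
            bound1 := fun y => (hb b1 _ (by positivity) y).trans_eq (by ring)
            bound2 := fun y => (hb b2 _ (by positivity) y).trans_eq (by ring)
            bound3 := fun y => (hb b3 _ (by positivity) y).trans_eq (by ring) }⟩
  · rw [one_mul, t_one]
    rwa [inv_mul_le_iff₀ hδ, mul_one]
  · rw [one_mul, t_zero]
    rwa [le_inv_mul_iff₀ hδ, mul_comm]
  · rw [one_mul]; exact Real.smoothTransition.nonneg _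
  · rw [one_mul]; exact Real.smoothTransition.le_one _

/-! ### Derivatives up to order three of the smoothed orthant indicator. -/

section Derivatives

variable {ι : Type*} [Fintype ι] {δ K : ℝ}

/-- The covariance of `a` and `b` under the Gibbs weights. -/
def gibbsCov (β : ℝ) (x a b : ι → ℝ) : ℝ :=
  gibbsMean β x (fun j => a j * b j) - gibbsMean β x a * gibbsMean β x b

/-- The smoothed indicator of an orthant. -/
def smoothInd (c : SmoothCutoff δ K) (β : ℝ) (x : ι → ℝ) : ℝ := c.g0 (softmax β x)

/-- The first derivative of `smoothInd` in direction `a`. -/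
def smoothD1 (c : SmoothCutoff δ K) (β : ℝ) (x a : ι → ℝ) : ℝ :=
  c.g1 (softmax β x) * gibbsMean β x a

/-- The second derivative of `smoothInd` in directions `a`, `b`. -/
def smoothD2 (c : SmoothCutoff δ K) (β : ℝ) (x a b : ι → ℝ) : ℝ :=
  c.g2 (softmax β x) * (gibbsMean β x a * gibbsMean β x b)
    + c.g1 (softmax β x) * (β * gibbsCov β x a b)

/-- The third derivative of `smoothInd` in directions `a`, `b`, `d`. -/
def smoothD3 (c : SmoothCutoff δ K) (β : ℝ) (x a b d : ι → ℝ) : ℝ :=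
  c.g3 (softmax β x) * (gibbsMean β x d * (gibbsMean β x a * gibbsMean β x b))
    + c.g2 (softmax β x) * (β * (gibbsCov β x a d * gibbsMean β x b
        + gibbsMean β x a * gibbsCov β x b d + gibbsMean β x d * gibbsCov β x a b))
    + c.g1 (softmax β x) * (β ^ 2 * (gibbsCov β x (fun j => a j * b j) d
        - gibbsCov β x a d * gibbsMean β x b - gibbsMean β x a * gibbsCov β x b d))

variable (c : SmoothCutoff δ K)

lemma hasDerivAt_smoothInd [Nonempty ι] {β : ℝ} (hβ : 0 < β) {x : ℝ → ι → ℝ} {v : ι → ℝ} {τ : ℝ}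
    (hx : ∀ j, HasDerivAt (fun τ => x τ j) (v j) τ) :
    HasDerivAt (fun τ => smoothInd c β (x τ)) (smoothD1 c β (x τ) v) τ :=
  (c.deriv0 (softmax β (x τ))).comp τ (hasDerivAt_softmax hβ hx)

lemma hasDerivAt_smoothD1 [Nonempty ι] {β : ℝ} (hβ : 0 < β) {x a : ℝ → ι → ℝ} {v a' : ι → ℝ}
    {τ : ℝ} (hx : ∀ j, HasDerivAt (fun τ => x τ j) (v j) τ)
    (ha : ∀ j, HasDerivAt (fun τ => a τ j) (a' j) τ) :
    HasDerivAt (fun τ => smoothD1 c β (x τ) (a τ))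
      (smoothD2 c β (x τ) (a τ) v + smoothD1 c β (x τ) a') τ := by
  have h := ((c.deriv1 (softmax β (x τ))).comp τ (hasDerivAt_softmax hβ hx)).mul
    (hasDerivAt_gibbsMean β hx ha)
  refine h.congr_deriv ?_
  simp only [smoothD2, smoothD1, gibbsCov, Function.comp_apply]
  ring

lemma hasDerivAt_smoothD2 [Nonempty ι] {β : ℝ} (hβ : 0 < β) {x : ℝ → ι → ℝ} {v : ι → ℝ}
    {τ : ℝ} (hx : ∀ j, HasDerivAt (fun τ => x τ j) (v j) τ) (a b : ι → ℝ) :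
    HasDerivAt (fun τ => smoothD2 c β (x τ) a b) (smoothD3 c β (x τ) a b v) τ := by
  have hm : ∀ a : ι → ℝ, HasDerivAt (fun τ => gibbsMean β (x τ) a)
      (β * gibbsCov β (x τ) a v) τ := by
    intro a
    refine (hasDerivAt_gibbsMean β hx (fun j => hasDerivAt_const τ (a j))).congr_deriv ?_
    simp [gibbsCov, gibbsMean]
  have hF := hasDerivAt_softmax hβ hx
  have h := (((c.deriv2 (softmax β (x τ))).comp τ hF).mul ((hm a).mul (hm b))).add
    (((c.deriv1 (softmax β (x τ))).comp τ hF).mul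
      (((hm fun j => a j * b j).sub ((hm a).mul (hm b))).const_mul β))
  refine h.congr_deriv ?_
  simp only [smoothD3, gibbsCov, Function.comp_apply, Pi.mul_apply, Pi.sub_apply]
  ring

lemma smoothD3_mul_right (β : ℝ) (x a b d : ι → ℝ) (r s : ℝ) :
    smoothD3 c β x a (fun j => r * b j) (fun j => s * d j) = r * s * smoothD3 c β x a b d := by
  have e1 : (fun j => a j * (s * d j)) = fun j => s * (a j * d j) := by ext j; ring
  have e2 : (fun j => r * b j * (s * d j)) = fun j => (r * s) * (b j * d j) := by ext j; ring
  have e3 : (fun j => a j * (r * b j)) = fun j => r * (a j * b j) := by ext j; ring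
  have e4 : (fun j => a j * (r * b j) * (s * d j)) = fun j => (r * s) * (a j * b j * d j) := by
    ext j; ring
  simp only [smoothD3, gibbsCov, e1, e2, e3, e4, gibbsMean_mul_left]
  ring

lemma smoothD1_sum {κ : Type*} (s : Finset κ) (β : ℝ) (x : ι → ℝ) (a : κ → ι → ℝ) :
    smoothD1 c β x (fun j => ∑ t ∈ s, a t j) = ∑ t ∈ s, smoothD1 c β x (a t) := by
  simp only [smoothD1, gibbsMean_sum, Finset.mul_sum]

lemma smoothD1_mul_left (β : ℝ) (x a : ι → ℝ) (r : ℝ) :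
    smoothD1 c β x (fun j => r * a j) = r * smoothD1 c β x a := by
  simp only [smoothD1, gibbsMean_mul_left]; ring

lemma smoothD1_sub (β : ℝ) (x a b : ι → ℝ) :
    smoothD1 c β x (fun j => a j - b j) = smoothD1 c β x a - smoothD1 c β x b := by
  simp only [smoothD1, gibbsMean_sub]; ring

/-- The Hessian entries of `smoothInd`. -/
def smoothHess [DecidableEq ι] (c : SmoothCutoff δ K) (β : ℝ) (x : ι → ℝ) (j k : ι) : ℝ :=
  c.g2 (softmax β x) * (gibbs β x j * gibbs β x k)
    + c.g1 (softmax β x) * (β * ((if j = k then gibbs β x j else 0) - gibbs β x j * gibbs β x k))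

/-- The coordinate form separates the base point from the directions, so averaging over independent
directions only replaces products by mixed moments. -/
lemma smoothD2_eq_sum [DecidableEq ι] (β : ℝ) (x a b : ι → ℝ) :
    smoothD2 c β x a b = ∑ j, ∑ k, smoothHess c β x j k * (a j * b k) := by
  have e : ∀ j k, smoothHess c β x j k * (a j * b k)
      = (c.g2 (softmax β x) - c.g1 (softmax β x) * β)
          * ((gibbs β x j * a j) * (gibbs β x k * b k))
        + c.g1 (softmax β x) * β * (if j = k then gibbs β x j * (a j * b k) else 0) := by
    intro j k
    unfold smoothHess
    split_ifs <;> ring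
  simp only [e, Finset.sum_add_distrib, ← Finset.mul_sum, Finset.sum_ite_eq, Finset.mem_univ,
    if_true, ← Finset.sum_mul]
  simp only [smoothD2, gibbsCov, gibbsMean]
  ring

lemma SmoothCutoff.abs_g1_le (hδ : 0 < δ) (hK : 0 ≤ K) (y : ℝ) : |c.g1 y| ≤ K * δ⁻¹ := by
  refine (c.bound1 y).trans (mul_le_of_le_one_right (by positivity) ?_)
  exact Set.indicator_le_self' (fun _ _ => zero_le_one) y

lemma SmoothCutoff.abs_g2_le (hδ : 0 < δ) (hK : 0 ≤ K) (y : ℝ) : |c.g2 y| ≤ K * δ⁻¹ ^ 2 := by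
  refine (c.bound2 y).trans (mul_le_of_le_one_right (by positivity) ?_)
  exact Set.indicator_le_self' (fun _ _ => zero_le_one) y

lemma abs_smoothD1_le [Nonempty ι] (hδ : 0 < δ) (hK : 0 ≤ K) (β : ℝ) (x a : ι → ℝ) :
    |smoothD1 c β x a| ≤ K * δ⁻¹ * ∑ j, |a j| := by
  rw [smoothD1, abs_mul]
  exact mul_le_mul (c.abs_g1_le hδ hK _) (abs_gibbsMean_le_sum β x a) (abs_nonneg _) (by positivity)

lemma abs_smoothD2_le [Nonempty ι] (hδ : 0 < δ) (hK : 0 ≤ K) {β : ℝ} (hβ : 0 ≤ β)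
    (x a b : ι → ℝ) :
    |smoothD2 c β x a b| ≤ (K * δ⁻¹ ^ 2 + 2 * K * δ⁻¹ * β) * ((∑ j, |a j|) * ∑ j, |b j|) := by
  set A := ∑ j, |a j|
  set B := ∑ j, |b j|
  have hA : 0 ≤ A := Finset.sum_nonneg fun _ _ => abs_nonneg _
  have hB : 0 ≤ B := Finset.sum_nonneg fun _ _ => abs_nonneg _
  have h1 : |gibbsMean β x a * gibbsMean β x b| ≤ A * B := by
    rw [abs_mul]
    exact mul_le_mul (abs_gibbsMean_le_sum β x a) (abs_gibbsMean_le_sum β x b) (abs_nonneg _) hA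
  have h2 : |gibbsMean β x (fun j => a j * b j)| ≤ A * B := by
    refine (abs_gibbsMean_le_sum β x _).trans ?_
    simp only [abs_mul]
    rw [Finset.sum_mul]
    refine Finset.sum_le_sum fun j _ => mul_le_mul_of_nonneg_left ?_ (abs_nonneg _)
    exact Finset.single_le_sum (f := fun k => |b k|) (fun _ _ => abs_nonneg _) (Finset.mem_univ j)
  have h3 : |gibbsCov β x a b| ≤ 2 * (A * B) := by
    unfold gibbsCov
    exact (abs_sub _ _).trans (by linarith)
  unfold smoothD2
  refine (abs_add_le _ _).trans ?_
  rw [abs_mul, abs_mul (c.g1 _), abs_mul β, abs_of_nonneg hβ]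
  have e1 := mul_le_mul (c.abs_g2_le hδ hK (softmax β x)) h1 (abs_nonneg _) (by positivity)
  have e2 := mul_le_mul (c.abs_g1_le hδ hK (softmax β x)) (mul_le_mul_of_nonneg_left h3 hβ)
    (by positivity) (by positivity)
  linarith

lemma mul_mul_le_sum_pow_three {x y z : ℝ} (hx : 0 ≤ x) (hy : 0 ≤ y) (hz : 0 ≤ z) :
    x * y * z ≤ (x ^ 3 + y ^ 3 + z ^ 3) / 3 := by
  -- This is the identity x³ + y³ + z³ - 3xyz = (x + y + z)((x - y)² + (y - z)² + (z - x)²) / 2.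
  nlinarith [mul_nonneg (add_nonneg (add_nonneg hx hy) hz)
    (add_nonneg (add_nonneg (sq_nonneg (x - y)) (sq_nonneg (y - z))) (sq_nonneg (z - x)))]

/-- The trilinear Gibbs moments are bounded by mean cubes. -/
lemma abs_gibbsMean_mul_mul_le [Nonempty ι] (β : ℝ) (x a b d : ι → ℝ) :
    |gibbsMean β x a * gibbsMean β x b * gibbsMean β x d| ≤
        (gibbsMean β x (fun j => |a j| ^ 3) + gibbsMean β x (fun j => |b j| ^ 3)
          + gibbsMean β x (fun j => |d j| ^ 3)) / 3 ∧
    |gibbsMean β x (fun j => a j * b j) * gibbsMean β x d| ≤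
        (gibbsMean β x (fun j => |a j| ^ 3) + gibbsMean β x (fun j => |b j| ^ 3)
          + gibbsMean β x (fun j => |d j| ^ 3)) / 3 ∧
    |gibbsMean β x (fun j => a j * b j * d j)| ≤
        (gibbsMean β x (fun j => |a j| ^ 3) + gibbsMean β x (fun j => |b j| ^ 3)
          + gibbsMean β x (fun j => |d j| ^ 3)) / 3 := by
  have ja := gibbsMean_abs_pow_three_le β x a
  have jb := gibbsMean_abs_pow_three_le β x b
  have jd := gibbsMean_abs_pow_three_le β x d
  have na : 0 ≤ gibbsMean β x (fun j => |a j|) := gibbsMean_nonneg β x fun _ => abs_nonneg _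
  have nb : 0 ≤ gibbsMean β x (fun j => |b j|) := gibbsMean_nonneg β x fun _ => abs_nonneg _
  have nd : 0 ≤ gibbsMean β x (fun j => |d j|) := gibbsMean_nonneg β x fun _ => abs_nonneg _
  have la := abs_gibbsMean_le β x a
  have lb := abs_gibbsMean_le β x b
  have ld := abs_gibbsMean_le β x d
  refine ⟨?_, ?_, ?_⟩
  · rw [abs_mul, abs_mul]
    have h1 := mul_le_mul (mul_le_mul la lb (abs_nonneg _) na) ld (abs_nonneg _)
      (mul_nonneg na nb)
    have h2 := mul_mul_le_sum_pow_three na nb nd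
    linarith
  · rw [abs_mul]
    have h1 := mul_le_mul (abs_gibbsMean_le β x fun j => a j * b j) ld (abs_nonneg _)
      (gibbsMean_nonneg β x fun _ => abs_nonneg _)
    -- The mean of |d| enters the inequality as a constant inside the average; Jensen then bounds
    -- its cube by the mean of |d|³.
    have h2 := gibbsMean_mono β x fun j => mul_mul_le_sum_pow_three (abs_nonneg (a j))
      (abs_nonneg (b j)) nd
    have e1 : gibbsMean β x (fun j => |a j| * |b j| * gibbsMean β x fun j => |d j|)
        = gibbsMean β x (fun j => |a j * b j|) * gibbsMean β x (fun j => |d j|) := by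
      rw [mul_comm, ← gibbsMean_mul_left]
      simp only [abs_mul, mul_comm]
    have e2 : gibbsMean β x (fun j => (|a j| ^ 3 + |b j| ^ 3 + (gibbsMean β x fun j => |d j|) ^ 3)
          / 3) = (gibbsMean β x (fun j => |a j| ^ 3) + gibbsMean β x (fun j => |b j| ^ 3)
          + (gibbsMean β x fun j => |d j|) ^ 3) / 3 := by
      simp only [div_eq_inv_mul, gibbsMean_mul_left, gibbsMean_add, gibbsMean_const]
    linarith
  · have h1 := abs_gibbsMean_le β x fun j => a j * b j * d j
    have h2 := gibbsMean_mono β x fun j => mul_mul_le_sum_pow_three (abs_nonneg (a j))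
      (abs_nonneg (b j)) (abs_nonneg (d j))
    have e2 : gibbsMean β x (fun j => (|a j| ^ 3 + |b j| ^ 3 + |d j| ^ 3) / 3)
        = (gibbsMean β x (fun j => |a j| ^ 3) + gibbsMean β x (fun j => |b j| ^ 3)
          + gibbsMean β x (fun j => |d j| ^ 3)) / 3 := by
      simp only [div_eq_inv_mul, gibbsMean_mul_left, gibbsMean_add]
    simp only [abs_mul] at h1
    linarith

/-- The third derivative is controlled by Gibbs means of cubes, near the boundary only. -/
lemma abs_smoothD3_le [Nonempty ι] (hδ : 0 < δ) (hK : 0 ≤ K) {β : ℝ} (hβ : 1 ≤ β * δ)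
    (x a b d : ι → ℝ) :
    |smoothD3 c β x a b d| ≤ 5 * K * δ⁻¹ * β ^ 2 *
      ((Set.Icc δ (2 * δ)).indicator 1 (softmax β x) *
        gibbsMean β x (fun j => |a j| ^ 3 + |b j| ^ 3 + |d j| ^ 3)) := by
  -- The three terms scale as δ⁻³, δ⁻²β and δ⁻¹β². As δ⁻¹ ≤ β, the last dominates, and the terms
  -- contribute 1 + 2 + 2 = 5.
  have hi : δ⁻¹ ≤ β := by rwa [inv_le_iff_one_le_mul₀ hδ]
  have hδi : 0 < δ⁻¹ := by positivity
  have hβ0 : 0 < β := hδi.trans_le hi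
  rw [gibbsMean_add, gibbsMean_add]
  set Q := gibbsMean β x (fun j => |a j| ^ 3) + gibbsMean β x (fun j => |b j| ^ 3)
          + gibbsMean β x (fun j => |d j| ^ 3) with hQ
  have hQ0 : 0 ≤ Q := add_nonneg (add_nonneg (gibbsMean_nonneg β x fun _ => by positivity)
    (gibbsMean_nonneg β x fun _ => by positivity)) (gibbsMean_nonneg β x fun _ => by positivity)
  set I : ℝ := (Set.Icc δ (2 * δ)).indicator 1 (softmax β x) with hI
  have hI0 : 0 ≤ I := Set.indicator_nonneg (fun _ _ => zero_le_one) _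
  obtain ⟨h1, h2, h3⟩ := abs_gibbsMean_mul_mul_le β x a b d
  obtain ⟨-, h4, -⟩ := abs_gibbsMean_mul_mul_le β x a d b
  obtain ⟨-, h5, -⟩ := abs_gibbsMean_mul_mul_le β x b d a
  set ma := gibbsMean β x a
  set mb := gibbsMean β x b
  set md := gibbsMean β x d
  have q1 : |md * (ma * mb)| ≤ Q / 3 := by
    rw [show md * (ma * mb) = ma * mb * md by ring]; exact h1
  have h4' : |gibbsMean β x (fun j => a j * d j) * mb| ≤ Q / 3 := h4.trans_eq (by rw [hQ]; ring)
  have h5' : |gibbsMean β x (fun j => b j * d j) * ma| ≤ Q / 3 := h5.trans_eq (by rw [hQ]; ring)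
  -- Expanding the covariances leaves six trilinear moments, each at most Q / 3; the same count
  -- applies to `q3`.
  have q2 : |gibbsCov β x a d * mb + ma * gibbsCov β x b d + md * gibbsCov β x a b|
      ≤ 2 * Q := by
    rw [abs_le] at *
    simp only [gibbsCov]
    constructor <;> nlinarith
  have q3 : |gibbsCov β x (fun j => a j * b j) d - gibbsCov β x a d * mb - ma * gibbsCov β x b d|
      ≤ 2 * Q := by
    rw [abs_le] at *
    simp only [gibbsCov]
    constructor <;> nlinarith
  have b1 := c.bound1 (softmax β x)
  have b2 := c.bound2 (softmax β x)
  have b3 := c.bound3 (softmax β x)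
  rw [← hI] at b1 b2 b3
  unfold smoothD3
  refine (abs_add_three _ _ _).trans ?_
  rw [abs_mul, abs_mul (c.g2 _), abs_mul (c.g1 _), abs_mul β, abs_mul (β ^ 2),
    abs_of_pos hβ0, abs_of_pos (pow_pos hβ0 2)]
  have e1 := mul_le_mul b3 q1 (abs_nonneg _) (by positivity)
  have e2 := mul_le_mul b2 (mul_le_mul_of_nonneg_left q2 hβ0.le) (by positivity) (by positivity)
  have e3 := mul_le_mul b1 (mul_le_mul_of_nonneg_left q3 (sq_nonneg β)) (by positivity)
    (by positivity)
  have s1 : δ⁻¹ ^ 2 ≤ β ^ 2 := pow_le_pow_left₀ hδi.le hi 2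
  have f1 : K * δ⁻¹ ^ 3 * I * (Q / 3) ≤ K * δ⁻¹ * β ^ 2 * (I * Q) := by
    have : K * δ⁻¹ * (I * Q) * δ⁻¹ ^ 2 ≤ K * δ⁻¹ * (I * Q) * β ^ 2 :=
      mul_le_mul_of_nonneg_left s1 (by positivity)
    have h0 : 0 ≤ K * δ⁻¹ ^ 3 * I * Q := by positivity
    linarith
  have f2 : K * δ⁻¹ ^ 2 * I * (β * (2 * Q)) ≤ 2 * (K * δ⁻¹ * β ^ 2 * (I * Q)) := by
    have : K * δ⁻¹ * (I * Q) * β * δ⁻¹ ≤ K * δ⁻¹ * (I * Q) * β * β :=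
      mul_le_mul_of_nonneg_left hi (by positivity)
    linarith
  linarith

/-- First-order expansion of the first derivative with a second-order remainder. -/
lemma abs_smoothD1_taylor_le [Nonempty ι] {β : ℝ} (hβ : 0 < β) (x a v : ι → ℝ) {R : ℝ}
    (hR : ∀ τ ∈ Set.Icc (0 : ℝ) 1, |smoothD3 c β (fun j => x j - τ * v j) a v v| ≤ R) :
    |smoothD1 c β x a - smoothD1 c β (fun j => x j - v j) a - smoothD2 c β x a v| ≤ R := by
  have hx : ∀ τ : ℝ, ∀ j, HasDerivAt (fun τ => x j - τ * v j) (-1 * v j) τ := fun τ j =>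
    (((hasDerivAt_id τ).mul_const (v j)).const_sub (x j)).congr_deriv (by ring)
  have hD2 : ∀ τ, HasDerivAt (fun τ => smoothD2 c β (fun j => x j - τ * v j) a v)
      (-smoothD3 c β (fun j => x j - τ * v j) a v v) τ := fun τ => by
    refine (hasDerivAt_smoothD2 c hβ (hx τ) a v).congr_deriv ?_
    have := smoothD3_mul_right c β (fun j => x j - τ * v j) a v v 1 (-1)
    simpa using this
  -- Adding τ D²f(x)[a, v] makes the derivative an increment of the second derivative. Two
  -- applications of the mean value inequality then give the remainder, without the Taylor factor
  -- 1/2.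
  have hD1 : ∀ τ, HasDerivAt (fun τ => smoothD1 c β (fun j => x j - τ * v j) a
        + τ * smoothD2 c β x a v)
      (smoothD2 c β x a v - smoothD2 c β (fun j => x j - τ * v j) a v) τ := fun τ => by
    refine ((hasDerivAt_smoothD1 c hβ (hx τ) (fun j => hasDerivAt_const τ (a j))).add
      ((hasDerivAt_id τ).mul_const _)).congr_deriv ?_
    simp [smoothD1, smoothD2, gibbsCov, gibbsMean]
    ring
  have hR0 : 0 ≤ R := (abs_nonneg _).trans (hR 0 (by simp))
  have hb : ∀ τ ∈ Set.Icc (0 : ℝ) 1,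
      ‖smoothD2 c β x a v - smoothD2 c β (fun j => x j - τ * v j) a v‖ ≤ R := by
    intro τ hτ
    have h := (convex_Icc (0 : ℝ) 1).norm_image_sub_le_of_norm_hasDerivWithin_le
      (fun τ _ => (hD2 τ).hasDerivWithinAt) (C := R)
      (fun τ hτ => by rw [norm_neg]; exact hR τ hτ) hτ (Set.left_mem_Icc.2 zero_le_one)
    simp only [zero_mul, sub_zero] at h
    refine h.trans (mul_le_of_le_one_right hR0 ?_)
    rw [zero_sub, norm_neg, Real.norm_eq_abs, abs_of_nonneg hτ.1]
    exact hτ.2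
  have h := (convex_Icc (0 : ℝ) 1).norm_image_sub_le_of_norm_hasDerivWithin_le
      (fun τ _ => (hD1 τ).hasDerivWithinAt) hb (Set.right_mem_Icc.2 zero_le_one)
      (Set.left_mem_Icc.2 zero_le_one)
  simp only [zero_mul, sub_zero, one_mul, zero_sub, norm_neg, norm_one, mul_one, add_zero] at h
  rw [Real.norm_eq_abs] at h
  refine le_of_eq_of_le ?_ h
  congr 1; ring

/-- Increment of the second derivative. -/
lemma abs_smoothD2_sub_le [Nonempty ι] {β : ℝ} (hβ : 0 < β) (x a b v : ι → ℝ) {R : ℝ}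
    (hR : ∀ τ ∈ Set.Icc (0 : ℝ) 1, |smoothD3 c β (fun j => x j - τ * v j) a b v| ≤ R) :
    |smoothD2 c β x a b - smoothD2 c β (fun j => x j - v j) a b| ≤ R := by
  have hx : ∀ τ : ℝ, ∀ j, HasDerivAt (fun τ => x j - τ * v j) (-1 * v j) τ := fun τ j =>
    (((hasDerivAt_id τ).mul_const (v j)).const_sub (x j)).congr_deriv (by ring)
  have hD2 : ∀ τ, HasDerivAt (fun τ => smoothD2 c β (fun j => x j - τ * v j) a b)
      (-smoothD3 c β (fun j => x j - τ * v j) a b v) τ := fun τ => by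
    refine (hasDerivAt_smoothD2 c hβ (hx τ) a b).congr_deriv ?_
    have := smoothD3_mul_right c β (fun j => x j - τ * v j) a b v 1 (-1)
    simpa using this
  have h := (convex_Icc (0 : ℝ) 1).norm_image_sub_le_of_norm_hasDerivWithin_le
      (fun τ _ => (hD2 τ).hasDerivWithinAt) (C := R)
      (fun τ hτ => by rw [norm_neg]; exact hR τ hτ) (Set.right_mem_Icc.2 zero_le_one)
      (Set.left_mem_Icc.2 zero_le_one)
  simpa using h

end Derivatives

/-! ### Subexponential random variables -/

section Moments

variable {Ω : Type*} [MeasurableSpace Ω] {P : Measure Ω}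

/-- `ξ` is measurable with `E exp(|ξ| / b) ≤ 6`. -/
def SubExp (b : ℝ) (ξ : Ω → ℝ) (P : Measure Ω) : Prop :=
  Measurable ξ ∧ ∫⁻ ω, ENNReal.ofReal (Real.exp (|ξ ω| / b)) ∂P ≤ 6

lemma le_one_add_rpow {y γ : ℝ} (hy : 0 ≤ y) (hγ : 1 ≤ γ) : y ≤ 1 + y ^ γ := by
  have h0 := Real.rpow_nonneg hy γ
  rcases le_total y 1 with h | h
  · linarith
  · have := Real.rpow_le_rpow_of_exponent_le h hγ
    rw [Real.rpow_one] at this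
    linarith

/-- Since y ≤ 1 + y^γ for γ ≥ 1, the exponential moment is at most e ≤ 3 times an Orlicz moment
bounded by 2. Doubling B gives room to pick an admissible scale strictly above the infimum. -/
lemma subExp_of_psiNorm_le [IsProbabilityMeasure P] {γ B : ℝ} (hγ : 1 ≤ γ) (hB : 0 < B)
    {ξ : Ω → ℝ} (hξ : Measurable ξ) (h : psiNorm γ ξ P ≤ ENNReal.ofReal B) :
    SubExp (2 * B) ξ P := by
  refine ⟨hξ, ?_⟩
  have hlt : psiNorm γ ξ P < ENNReal.ofReal (2 * B) :=
    h.trans_lt ((ENNReal.ofReal_lt_ofReal_iff (by linarith)).2 (by linarith))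
  obtain ⟨a, ⟨lam, hlam, rfl, hint⟩, ha⟩ := sInf_lt_iff.1 hlt
  rw [ENNReal.ofReal_lt_ofReal_iff (by linarith)] at ha
  have hpt : ∀ ω, ENNReal.ofReal (Real.exp (|ξ ω| / (2 * B))) ≤
      3 * (ENNReal.ofReal (Real.exp ((|ξ ω| / lam) ^ γ) - 1) + 1) := by
    intro ω
    have h0 : 0 ≤ |ξ ω| / lam := by positivity
    have h1 : 1 ≤ Real.exp ((|ξ ω| / lam) ^ γ) :=
      Real.one_le_exp (Real.rpow_nonneg h0 γ)
    have h2 : |ξ ω| / (2 * B) ≤ 1 + (|ξ ω| / lam) ^ γ :=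
      (div_le_div_of_nonneg_left (abs_nonneg _) hlam ha.le).trans (le_one_add_rpow h0 hγ)
    have h3 : Real.exp (|ξ ω| / (2 * B)) ≤ 3 * Real.exp ((|ξ ω| / lam) ^ γ) := by
      refine (Real.exp_le_exp.2 h2).trans ?_
      rw [Real.exp_add]
      exact mul_le_mul_of_nonneg_right (by linarith [Real.exp_one_lt_d9]) (by positivity)
    rw [← ENNReal.ofReal_one, ← ENNReal.ofReal_add (by linarith) zero_le_one,
      show (3 : ℝ≥0∞) = ENNReal.ofReal 3 by simp, ← ENNReal.ofReal_mul (by norm_num)]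
    exact ENNReal.ofReal_le_ofReal (by linarith)
  have hm : Measurable fun ω => ENNReal.ofReal (Real.exp ((|ξ ω| / lam) ^ γ) - 1) :=
    ENNReal.measurable_ofReal.comp ((Real.measurable_exp.comp
      ((measurable_abs.comp hξ |>.div_const lam).pow_const γ)).sub_const 1)
  calc ∫⁻ ω, ENNReal.ofReal (Real.exp (|ξ ω| / (2 * B))) ∂P
      ≤ ∫⁻ ω, 3 * (ENNReal.ofReal (Real.exp ((|ξ ω| / lam) ^ γ) - 1) + 1) ∂P :=
        lintegral_mono hpt
    _ = 3 * (∫⁻ ω, ENNReal.ofReal (Real.exp ((|ξ ω| / lam) ^ γ) - 1) ∂P + 1) := by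
        rw [lintegral_const_mul _ (hm.add_const 1), lintegral_add_left hm]
        simp
    _ ≤ 3 * (1 + 1) := by gcongr
    _ = 6 := by norm_num

variable {b : ℝ} {ξ : Ω → ℝ}

lemma abs_pow_le_mul_exp (hb : 0 < b) (x : ℝ) (k : ℕ) :
    |x| ^ k ≤ k.factorial * b ^ k * Real.exp (|x| / b) := by
  have h := Real.pow_div_factorial_le_exp (|x| / b) (by positivity) k
  rw [div_le_iff₀ (by positivity), div_pow, div_le_iff₀ (by positivity)] at h
  linarith

lemma SubExp.integrable_exp (h : SubExp b ξ P) :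
    Integrable (fun ω => Real.exp (|ξ ω| / b)) P := by
  refine ⟨(Real.measurable_exp.comp ((measurable_abs.comp h.1).div_const b)).aestronglyMeasurable,
    ?_⟩
  rw [hasFiniteIntegral_iff_ofReal (Filter.Eventually.of_forall fun _ => (Real.exp_pos _).le)]
  exact h.2.trans_lt (by simp)

lemma SubExp.integral_exp_le (h : SubExp b ξ P) : ∫ ω, Real.exp (|ξ ω| / b) ∂P ≤ 6 := by
  rw [integral_eq_lintegral_of_nonneg_ae (Filter.Eventually.of_forall fun _ => (Real.exp_pos _).le)
    h.integrable_exp.aestronglyMeasurable]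
  exact ENNReal.toReal_le_of_le_ofReal (by norm_num) (h.2.trans_eq (by simp))

lemma SubExp.integrable_pow (h : SubExp b ξ P) (hb : 0 < b) (k : ℕ) :
    Integrable (fun ω => |ξ ω| ^ k) P := by
  refine (h.integrable_exp.const_mul (k.factorial * b ^ k)).mono'
    ((measurable_abs.comp h.1).pow_const k).aestronglyMeasurable
    (Filter.Eventually.of_forall fun ω => ?_)
  rw [Real.norm_eq_abs, abs_of_nonneg (by positivity)]
  exact abs_pow_le_mul_exp hb _ k

lemma SubExp.integral_pow_le (h : SubExp b ξ P) (hb : 0 < b) (k : ℕ) :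
    ∫ ω, |ξ ω| ^ k ∂P ≤ 6 * (k.factorial * b ^ k) := by
  calc ∫ ω, |ξ ω| ^ k ∂P ≤ ∫ ω, k.factorial * b ^ k * Real.exp (|ξ ω| / b) ∂P :=
        integral_mono (h.integrable_pow hb k) (h.integrable_exp.const_mul _)
          fun ω => abs_pow_le_mul_exp hb _ k
    _ = k.factorial * b ^ k * ∫ ω, Real.exp (|ξ ω| / b) ∂P := integral_const_mul _ _
    _ ≤ k.factorial * b ^ k * 6 := by
        exact mul_le_mul_of_nonneg_left h.integral_exp_le (by positivity)
    _ = _ := by ring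

lemma SubExp.integrable (h : SubExp b ξ P) (hb : 0 < b) : Integrable ξ P := by
  have := h.integrable_pow hb 1
  simp only [pow_one] at this
  exact (integrable_norm_iff h.1.aestronglyMeasurable).1 this

lemma SubExp.memLp (h : SubExp b ξ P) (hb : 0 < b) : MemLp ξ 2 P := by
  rw [memLp_two_iff_integrable_sq h.1.aestronglyMeasurable]
  simpa using h.integrable_pow hb 2

lemma SubExp.integral_abs_pow_three_le (h : SubExp b ξ P) (hb : 0 < b) :
    ∫ ω, |ξ ω| ^ 3 ∂P ≤ 66 * b ^ 3 := by
  have := h.integral_pow_le hb 3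
  norm_num [Nat.factorial] at this
  have : 0 < b ^ 3 := by positivity
  linarith

lemma SubExp.integral_abs_pow_six_le (h : SubExp b ξ P) (hb : 0 < b) :
    ∫ ω, (|ξ ω| ^ 3) ^ 2 ∂P ≤ (66 * b ^ 3) ^ 2 := by
  have := h.integral_pow_le hb 6
  norm_num [Nat.factorial] at this
  have : 0 < b ^ 6 := by positivity
  simp only [← pow_mul]
  norm_num
  nlinarith

lemma SubExp.integrable_abs_pow_six (h : SubExp b ξ P) (hb : 0 < b) :
    Integrable (fun ω => (|ξ ω| ^ 3) ^ 2) P := by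
  simpa only [← pow_mul] using h.integrable_pow hb 6

lemma SubExp.measureReal_lt_abs_le [IsFiniteMeasure P] (h : SubExp b ξ P) (hb : 0 < b) (r : ℝ) :
    P.real {ω | r < |ξ ω|} ≤ 6 * Real.exp (-(r / b)) := by
  have h1 := mul_meas_ge_le_integral_of_nonneg
    (Filter.Eventually.of_forall fun ω => (Real.exp_pos (|ξ ω| / b)).le)
    h.integrable_exp (Real.exp (r / b))
  have h2 : P.real {ω | r < |ξ ω|} ≤ P.real {ω | Real.exp (r / b) ≤ Real.exp (|ξ ω| / b)} := by
    refine measureReal_mono fun ω (hω : r < |ξ ω|) => ?_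
    exact Real.exp_le_exp.2 (div_le_div_of_nonneg_right hω.le hb.le)
  rw [Real.exp_neg, ← div_eq_mul_inv, le_div_iff₀ (Real.exp_pos _), mul_comm]
  exact (mul_le_mul_of_nonneg_left h2 (Real.exp_pos _).le).trans (h1.trans h.integral_exp_le)

/-- An average of subexponential variables is subexponential. -/
lemma SubExp.sum_div {κ : Type*} {s : Finset κ} (hs : s.Nonempty) {M : ℝ} (hM : s.card ≤ M)
    (hb : 0 < b) {ξ : κ → Ω → ℝ} (h : ∀ t, SubExp b (ξ t) P) :
    SubExp b (fun ω => (∑ t ∈ s, ξ t ω) / M) P := by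
  refine ⟨(Finset.measurable_sum s fun t _ => (h t).1).div_const M, ?_⟩
  have hN : (0 : ℝ) < s.card := by exact_mod_cast hs.card_pos
  have hM0 := hN.trans_le hM
  have hpt : ∀ ω, ENNReal.ofReal (Real.exp (|(∑ t ∈ s, ξ t ω) / M| / b)) ≤
      (s.card : ℝ≥0∞)⁻¹ * ∑ t ∈ s, ENNReal.ofReal (Real.exp (|ξ t ω| / b)) := by
    intro ω
    rw [← ENNReal.ofReal_sum_of_nonneg fun _ _ => (Real.exp_pos _).le,
      ← ENNReal.ofReal_natCast, ← ENNReal.ofReal_inv_of_pos hN,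
      ← ENNReal.ofReal_mul (by positivity)]
    refine ENNReal.ofReal_le_ofReal ?_
    -- Jensen for the exponential: the average needs no independence and keeps both the scale b and
    -- the bound 6. Dividing by M rather than by the cardinality only shrinks it.
    have hj := convexOn_exp.map_sum_le (t := s) (w := fun _ => (s.card : ℝ)⁻¹)
      (p := fun t => |ξ t ω| / b) (fun _ _ => by positivity) (by simp [hN.ne'])
      (fun _ _ => Set.mem_univ _)
    simp only [smul_eq_mul, ← Finset.mul_sum] at hj
    refine le_trans (Real.exp_le_exp.2 ?_) hj
    rw [abs_div, abs_of_pos hM0, ← Finset.sum_div, div_le_iff₀ hb, mul_assoc,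
      div_mul_cancel₀ _ hb.ne', inv_mul_eq_div]
    exact div_le_div₀ (Finset.sum_nonneg fun _ _ => abs_nonneg _)
      (Finset.abs_sum_le_sum_abs _ _) hN hM
  calc _ ≤ ∫⁻ ω, (s.card : ℝ≥0∞)⁻¹ * ∑ t ∈ s, ENNReal.ofReal (Real.exp (|ξ t ω| / b)) ∂P :=
        lintegral_mono hpt
    _ = (s.card : ℝ≥0∞)⁻¹ * ∑ t ∈ s, ∫⁻ ω, ENNReal.ofReal (Real.exp (|ξ t ω| / b)) ∂P := by
        have hm : ∀ t, Measurable fun ω => ENNReal.ofReal (Real.exp (|ξ t ω| / b)) := fun t =>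
          ENNReal.measurable_ofReal.comp (Real.measurable_exp.comp
            ((measurable_abs.comp (h t).1).div_const b))
        rw [lintegral_const_mul _ (Finset.measurable_sum s fun t _ => hm t),
          lintegral_finsetSum _ fun t _ => hm t]
    _ ≤ (s.card : ℝ≥0∞)⁻¹ * ∑ t ∈ s, 6 := by
        gcongr with t _; exact (h t).2
    _ = 6 := by
        rw [Finset.sum_const, nsmul_eq_mul, ← mul_assoc, ENNReal.inv_mul_cancel, one_mul]
        · exact_mod_cast hs.card_pos.ne'
        · exact ENNReal.natCast_ne_top _

end Moments

/-! ### Independence of separated index blocks -/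

section Blocks

variable {Ω E : Type*} [MeasurableSpace Ω] [MeasurableSpace E] {P : Measure Ω}
  [IsProbabilityMeasure P] {n m : ℕ} {X : Fin n → Ω → E}

lemma indepFun_of_isEmpty_right {κ β : Type*} [IsEmpty κ] [MeasurableSpace β]
    (f : Ω → β) (g : Ω → κ → E) : IndepFun f g P := by
  have : g = fun _ => isEmptyElim := funext fun _ => Subsingleton.elim _ _
  rw [this]
  exact indepFun_const_right _ _

/-- With r exclusive, the last index on the left is r - 1, so a gap r + m ≤ s already exceeds m. The
degenerate ranges are independent for want of indices. -/
lemma IsMDependent.indepFun_lt_le (h : IsMDependent m X P) {r s : ℕ} (hrs : r + m ≤ s) :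
    IndepFun (fun ω (t : {t : Fin n // (t : ℕ) < r}) => X t ω)
      (fun ω (t : {t : Fin n // s ≤ (t : ℕ)}) => X t ω) P := by
  rcases Nat.eq_zero_or_pos r with rfl | hr
  · have : IsEmpty {t : Fin n // (t : ℕ) < 0} := ⟨fun t => absurd t.2 (by simp)⟩
    exact (indepFun_of_isEmpty_right _ _).symm
  by_cases hs : s < n
  · have h1 := h ⟨r - 1, by omega⟩ ⟨s, hs⟩ (by simp; omega)
    have h2 := h1.comp
      (φ := fun x (t : {t : Fin n // (t : ℕ) < r}) =>
        x ⟨t.1, by rw [Fin.le_def]; have := t.2; simp; omega⟩)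
      (ψ := fun x (t : {t : Fin n // s ≤ (t : ℕ)}) => x ⟨t.1, by rw [Fin.le_def]; exact t.2⟩)
      (measurable_pi_lambda _ fun _ => measurable_pi_apply _)
      (measurable_pi_lambda _ fun _ => measurable_pi_apply _)
    exact h2
  · have : IsEmpty {t : Fin n // s ≤ (t : ℕ)} := ⟨fun t => by have := t.2; have := t.1.2; omega⟩
    exact indepFun_of_isEmpty_right _ _

/-- If `f` is independent of `(g, k)` and `(f, g)` is independent of `k`, then `g` is independent
of `(f, k)`. -/
lemma indepFun_middle {A B C : Type*} [MeasurableSpace A] [MeasurableSpace B] [MeasurableSpace C]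
    {f : Ω → A} {g : Ω → B} {k : Ω → C} (hf : Measurable f) (hg : Measurable g)
    (hk : Measurable k) (h1 : IndepFun f (fun ω => (g ω, k ω)) P)
    (h2 : IndepFun (fun ω => (f ω, g ω)) k P) : IndepFun g (fun ω => (f ω, k ω)) P := by
  have hgk : IndepFun g k P := h2.comp measurable_snd measurable_id
  have hfk : IndepFun f k P := h1.comp measurable_id measurable_snd
  rw [indepFun_iff_map_prod_eq_prod_map_map hg.aemeasurable (hf.prodMk hk).aemeasurable]
  rw [indepFun_iff_map_prod_eq_prod_map_map hf.aemeasurable (hg.prodMk hk).aemeasurable] at h1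
  rw [indepFun_iff_map_prod_eq_prod_map_map hg.aemeasurable hk.aemeasurable] at hgk
  rw [indepFun_iff_map_prod_eq_prod_map_map hf.aemeasurable hk.aemeasurable] at hfk
  have := Measure.isProbabilityMeasure_map (μ := P) hf.aemeasurable
  have := Measure.isProbabilityMeasure_map (μ := P) hg.aemeasurable
  have := Measure.isProbabilityMeasure_map (μ := P) hk.aemeasurable
  rw [hfk]
  -- Both independence hypotheses factor the probability of a box into the three marginals, so the
  -- required law can be checked on boxes.
  refine Measure.ext_prod₃ fun {s t u} hs ht hu => ?_
  rw [Measure.prod_prod, Measure.prod_prod,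
    Measure.map_apply (hg.prodMk (hf.prodMk hk)) (hs.prod (ht.prod hu))]
  have h3 := congrArg (fun μ => μ (t ×ˢ s ×ˢ u)) h1
  simp only [hgk, Measure.prod_prod] at h3
  rw [Measure.map_apply (hf.prodMk (hg.prodMk hk)) (ht.prod (hs.prod hu))] at h3
  rw [mul_left_comm, ← h3]
  congr 1
  ext ω
  simp [and_left_comm]

/-- A block is independent of everything at distance more than `m` from it. -/
lemma IsMDependent.indepFun_block_far (h : IsMDependent m X P) (hX : ∀ t, Measurable (X t))
    (lo hi : ℕ) (hlh : lo ≤ hi) :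
    IndepFun (fun ω (t : {t : Fin n // lo ≤ (t : ℕ) ∧ (t : ℕ) < hi}) => X t ω)
      (fun ω (t : {t : Fin n // (t : ℕ) + m < lo ∨ hi + m ≤ (t : ℕ)}) => X t ω) P := by
  have hmeas : ∀ q : Fin n → Prop, Measurable fun ω (t : {t : Fin n // q t}) => X t ω :=
    fun q => measurable_pi_lambda _ fun t => hX t
  -- m-dependence provides only one cut at a time, so the left and right cuts are treated separately
  -- and merged by `indepFun_middle`. If lo ≤ m, the truncated subtraction makes the left part
  -- empty.
  have h1 : IndepFun (fun ω (t : {t : Fin n // (t : ℕ) < lo - m}) => X t ω)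
      (fun ω => (fun t : {t : Fin n // lo ≤ (t : ℕ) ∧ (t : ℕ) < hi} => X t ω,
        fun t : {t : Fin n // hi + m ≤ (t : ℕ)} => X t ω)) P := by
    rcases Nat.lt_or_ge m lo with hm | hm
    · let ψ : ({t : Fin n // lo ≤ (t : ℕ)} → E) → ({t : Fin n // lo ≤ (t : ℕ) ∧ (t : ℕ) < hi} → E)
          × ({t : Fin n // hi + m ≤ (t : ℕ)} → E) := fun x =>
        (fun t => x ⟨t.1, t.2.1⟩, fun t => x ⟨t.1, by have := t.2; omega⟩)
      have hψ : Measurable ψ := (measurable_pi_lambda _ fun _ => measurable_pi_apply _).prodMk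
        (measurable_pi_lambda _ fun _ => measurable_pi_apply _)
      exact (h.indepFun_lt_le (r := lo - m) (s := lo) (by omega)).comp measurable_id hψ
    · have : IsEmpty {t : Fin n // (t : ℕ) < lo - m} := ⟨fun t => by have := t.2; omega⟩
      exact (indepFun_of_isEmpty_right _ _).symm
  have h2 : IndepFun (fun ω => (fun t : {t : Fin n // (t : ℕ) < lo - m} => X t ω,
        fun t : {t : Fin n // lo ≤ (t : ℕ) ∧ (t : ℕ) < hi} => X t ω))
      (fun ω (t : {t : Fin n // hi + m ≤ (t : ℕ)}) => X t ω) P := by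
    let φ : ({t : Fin n // (t : ℕ) < hi} → E) → ({t : Fin n // (t : ℕ) < lo - m} → E)
        × ({t : Fin n // lo ≤ (t : ℕ) ∧ (t : ℕ) < hi} → E) := fun x =>
      (fun t => x ⟨t.1, by have := t.2; omega⟩, fun t => x ⟨t.1, t.2.2⟩)
    have hφ : Measurable φ := (measurable_pi_lambda _ fun _ => measurable_pi_apply _).prodMk
      (measurable_pi_lambda _ fun _ => measurable_pi_apply _)
    exact (h.indepFun_lt_le (r := hi) (s := hi + m) le_rfl).comp hφ measurable_id
  have h3 := indepFun_middle (hmeas _) (hmeas _) (hmeas _) h1 h2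
  let ψ : ({t : Fin n // (t : ℕ) < lo - m} → E) × ({t : Fin n // hi + m ≤ (t : ℕ)} → E) →
      {t : Fin n // (t : ℕ) + m < lo ∨ hi + m ≤ (t : ℕ)} → E := fun x t =>
    if ht : (t.1 : ℕ) + m < lo then x.1 ⟨t.1, by omega⟩ else x.2 ⟨t.1, t.2.resolve_left ht⟩
  have hψ : Measurable ψ := measurable_pi_lambda _ fun t => by
    by_cases ht : (t.1 : ℕ) + m < lo
    · simp only [ψ, ht, dif_pos]; fun_prop
    · simp only [ψ, ht, dif_neg, not_false_eq_true]; fun_prop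
  have h4 := h3.comp (φ := id) (ψ := ψ) measurable_id hψ
  refine h4.congr (Filter.EventuallyEq.rfl) (Filter.Eventually.of_forall fun ω => ?_)
  ext t
  simp only [Function.comp_apply, ψ]
  split_ifs <;> rfl

end Blocks

/-! ### Expansion around a vector with local dependence -/

section Pointwise

variable {ι : Type*} [Fintype ι] {δ K : ℝ} (c : SmoothCutoff δ K)

lemma SmoothCutoff.continuous_g0 : Continuous c.g0 :=
  continuous_iff_continuousAt.2 fun y => (c.deriv0 y).continuousAt

lemma SmoothCutoff.continuous_g1 : Continuous c.g1 :=
  continuous_iff_continuousAt.2 fun y => (c.deriv1 y).continuousAt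

lemma SmoothCutoff.continuous_g2 : Continuous c.g2 :=
  continuous_iff_continuousAt.2 fun y => (c.deriv2 y).continuousAt

lemma continuous_smoothInd [Nonempty ι] (β : ℝ) :
    Continuous fun x : ι → ℝ => smoothInd c β x :=
  c.continuous_g0.comp (continuous_softmax β)

/-- The gradient entries of `smoothInd`. -/
def smoothGrad (c : SmoothCutoff δ K) (β : ℝ) (x : ι → ℝ) (j : ι) : ℝ :=
  c.g1 (softmax β x) * gibbs β x j

lemma smoothD1_eq_sum (β : ℝ) (x a : ι → ℝ) :
    smoothD1 c β x a = ∑ j, smoothGrad c β x j * a j := by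
  simp only [smoothD1, gibbsMean, smoothGrad, Finset.mul_sum, mul_assoc]

lemma continuous_smoothGrad (β : ℝ) (j : ι) :
    Continuous fun x : ι → ℝ => smoothGrad c β x j :=
  have : Nonempty ι := ⟨j⟩
  (c.continuous_g1.comp (continuous_softmax β)).mul (continuous_gibbs β j)

lemma abs_smoothGrad_le (hδ : 0 < δ) (hK : 0 ≤ K) (β : ℝ) (x : ι → ℝ) (j : ι) :
    |smoothGrad c β x j| ≤ K * δ⁻¹ := by
  have : Nonempty ι := ⟨j⟩
  rw [smoothGrad, abs_mul, abs_of_nonneg (gibbs_nonneg β x j)]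
  exact (mul_le_of_le_one_right (abs_nonneg _) (gibbs_le_one β x j)).trans
    (c.abs_g1_le hδ hK _)

lemma continuous_smoothHess [DecidableEq ι] (β : ℝ) (j k : ι) :
    Continuous fun x : ι → ℝ => smoothHess c β x j k := by
  have : Nonempty ι := ⟨j⟩
  have h1 := c.continuous_g1.comp (continuous_softmax (ι := ι) β)
  have h2 := c.continuous_g2.comp (continuous_softmax (ι := ι) β)
  have hj := continuous_gibbs β j
  have hk := continuous_gibbs β k
  unfold smoothHess
  refine (h2.mul (hj.mul hk)).add (h1.mul (continuous_const.mul (Continuous.sub ?_ (hj.mul hk))))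
  split_ifs
  · exact hj
  · exact continuous_const

lemma abs_smoothHess_le [DecidableEq ι] (hδ : 0 < δ) (hK : 0 ≤ K) {β : ℝ} (hβ : 0 ≤ β)
    (x : ι → ℝ) (j k : ι) :
    |smoothHess c β x j k| ≤ K * δ⁻¹ ^ 2 + K * δ⁻¹ * β := by
  have : Nonempty ι := ⟨j⟩
  have j0 := gibbs_nonneg β x j
  have j1 := gibbs_le_one β x j
  have k0 := gibbs_nonneg β x k
  have k1 := gibbs_le_one β x k
  have p0 := mul_nonneg j0 k0
  have p1 := mul_le_one₀ j1 k0 k1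
  have h1 : |(if j = k then gibbs β x j else 0) - gibbs β x j * gibbs β x k| ≤ 1 := by
    rw [abs_le]; split_ifs <;> constructor <;> linarith
  unfold smoothHess
  refine (abs_add_le _ _).trans ?_
  rw [abs_mul, abs_mul (c.g1 _), abs_mul β, abs_of_nonneg hβ, abs_of_nonneg p0]
  have e1 := mul_le_mul (c.abs_g2_le hδ hK (softmax β x)) p1 p0 (by positivity)
  have e2 := mul_le_mul (c.abs_g1_le hδ hK (softmax β x)) (mul_le_mul_of_nonneg_left h1 hβ)
    (by positivity) (by positivity)
  linarith

lemma continuous_smoothD1 [Nonempty ι] (β : ℝ) :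
    Continuous fun z : (ι → ℝ) × (ι → ℝ) => smoothD1 c β z.1 z.2 := by
  simp only [smoothD1_eq_sum]
  exact continuous_finsetSum _ fun j _ => ((continuous_smoothGrad c β j).comp continuous_fst).mul
    ((continuous_apply j).comp continuous_snd)

lemma continuous_smoothD2 [Nonempty ι] (β : ℝ) :
    Continuous fun z : (ι → ℝ) × (ι → ℝ) × (ι → ℝ) => smoothD2 c β z.1 z.2.1 z.2.2 := by
  classical
  simp only [smoothD2_eq_sum]
  exact continuous_finsetSum _ fun j _ => continuous_finsetSum _ fun k _ =>
    ((continuous_smoothHess c β j k).comp continuous_fst).mul (by fun_prop)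

lemma smoothD2_mul_right (β : ℝ) (x a b : ι → ℝ) (r : ℝ) :
    smoothD2 c β x a (fun j => r * b j) = r * smoothD2 c β x a b := by
  classical
  simp only [smoothD2_eq_sum, Finset.mul_sum]
  exact Finset.sum_congr rfl fun j _ => Finset.sum_congr rfl fun k _ => by ring

/-- Majorant of the Gibbs weights at points close to `z` lying near the boundary. -/
def nearWeight (β δ : ℝ) (z : ι → ℝ) (j : ι) : ℝ :=
  8 * (gibbs β z j * (Set.Icc 0 (3 * δ)).indicator 1 (softmax β z))

lemma nearWeight_nonneg (β δ : ℝ) (z : ι → ℝ) (j : ι) : 0 ≤ nearWeight β δ z j :=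
  mul_nonneg (by norm_num) (mul_nonneg (gibbs_nonneg β z j)
    (Set.indicator_nonneg (fun _ _ => zero_le_one) _))

/-- The number e plays the role of the indicator of an exceptional event. On it the weights are
merely bounded by one; off it y is within 1/β ≤ δ of z, which widens the strip [δ, 2δ] to [0, 3δ]
and costs the factor e² ≤ 8 in the weights. -/
lemma indicator_mul_gibbsMean_le [Nonempty ι] {β : ℝ} (hδ : 0 < δ) (hβ : 1 ≤ β * δ)
    {y z q : ι → ℝ} (hq : ∀ j, 0 ≤ q j) {e : ℝ} (he : 0 ≤ e)
    (h : 1 ≤ e ∨ ∀ j, |y j - z j| ≤ β⁻¹) :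
    (Set.Icc δ (2 * δ)).indicator 1 (softmax β y) * gibbsMean β y q
      ≤ ∑ j, (nearWeight β δ z j + e) * q j := by
  have hβ0 : 0 < β := pos_of_mul_pos_left (zero_lt_one.trans_le hβ) hδ.le
  rw [gibbsMean, Finset.mul_sum]
  refine Finset.sum_le_sum fun j _ => ?_
  rw [← mul_assoc]
  refine mul_le_mul_of_nonneg_right ?_ (hq j)
  have hw := nearWeight_nonneg β δ z j
  by_cases hy : softmax β y ∈ Set.Icc δ (2 * δ)
  · rw [Set.indicator_of_mem hy, Pi.one_apply, one_mul]
    rcases h with h | h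
    · linarith [gibbs_le_one β y j]
    · have hi : β⁻¹ ≤ δ := by rwa [inv_le_iff_one_le_mul₀' hβ0]
      have h1 := softmax_le_add hβ0 h
      have h2 := softmax_le_add hβ0 (fun j => (abs_sub_comm (z j) (y j)).trans_le (h j))
      have hz : softmax β z ∈ Set.Icc 0 (3 * δ) := ⟨by linarith [hy.1], by linarith [hy.2]⟩
      have h3 := gibbs_le_exp_mul hβ0 h j
      rw [mul_inv_cancel₀ hβ0.ne', mul_one] at h3
      have h4 : Real.exp 2 ≤ 8 := by
        have := Real.exp_one_lt_d9
        have e2 : Real.exp 2 = Real.exp 1 * Real.exp 1 := by rw [← Real.exp_add]; norm_num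
        have := Real.exp_pos 1
        rw [e2]; nlinarith
      have h5 : nearWeight β δ z j = 8 * gibbs β z j := by
        simp [nearWeight, Set.indicator_of_mem hz]
      rw [h5]
      nlinarith [gibbs_nonneg β z j]
  · rw [Set.indicator_of_notMem hy, zero_mul]
    linarith

lemma sum_nearWeight [Nonempty ι] (β δ : ℝ) (z : ι → ℝ) :
    ∑ j, nearWeight β δ z j = 8 * (Set.Icc 0 (3 * δ)).indicator 1 (softmax β z) := by
  simp only [nearWeight, ← Finset.mul_sum, ← Finset.sum_mul, sum_gibbs, one_mul]

lemma measurable_nearWeight (β δ : ℝ) (j : ι) :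
    Measurable fun z : ι → ℝ => nearWeight β δ z j := by
  have : Nonempty ι := ⟨j⟩
  unfold nearWeight
  refine ((continuous_gibbs β j).measurable.mul ?_).const_mul 8
  exact (measurable_one.indicator measurableSet_Icc).comp (continuous_softmax β).measurable

lemma nearWeight_le (β δ : ℝ) (z : ι → ℝ) (j : ι) : nearWeight β δ z j ≤ 8 := by
  have : Nonempty ι := ⟨j⟩
  have h1 := Finset.single_le_sum (f := nearWeight β δ z) (fun k _ => nearWeight_nonneg β δ z k)
    (Finset.mem_univ j)
  rw [sum_nearWeight] at h1
  refine h1.trans (mul_le_of_le_one_right (by norm_num) ?_)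
  exact Set.indicator_le_self' (fun _ _ => zero_le_one) _

end Pointwise

/-! ### Expected remainders: Gibbs weights independent of the cubes, plus an exceptional event. -/

section Expectation

lemma integrable_mul_of_bdd {Ω : Type*} [MeasurableSpace Ω] {P : Measure Ω} {f g : Ω → ℝ}
    (hf : Measurable f) {C : ℝ} (hC : ∀ ω, |f ω| ≤ C)
    (hg : Integrable g P) : Integrable (fun ω => f ω * g ω) P :=
  hg.bdd_mul hf.aestronglyMeasurable (Filter.Eventually.of_forall hC)


variable {ι : Type*} [Fintype ι] [Nonempty ι] {Ω : Type*} [MeasurableSpace Ω] {P : Measure Ω}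
  [IsProbabilityMeasure P]

/-- Cauchy–Schwarz in the form used for exceptional events. -/
lemma integral_indicator_mul_le {A : Set Ω} (hA : MeasurableSet A) {q : Ω → ℝ} {Q ε : ℝ}
    (hQ : 0 < Q) (hε : 0 < ε) (hPA : P.real A ≤ ε ^ 2) (hq : Integrable q P)
    (hq2 : Integrable (fun ω => q ω ^ 2) P) (hQ2 : ∫ ω, q ω ^ 2 ∂P ≤ Q ^ 2) :
    ∫ ω, A.indicator 1 ω * q ω ∂P ≤ Q * ε := by
  have hi : Integrable (fun ω => A.indicator (1 : Ω → ℝ) ω) P :=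
    (integrable_const (1 : ℝ)).indicator hA
  -- The inequality 2xy ≤ x² + y² with weights Q/ε and ε/Q, chosen so that the two resulting
  -- expectations balance.
  have hpt : ∀ ω, A.indicator (1 : Ω → ℝ) ω * q ω
      ≤ (Q / ε / 2) * A.indicator 1 ω + (ε / Q / 2) * q ω ^ 2 := by
    intro ω
    by_cases hω : ω ∈ A
    · rw [Set.indicator_of_mem hω, Pi.one_apply, one_mul, mul_one]
      have : Q / ε / 2 + ε / Q / 2 * q ω ^ 2 - q ω = (ε / Q / 2) * (q ω - Q / ε) ^ 2 := by
        field_simp; ring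
      have h0 : 0 ≤ (ε / Q / 2) * (q ω - Q / ε) ^ 2 := by positivity
      linarith
    · rw [Set.indicator_of_notMem hω, zero_mul, mul_zero, zero_add]
      positivity
  have hm : ∀ ω, |A.indicator (1 : Ω → ℝ) ω| ≤ 1 := fun ω => by
    by_cases hω : ω ∈ A <;> simp [hω]
  calc ∫ ω, A.indicator 1 ω * q ω ∂P
      ≤ ∫ ω, ((Q / ε / 2) * A.indicator 1 ω + (ε / Q / 2) * q ω ^ 2) ∂P :=
        integral_mono (integrable_mul_of_bdd (measurable_one.indicator hA) hm hq)
          ((hi.const_mul _).add (hq2.const_mul _)) hpt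
    _ = (Q / ε / 2) * P.real A + (ε / Q / 2) * ∫ ω, q ω ^ 2 ∂P := by
        rw [integral_add (hi.const_mul _) (hq2.const_mul _), integral_const_mul,
          integral_const_mul, integral_indicator_one hA]
    _ ≤ (Q / ε / 2) * ε ^ 2 + (ε / Q / 2) * Q ^ 2 := by gcongr
    _ = Q * ε := by field_simp; ring

lemma measureReal_le_of_le_sq {A : Set Ω} {ε : ℝ} (hε : 0 < ε) (h : P.real A ≤ ε ^ 2) :
    P.real A ≤ ε := by
  rcases le_total ε 1 with h1 | h1
  · nlinarith
  · exact measureReal_le_one.trans h1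

/-- Expected size of a remainder whose weights are independent of its cubes. -/
lemma integral_sum_nearWeight_mul_le {β δ : ℝ} {z : Ω → ι → ℝ} (hz : Measurable z)
    {q : ι → Ω → ℝ} (hqm : ∀ j, Measurable (q j))
    (hq2 : ∀ j, Integrable (fun ω => q j ω ^ 2) P) {Q ε : ℝ} (hQ : 0 < Q) (hε : 0 < ε)
    (hQ1 : ∀ j, ∫ ω, q j ω ∂P ≤ Q) (hQ2 : ∀ j, ∫ ω, q j ω ^ 2 ∂P ≤ Q ^ 2)
    (hind : ∀ j, IndepFun z (q j) P) {A N : Set Ω} (hA : MeasurableSet A)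
    (hPA : P.real A ≤ ε ^ 2) (hN : MeasurableSet N)
    (hsub : ∀ ω, softmax β (z ω) ∈ Set.Icc 0 (3 * δ) → ω ∈ N ∪ A) :
    Integrable (fun ω => ∑ j, (nearWeight β δ (z ω) j + A.indicator 1 ω) * q j ω) P ∧
    ∫ ω, ∑ j, (nearWeight β δ (z ω) j + A.indicator 1 ω) * q j ω ∂P
      ≤ Q * (8 * P.real N + 9 * (Fintype.card ι * ε)) := by
  have hq : ∀ j, Integrable (q j) P := fun j =>
    ((memLp_two_iff_integrable_sq (hqm j).aestronglyMeasurable).2 (hq2 j)).integrable one_le_two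
  have hwm : ∀ j, Measurable fun ω => nearWeight β δ (z ω) j := fun j =>
    (measurable_nearWeight β δ j).comp hz
  have hw8 : ∀ j ω, |nearWeight β δ (z ω) j| ≤ 8 := fun j ω => by
    rw [abs_of_nonneg (nearWeight_nonneg _ _ _ _)]; exact nearWeight_le _ _ _ _
  have hAm : ∀ ω, |A.indicator (1 : Ω → ℝ) ω| ≤ 1 := fun ω => by
    by_cases hω : ω ∈ A <;> simp [hω]
  have i1 : ∀ j, Integrable (fun ω => nearWeight β δ (z ω) j * q j ω) P := fun j =>
    integrable_mul_of_bdd (hwm j) (hw8 j) (hq j)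
  have i2 : ∀ j, Integrable (fun ω => A.indicator 1 ω * q j ω) P := fun j =>
    integrable_mul_of_bdd (measurable_one.indicator hA) hAm (hq j)
  have hwi : ∀ j, Integrable (fun ω => nearWeight β δ (z ω) j) P := fun j =>
    Integrable.of_bound (hwm j).aestronglyMeasurable 8 (Filter.Eventually.of_forall (hw8 j))
  have i3 : ∀ j, Integrable (fun ω => (nearWeight β δ (z ω) j + A.indicator 1 ω) * q j ω) P :=
    fun j => by simpa only [add_mul] using! (i1 j).add (i2 j)
  refine ⟨integrable_finsetSum _ fun j _ => i3 j, ?_⟩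
  rw [integral_finsetSum _ fun j _ => i3 j]
  have step : ∀ j, ∫ ω, (nearWeight β δ (z ω) j + A.indicator 1 ω) * q j ω ∂P
      ≤ Q * ∫ ω, nearWeight β δ (z ω) j ∂P + Q * ε := by
    intro j
    simp only [add_mul]
    rw [integral_add (i1 j) (i2 j)]
    -- Independence of the weight and the cube allows the moment bound Q to come out uniformly in j.
    have e1 : ∫ ω, nearWeight β δ (z ω) j * q j ω ∂P
        = (∫ ω, nearWeight β δ (z ω) j ∂P) * ∫ ω, q j ω ∂P :=
      ((hind j).comp (measurable_nearWeight β δ j) measurable_id).integral_fun_mul_eq_mul_integral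
        (hwm j).aestronglyMeasurable (hqm j).aestronglyMeasurable
    have h0 : 0 ≤ ∫ ω, nearWeight β δ (z ω) j ∂P :=
      integral_nonneg fun ω => nearWeight_nonneg _ _ _ _
    have := mul_le_mul_of_nonneg_left (hQ1 j) h0
    have := integral_indicator_mul_le hA hQ hε hPA (hq j) (hq2 j) (hQ2 j)
    rw [e1]; linarith
  refine (Finset.sum_le_sum fun j _ => step j).trans ?_
  -- Summed over j the weights collapse to the indicator of the strip, so the main term has no
  -- factor p; only the exceptional event pays it.
  rw [Finset.sum_add_distrib, ← Finset.mul_sum, ← integral_finsetSum _ fun j _ => hwi j]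
  simp only [sum_nearWeight, Finset.sum_const, Finset.card_univ, nsmul_eq_mul]
  have hpt : ∫ ω, 8 * (Set.Icc 0 (3 * δ)).indicator 1 (softmax β (z ω)) ∂P
      ≤ 8 * P.real (N ∪ A) := by
    rw [integral_const_mul]
    refine mul_le_mul_of_nonneg_left ?_ (by norm_num)
    rw [← integral_indicator_one (hN.union hA)]
    refine integral_mono_of_nonneg (Filter.Eventually.of_forall fun ω =>
      Set.indicator_nonneg (fun _ _ => zero_le_one) _)
      ((integrable_const (1 : ℝ)).indicator (hN.union hA)) (Filter.Eventually.of_forall fun ω => ?_)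
    by_cases h : softmax β (z ω) ∈ Set.Icc 0 (3 * δ)
    · simp only [Set.indicator_of_mem h, Set.indicator_of_mem (hsub ω h)]; exact le_rfl
    · simp only [Set.indicator_of_notMem h]
      exact Set.indicator_nonneg (fun _ _ => zero_le_one) _
  have hu := measureReal_union_le (μ := P) N A
  have hAε := measureReal_le_of_le_sq hε hPA
  have hc : (1 : ℝ) ≤ Fintype.card ι := by exact_mod_cast Fintype.card_pos
  have hcε : ε ≤ Fintype.card ι * ε := by nlinarith
  have : ∫ ω, 8 * (Set.Icc 0 (3 * δ)).indicator 1 (softmax β (z ω)) ∂P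
      ≤ 8 * P.real N + 8 * (Fintype.card ι * ε) := by linarith
  nlinarith

end Expectation

/-! ### Second-order expansion of one summand under local dependence. -/

section LocalExpansion

variable {ι : Type*} [Fintype ι] [Nonempty ι] {δ K : ℝ} {Ω : Type*} [MeasurableSpace Ω]
  {P : Measure Ω} [IsProbabilityMeasure P]

/-- Moments of a weighted sum of three cubes plus constants. -/
lemma cubes_moments {b : ℝ} (hb : 0 < b) {f g k : Ω → ℝ} (hf : SubExp b f P) (hg : SubExp b g P)
    (hk : SubExp b k P) :
    Integrable (fun ω => (|f ω| ^ 3 + 2 * |g ω| ^ 3 + |k ω| ^ 3) ^ 2) P ∧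
    ∫ ω, (|f ω| ^ 3 + 2 * |g ω| ^ 3 + |k ω| ^ 3) ∂P ≤ 4 * (66 * b ^ 3) ∧
    ∫ ω, (|f ω| ^ 3 + 2 * |g ω| ^ 3 + |k ω| ^ 3) ^ 2 ∂P ≤ (4 * (66 * b ^ 3)) ^ 2 := by
  have f3 := hf.integrable_pow hb 3
  have g3 := hg.integrable_pow hb 3
  have k3 := hk.integrable_pow hb 3
  have f6 := hf.integrable_abs_pow_six hb
  have g6 := hg.integrable_abs_pow_six hb
  have k6 := hk.integrable_abs_pow_six hb
  have hpt : ∀ ω, (|f ω| ^ 3 + 2 * |g ω| ^ 3 + |k ω| ^ 3) ^ 2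
      ≤ 4 * ((|f ω| ^ 3) ^ 2 + 2 * (|g ω| ^ 3) ^ 2 + (|k ω| ^ 3) ^ 2) := fun ω => by
    nlinarith [sq_nonneg (|f ω| ^ 3 - |g ω| ^ 3), sq_nonneg (|g ω| ^ 3 - |k ω| ^ 3),
      sq_nonneg (|f ω| ^ 3 - |k ω| ^ 3)]
  have hi := ((f6.add (g6.const_mul 2)).add k6).const_mul 4
  have hm : Measurable fun ω => (|f ω| ^ 3 + 2 * |g ω| ^ 3 + |k ω| ^ 3) ^ 2 := by
    have := hf.1; have := hg.1; have := hk.1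
    fun_prop
  have hi2 : Integrable (fun ω => (|f ω| ^ 3 + 2 * |g ω| ^ 3 + |k ω| ^ 3) ^ 2) P :=
    hi.mono' hm.aestronglyMeasurable (Filter.Eventually.of_forall fun ω => by
      rw [Real.norm_eq_abs, abs_of_nonneg (sq_nonneg _)]; exact hpt ω)
  refine ⟨hi2, ?_, ?_⟩
  · have fg3 : Integrable (fun ω => |f ω| ^ 3 + 2 * |g ω| ^ 3) P := f3.add (g3.const_mul 2)
    rw [integral_add fg3 k3, integral_add f3 (g3.const_mul 2),
      integral_const_mul]
    linarith [hf.integral_abs_pow_three_le hb, hg.integral_abs_pow_three_le hb,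
      hk.integral_abs_pow_three_le hb]
  · refine (integral_mono hi2 hi hpt).trans ?_
    have fg6 : Integrable (fun ω => (|f ω| ^ 3) ^ 2 + 2 * (|g ω| ^ 3) ^ 2) P :=
      f6.add (g6.const_mul 2)
    simp only [Pi.add_apply]
    rw [integral_const_mul, integral_add fg6 k6, integral_add f6 (g6.const_mul 2),
      integral_const_mul]
    linarith [hf.integral_abs_pow_six_le hb, hg.integral_abs_pow_six_le hb,
      hk.integral_abs_pow_six_le hb]

/-- Moments of the sum of a constant and a cube. -/
lemma const_add_cube_moments {b C : ℝ} (hb : 0 < b) (hC0 : 0 ≤ C) (hC : C ≤ 2 * (66 * b ^ 3))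
    {k : Ω → ℝ} (hk : SubExp b k P) :
    Integrable (fun ω => (C + |k ω| ^ 3) ^ 2) P ∧
    ∫ ω, (C + |k ω| ^ 3) ∂P ≤ 4 * (66 * b ^ 3) ∧
    ∫ ω, (C + |k ω| ^ 3) ^ 2 ∂P ≤ (4 * (66 * b ^ 3)) ^ 2 := by
  have hb3 : 0 < 66 * b ^ 3 := by positivity
  have k3 := hk.integrable_pow hb 3
  have k6 := hk.integrable_abs_pow_six hb
  have e : ∀ ω, (C + |k ω| ^ 3) ^ 2 = C ^ 2 + (2 * C * |k ω| ^ 3 + (|k ω| ^ 3) ^ 2) :=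
    fun ω => by ring
  have hi : Integrable (fun ω => 2 * C * |k ω| ^ 3 + (|k ω| ^ 3) ^ 2) P :=
    (k3.const_mul (2 * C)).add k6
  have m3 := hk.integral_abs_pow_three_le hb
  have m6 := hk.integral_abs_pow_six_le hb
  refine ⟨?_, ?_, ?_⟩
  · simp only [e]
    exact (integrable_const _).add hi
  · rw [integral_add (integrable_const _) k3]
    simp
    linarith
  · simp only [e]
    rw [integral_add (integrable_const _) hi, integral_add (k3.const_mul _) k6, integral_const_mul]
    simp
    nlinarith

variable (c : SmoothCutoff δ K)

/-- Averaging the second derivative over its directions. -/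
lemma integral_smoothD2_dir [DecidableEq ι] {Ω' : Type*} [MeasurableSpace Ω'] {μ : Measure Ω'}
    (β : ℝ) (x : ι → ℝ) {a d : Ω' → ι → ℝ}
    (h : ∀ j k, Integrable (fun ω => a ω j * d ω k) μ) :
    ∫ ω, smoothD2 c β x (a ω) (d ω) ∂μ
      = ∑ j, ∑ k, smoothHess c β x j k * ∫ ω, a ω j * d ω k ∂μ := by
  simp only [smoothD2_eq_sum]
  rw [integral_finsetSum _ fun j _ => integrable_finsetSum _ fun k _ => (h j k).const_mul _]
  refine Finset.sum_congr rfl fun j _ => ?_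
  rw [integral_finsetSum _ fun k _ => (h j k).const_mul _]
  exact Finset.sum_congr rfl fun k _ => integral_const_mul _ _

lemma integrable_smoothD1 (hδ : 0 < δ) (hK : 0 ≤ K) {Ω' : Type*} [MeasurableSpace Ω']
    {μ : Measure Ω'} (β : ℝ) {x a : Ω' → ι → ℝ} (hx : Measurable x) (ham : Measurable a)
    (ha : ∀ j, Integrable (fun ω => a ω j) μ) :
    Integrable (fun ω => smoothD1 c β (x ω) (a ω)) μ := by
  refine ((integrable_finsetSum Finset.univ fun j _ => (ha j).abs).const_mul (K * δ⁻¹)).mono'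
    ((continuous_smoothD1 c β).measurable.comp (hx.prodMk ham)).aestronglyMeasurable
    (Filter.Eventually.of_forall fun ω => abs_smoothD1_le c hδ hK β (x ω) (a ω))

lemma integrable_smoothD2 (hδ : 0 < δ) (hK : 0 ≤ K) {Ω' : Type*} [MeasurableSpace Ω']
    {μ : Measure Ω'} {β : ℝ} (hβ : 0 ≤ β) {x a d : Ω' → ι → ℝ} (hx : Measurable x)
    (ham : Measurable a) (hdm : Measurable d)
    (h : ∀ j k, Integrable (fun ω => a ω j * d ω k) μ) :
    Integrable (fun ω => smoothD2 c β (x ω) (a ω) (d ω)) μ := by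
  have hi : Integrable (fun ω => (∑ j, |a ω j|) * ∑ k, |d ω k|) μ := by
    simp only [Finset.sum_mul_sum, ← abs_mul]
    exact integrable_finsetSum _ fun j _ => integrable_finsetSum _ fun k _ => (h j k).abs
  exact (hi.const_mul _).mono'
    ((continuous_smoothD2 c β).measurable.comp (hx.prodMk (ham.prodMk hdm))).aestronglyMeasurable
    (Filter.Eventually.of_forall fun ω => abs_smoothD2_le c hδ hK hβ (x ω) (a ω) (d ω))

/-- The first derivative in an independent centered direction has mean zero. -/
lemma integral_smoothD1_eq_zero {β : ℝ} (hδ : 0 < δ) (hK : 0 ≤ K) {x a : Ω → ι → ℝ}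
    (hx : Measurable x) (ha : ∀ j, Integrable (fun ω => a ω j) P)
    (h0 : ∀ j, ∫ ω, a ω j ∂P = 0) (hind : IndepFun x a P) :
    ∫ ω, smoothD1 c β (x ω) (a ω) ∂P = 0 := by
  simp only [smoothD1_eq_sum]
  have hi : ∀ j, Integrable (fun ω => smoothGrad c β (x ω) j * a ω j) P := fun j =>
    integrable_mul_of_bdd ((continuous_smoothGrad c β j).measurable.comp hx)
      (fun ω => abs_smoothGrad_le c hδ hK β (x ω) j) (ha j)
  rw [integral_finsetSum _ fun j _ => hi j]
  refine Finset.sum_eq_zero fun j _ => ?_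
  have := (hind.comp (continuous_smoothGrad c β j).measurable
    (measurable_pi_apply j)).integral_fun_mul_eq_mul_integral
    ((continuous_smoothGrad c β j).measurable.comp hx).aestronglyMeasurable
    (ha j).aestronglyMeasurable
  simp only [Function.comp_apply] at this
  rw [this, h0 j, mul_zero]

/-- The mean second derivative in independent directions. -/
lemma integral_smoothD2_indep [DecidableEq ι] {β : ℝ} (hδ : 0 < δ) (hK : 0 ≤ K) (hβ : 0 ≤ β)
    {x a d : Ω → ι → ℝ}
    (hx : Measurable x) (h : ∀ j k, Integrable (fun ω => a ω j * d ω k) P)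
    (hind : IndepFun x (fun ω => (a ω, d ω)) P) :
    ∫ ω, smoothD2 c β (x ω) (a ω) (d ω) ∂P
      = ∫ ω, ∑ j, ∑ k, smoothHess c β (x ω) j k * ∫ ω', a ω' j * d ω' k ∂P ∂P := by
  have hHm : ∀ j k, Measurable fun ω => smoothHess c β (x ω) j k := fun j k =>
    (continuous_smoothHess c β j k).measurable.comp hx
  have hHb := fun j k ω => abs_smoothHess_le c hδ hK hβ (x ω) j k
  have i1 : ∀ j k, Integrable (fun ω => smoothHess c β (x ω) j k * (a ω j * d ω k)) P :=
    fun j k => integrable_mul_of_bdd (hHm j k) (hHb j k) (h j k)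
  have i2 : ∀ j k, Integrable (fun ω => smoothHess c β (x ω) j k *
      ∫ ω', a ω' j * d ω' k ∂P) P :=
    fun j k => integrable_mul_of_bdd (hHm j k) (hHb j k) (integrable_const _)
  simp only [smoothD2_eq_sum]
  rw [integral_finsetSum _ fun j _ => integrable_finsetSum _ fun k _ => i1 j k,
    integral_finsetSum _ fun j _ => integrable_finsetSum _ fun k _ => i2 j k]
  refine Finset.sum_congr rfl fun j _ => ?_
  rw [integral_finsetSum _ fun k _ => i1 j k, integral_finsetSum _ fun k _ => i2 j k]
  refine Finset.sum_congr rfl fun k _ => ?_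
  have := (hind.comp (φ := fun x => smoothHess c β x j k)
    (ψ := fun z : (ι → ℝ) × (ι → ℝ) => z.1 j * z.2 k)
    (continuous_smoothHess c β j k).measurable
    (by fun_prop)).integral_fun_mul_eq_mul_integral
    (hHm j k).aestronglyMeasurable (h j k).aestronglyMeasurable
  simp only [Function.comp_apply] at this
  rw [this, integral_mul_const]

/-- Third derivatives along a short segment are dominated by the weights at a nearby point. -/
lemma abs_smoothD3_segment_le (hδ : 0 < δ) (hK : 0 ≤ K) {β : ℝ} (hβ : 1 ≤ β * δ) {e : ℝ}
    (he : 0 ≤ e) {x v z a f g q : ι → ℝ}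
    (h : 1 ≤ e ∨ ∀ τ ∈ Set.Icc (0 : ℝ) 1, ∀ j, |x j - τ * v j - z j| ≤ β⁻¹)
    (hq : ∀ j, |a j| ^ 3 + |f j| ^ 3 + |g j| ^ 3 ≤ q j) :
    ∀ τ ∈ Set.Icc (0 : ℝ) 1, |smoothD3 c β (fun j => x j - τ * v j) a f g|
      ≤ 5 * K * δ⁻¹ * β ^ 2 * ∑ j, (nearWeight β δ z j + e) * q j := by
  intro τ hτ
  refine (abs_smoothD3_le c hδ hK hβ _ a f g).trans ?_
  refine mul_le_mul_of_nonneg_left ?_ (by positivity)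
  refine (indicator_mul_gibbsMean_le hδ hβ (z := z) (fun j => by positivity) he
    (h.imp id fun h j => h τ hτ j)).trans (Finset.sum_le_sum fun j _ => ?_)
  exact mul_le_mul_of_nonneg_left (hq j) (add_nonneg (nearWeight_nonneg _ _ _ _) he)

/-- Second-order expansion of `E[D f(x₀)[a]]` when `a` depends on `x₀` only through the
increments `r f`, and `(a, f)` only through the increment `r g`. -/
lemma local_expansion (hδ : 0 < δ) (hK : 0 ≤ K) {β : ℝ} (hβ : 1 ≤ β * δ)
    {b r ε : ℝ} (hb : 0 < b) (hr : 0 ≤ r) (hε : 0 < ε) {x0 z a f g : Ω → ι → ℝ}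
    (hx0 : Measurable x0) (hz : Measurable z)
    (ha : ∀ j, SubExp b (fun ω => a ω j) P) (hf : ∀ j, SubExp b (fun ω => f ω j) P)
    (hg : ∀ j, SubExp b (fun ω => g ω j) P) (ha0 : ∀ j, ∫ ω, a ω j ∂P = 0)
    (hi1 : IndepFun (fun ω j => x0 ω j - r * f ω j) a P)
    (hi2 : IndepFun (fun ω j => x0 ω j - r * g ω j) (fun ω => (a ω, f ω)) P)
    (hi3 : IndepFun z (fun ω => (a ω, f ω, g ω)) P)
    {A N : Set Ω} (hA : MeasurableSet A) (hPA : P.real A ≤ ε ^ 2) (hN : MeasurableSet N)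
    (hsub : ∀ ω, softmax β (z ω) ∈ Set.Icc 0 (3 * δ) → ω ∈ N ∪ A)
    (hnf : ∀ ω ∉ A, ∀ τ ∈ Set.Icc (0 : ℝ) 1, ∀ j, |x0 ω j - τ * (r * f ω j) - z ω j| ≤ β⁻¹)
    (hng : ∀ ω ∉ A, ∀ τ ∈ Set.Icc (0 : ℝ) 1, ∀ j, |x0 ω j - τ * (r * g ω j) - z ω j| ≤ β⁻¹) :
    |∫ ω, smoothD1 c β (x0 ω) (a ω) ∂P
        - r * ∫ ω, ∫ ω', smoothD2 c β (x0 ω) (a ω') (f ω') ∂P ∂P|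
      ≤ 3 * r ^ 2 * (5 * K * δ⁻¹ * β ^ 2) *
          (4 * (66 * b ^ 3) * (8 * P.real N + 9 * (Fintype.card ι * ε))) := by
  classical
  have hβ0 : 0 < β := pos_of_mul_pos_left (zero_lt_one.trans_le hβ) hδ.le
  have ham : Measurable a := measurable_pi_lambda _ fun j => (ha j).1
  have hfm : Measurable f := measurable_pi_lambda _ fun j => (hf j).1
  have hgm : Measurable g := measurable_pi_lambda _ fun j => (hg j).1
  have hai : ∀ j, Integrable (fun ω => a ω j) P := fun j => (ha j).integrable hb
  have hafi : ∀ j k, Integrable (fun ω => a ω j * f ω k) P := fun j k =>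
    ((ha j).memLp hb).integrable_mul ((hf k).memLp hb)
  have hx1 : Measurable fun ω j => x0 ω j - r * f ω j :=
    measurable_pi_lambda _ fun j => ((measurable_pi_apply j).comp hx0).sub ((hf j).1.const_mul r)
  have hx2 : Measurable fun ω j => x0 ω j - r * g ω j :=
    measurable_pi_lambda _ fun j => ((measurable_pi_apply j).comp hx0).sub ((hg j).1.const_mul r)
  set L := 5 * K * δ⁻¹ * β ^ 2 with hL
  have hL0 : 0 ≤ L := by positivity
  set E := 4 * (66 * b ^ 3) * (8 * P.real N + 9 * (Fintype.card ι * ε)) with hE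
  set I : Ω → ℝ := A.indicator 1 with hI
  have hI0 : ∀ ω, 0 ≤ I ω := fun ω => Set.indicator_nonneg (fun _ _ => zero_le_one) _
  have hI1 : ∀ ω, 1 ≤ I ω ∨ ω ∉ A := fun ω => by
    by_cases h : ω ∈ A
    · left; simp [hI, h]
    · exact Or.inr h
  -- One majorant serves two remainders: the Taylor remainder has directions a, f, f, hence the
  -- coefficient 2, and the increment of the second derivative has directions a, f, g.
  set q : ι → Ω → ℝ := fun j ω => |a ω j| ^ 3 + 2 * |f ω j| ^ 3 + |g ω j| ^ 3 with hq
  -- In the third remainder a and f come from an independent copy that is integrated out, which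
  -- leaves their third moments as constants.
  set C : ι → ℝ := fun j => ∫ ω, |a ω j| ^ 3 ∂P + ∫ ω, |f ω j| ^ 3 ∂P with hC
  set q' : ι → Ω → ℝ := fun j ω => C j + |g ω j| ^ 3 with hq'
  have hC0 : ∀ j, 0 ≤ C j := fun j => add_nonneg (integral_nonneg fun _ => by positivity)
    (integral_nonneg fun _ => by positivity)
  have hCle : ∀ j, C j ≤ 2 * (66 * b ^ 3) := fun j => by
    linarith [(ha j).integral_abs_pow_three_le hb, (hf j).integral_abs_pow_three_le hb]
  have mq := fun j => cubes_moments hb (ha j) (hf j) (hg j)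
  have mq' := fun j => const_add_cube_moments hb (hC0 j) (hCle j) (hg j)
  obtain ⟨iq, eq⟩ := integral_sum_nearWeight_mul_le (β := β) (δ := δ) hz (q := q)
    (fun j => by have := (ha j).1; have := (hf j).1; have := (hg j).1; fun_prop)
    (fun j => (mq j).1) (Q := 4 * (66 * b ^ 3)) (by positivity) hε (fun j => (mq j).2.1)
    (fun j => (mq j).2.2)
    (fun j => hi3.comp (φ := id)
      (ψ := fun w : (ι → ℝ) × (ι → ℝ) × (ι → ℝ) => |w.1 j| ^ 3 + 2 * |w.2.1 j| ^ 3 + |w.2.2 j| ^ 3)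
      measurable_id (by fun_prop)) hA hPA hN hsub
  obtain ⟨iq', eq'⟩ := integral_sum_nearWeight_mul_le (β := β) (δ := δ) hz (q := q')
    (fun j => by have := (hg j).1; fun_prop)
    (fun j => (mq' j).1) (Q := 4 * (66 * b ^ 3)) (by positivity) hε (fun j => (mq' j).2.1)
    (fun j => (mq' j).2.2)
    (fun j => hi3.comp (φ := id) (ψ := fun w : (ι → ℝ) × (ι → ℝ) × (ι → ℝ) => C j + |w.2.2 j| ^ 3)
      measurable_id (by fun_prop)) hA hPA hN hsub
  rw [← hE] at eq eq'
  set T2 : (ι → ℝ) → ℝ := fun x => ∑ j, ∑ k, smoothHess c β x j k * ∫ ω', a ω' j * f ω' k ∂P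
    with hT2
  have hT2eq : ∀ x, ∫ ω', smoothD2 c β x (a ω') (f ω') ∂P = T2 x := fun x =>
    integral_smoothD2_dir c β x hafi
  have hT2i : ∀ {x : Ω → ι → ℝ}, Measurable x → Integrable (fun ω => T2 (x ω)) P :=
    fun {x} hx => integrable_finsetSum _ fun j _ => integrable_finsetSum _ fun k _ =>
      integrable_mul_of_bdd ((continuous_smoothHess c β j k).measurable.comp hx)
        (fun ω => abs_smoothHess_le c hδ hK hβ0.le (x ω) j k) (integrable_const _)
  simp only [hT2eq]
  have r1 : ∀ ω, |smoothD1 c β (x0 ω) (a ω) - smoothD1 c β (fun j => x0 ω j - r * f ω j) (a ω)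
      - r * smoothD2 c β (x0 ω) (a ω) (f ω)|
      ≤ r ^ 2 * L * ∑ j, (nearWeight β δ (z ω) j + I ω) * q j ω := fun ω => by
    rw [← smoothD2_mul_right]
    refine abs_smoothD1_taylor_le c hβ0 (x0 ω) (a ω) (fun j => r * f ω j) fun τ hτ => ?_
    rw [smoothD3_mul_right, abs_mul, abs_of_nonneg (mul_nonneg hr hr), ← sq, mul_assoc]
    refine mul_le_mul_of_nonneg_left ?_ (sq_nonneg r)
    exact abs_smoothD3_segment_le c hδ hK hβ (hI0 ω) ((hI1 ω).imp id fun h => hnf ω h)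
      (fun j => by have : 0 ≤ |g ω j| ^ 3 := by positivity
                   simp only [hq]; linarith) τ hτ
  have r2 : ∀ ω, |smoothD2 c β (x0 ω) (a ω) (f ω)
      - smoothD2 c β (fun j => x0 ω j - r * g ω j) (a ω) (f ω)|
      ≤ r * L * ∑ j, (nearWeight β δ (z ω) j + I ω) * q j ω := fun ω => by
    refine abs_smoothD2_sub_le c hβ0 (x0 ω) (a ω) (f ω) (fun j => r * g ω j) fun τ hτ => ?_
    have e := smoothD3_mul_right c β (fun j => x0 ω j - τ * (r * g ω j)) (a ω) (f ω) (g ω) 1 r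
    simp only [one_mul] at e
    rw [e, abs_mul, abs_of_nonneg hr, mul_assoc]
    refine mul_le_mul_of_nonneg_left ?_ hr
    exact abs_smoothD3_segment_le c hδ hK hβ (hI0 ω) ((hI1 ω).imp id fun h => hng ω h)
      (fun j => by have : 0 ≤ |f ω j| ^ 3 := by positivity
                   simp only [hq]; linarith) τ hτ
  have r3 : ∀ ω, |T2 (x0 ω) - T2 (fun j => x0 ω j - r * g ω j)|
      ≤ r * L * ∑ j, (nearWeight β δ (z ω) j + I ω) * q' j ω := fun ω => by
    have i3a : ∀ j, Integrable (fun ω' => |a ω' j| ^ 3 + |f ω' j| ^ 3 + |g ω j| ^ 3) P :=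
      fun j => (((ha j).integrable_pow hb 3).add ((hf j).integrable_pow hb 3)).add
        (integrable_const _)
    have e : r * L * ∑ j, (nearWeight β δ (z ω) j + I ω) * q' j ω
        = ∫ ω', r * L * ∑ j, (nearWeight β δ (z ω) j + I ω) *
          (|a ω' j| ^ 3 + |f ω' j| ^ 3 + |g ω j| ^ 3) ∂P := by
      rw [integral_const_mul, integral_finsetSum _ fun j _ => (i3a j).const_mul _]
      congr 1
      refine Finset.sum_congr rfl fun j _ => ?_
      have haf : Integrable (fun ω' => |a ω' j| ^ 3 + |f ω' j| ^ 3) P :=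
        ((ha j).integrable_pow hb 3).add ((hf j).integrable_pow hb 3)
      rw [integral_const_mul, integral_add haf (integrable_const _),
        integral_add ((ha j).integrable_pow hb 3) ((hf j).integrable_pow hb 3)]
      simp [hq', hC]
    rw [e, ← hT2eq, ← hT2eq, ← integral_sub
      (integrable_smoothD2 c hδ hK hβ0.le measurable_const ham hfm hafi)
      (integrable_smoothD2 c hδ hK hβ0.le measurable_const ham hfm hafi)]
    rw [← Real.norm_eq_abs]
    refine norm_integral_le_of_norm_le
      ((integrable_finsetSum _ fun j _ => (i3a j).const_mul _).const_mul _)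
      (Filter.Eventually.of_forall fun ω' => ?_)
    refine abs_smoothD2_sub_le c hβ0 (x0 ω) (a ω') (f ω') (fun j => r * g ω j) fun τ hτ => ?_
    have e := smoothD3_mul_right c β (fun j => x0 ω j - τ * (r * g ω j)) (a ω') (f ω') (g ω) 1 r
    simp only [one_mul] at e
    rw [e, abs_mul, abs_of_nonneg hr, mul_assoc]
    refine mul_le_mul_of_nonneg_left ?_ hr
    exact abs_smoothD3_segment_le c hδ hK hβ (hI0 ω) ((hI1 ω).imp id fun h => hng ω h)
      (fun j => le_rfl) τ hτ
  have j0 := integrable_smoothD1 c hδ hK β hx0 ham hai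
  have j1 := integrable_smoothD1 c hδ hK β hx1 ham hai
  have k0 := integrable_smoothD2 c hδ hK hβ0.le hx0 ham hfm hafi
  have k2 := integrable_smoothD2 c hδ hK hβ0.le hx2 ham hfm hafi
  have z1 := integral_smoothD1_eq_zero c (β := β) hδ hK hx1 hai ha0 hi1
  have z2 := integral_smoothD2_indep c (β := β) hδ hK hβ0.le hx2 hafi hi2
  -- The first derivative at x0 - r f averages to zero, and the second derivative at x0 - r g
  -- decouples from (a, f). Moving to these points and back costs three remainders, whence the
  -- factor 3.
  have hdec : ∫ ω, smoothD1 c β (x0 ω) (a ω) ∂P - r * ∫ ω, T2 (x0 ω) ∂P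
      = (∫ ω, (smoothD1 c β (x0 ω) (a ω) - smoothD1 c β (fun j => x0 ω j - r * f ω j) (a ω)
          - r * smoothD2 c β (x0 ω) (a ω) (f ω)) ∂P)
        + r * (∫ ω, (smoothD2 c β (x0 ω) (a ω) (f ω)
          - smoothD2 c β (fun j => x0 ω j - r * g ω j) (a ω) (f ω)) ∂P)
        - r * (∫ ω, (T2 (x0 ω) - T2 (fun j => x0 ω j - r * g ω j)) ∂P) := by
    have j01 : Integrable (fun ω => smoothD1 c β (x0 ω) (a ω)
        - smoothD1 c β (fun j => x0 ω j - r * f ω j) (a ω)) P := j0.sub j1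
    rw [integral_sub j01 (k0.const_mul r), integral_sub j0 j1, integral_const_mul,
      integral_sub k0 k2, integral_sub (hT2i hx0) (hT2i hx2), z1, z2]
    ring
  have b1 := norm_integral_le_of_norm_le (iq.const_mul (r ^ 2 * L))
    (Filter.Eventually.of_forall fun ω => (Real.norm_eq_abs _).trans_le (r1 ω))
  have b2 := norm_integral_le_of_norm_le (iq.const_mul (r * L))
    (Filter.Eventually.of_forall fun ω => (Real.norm_eq_abs _).trans_le (r2 ω))
  have b3 := norm_integral_le_of_norm_le (iq'.const_mul (r * L))
    (Filter.Eventually.of_forall fun ω => (Real.norm_eq_abs _).trans_le (r3 ω))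
  rw [integral_const_mul, Real.norm_eq_abs] at b1 b2 b3
  have c1 := b1.trans (mul_le_mul_of_nonneg_left eq (by positivity))
  have c2 := b2.trans (mul_le_mul_of_nonneg_left eq (by positivity))
  have c3 := b3.trans (mul_le_mul_of_nonneg_left eq' (by positivity))
  rw [hdec]
  refine (abs_sub _ _).trans ((add_le_add_left (abs_add_le _ _) _).trans ?_)
  rw [abs_mul r, abs_mul r, abs_of_nonneg hr]
  have d2 := mul_le_mul_of_nonneg_left c2 hr
  have d3 := mul_le_mul_of_nonneg_left c3 hr
  calc _ ≤ r ^ 2 * L * E + r * (r * L * E) + r * (r * L * E) := by linarith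
    _ = 3 * r ^ 2 * L * E := by ring

end LocalExpansion

/-! ### Expansion of the first derivative for `m`-dependent sums -/

section MDependent

variable {Ω : Type*} [MeasurableSpace Ω] {P : Measure Ω} [IsProbabilityMeasure P] {n p m : ℕ}

/-- The indices within distance `k` of `t`. -/
def nbhd (t : Fin n) (k : ℕ) : Finset (Fin n) :=
  Finset.univ.filter fun i => (t : ℕ) ≤ i + k ∧ (i : ℕ) ≤ t + k

lemma mem_nbhd {t i : Fin n} {k : ℕ} : i ∈ nbhd t k ↔ (t : ℕ) ≤ i + k ∧ (i : ℕ) ≤ t + k := by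
  simp [nbhd]

lemma self_mem_nbhd (t : Fin n) (k : ℕ) : t ∈ nbhd t k := mem_nbhd.2 ⟨by omega, by omega⟩

lemma card_nbhd_le (t : Fin n) (k : ℕ) : (nbhd t k).card ≤ 2 * k + 1 := by
  have h : ((nbhd t k).map Fin.valEmbedding) ⊆ Finset.Icc ((t : ℕ) - k) (t + k) := by
    intro i hi
    obtain ⟨a, ha, rfl⟩ := Finset.mem_map.1 hi
    rw [mem_nbhd] at ha
    rw [Finset.mem_Icc, Fin.valEmbedding_apply]
    omega
  have := Finset.card_le_card h
  rw [Finset.card_map, Nat.card_Icc] at this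
  omega

/-- Zero-padded version of the independence of a block from the indices far from it. -/
lemma IsMDependent.indepFun_padded {E : Type*} [MeasurableSpace E] [Zero E]
    {X : Fin n → Ω → E} (h : IsMDependent m X P) (hX : ∀ t, Measurable (X t)) (t : Fin n) (k : ℕ) :
    IndepFun (fun ω i => if i ∈ nbhd t (k + m) then 0 else X i ω)
      (fun ω i => if i ∈ nbhd t k then X i ω else 0) P := by
  have h1 := h.indepFun_block_far hX (t - k) (t + k + 1) (by omega)
  let φ : ({i : Fin n // (t : ℕ) - k ≤ (i : ℕ) ∧ (i : ℕ) < t + k + 1} → E) → Fin n → E :=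
    fun x i => if hi : i ∈ nbhd t k then
      x ⟨i, by rw [mem_nbhd] at hi; omega⟩ else 0
  let ψ : ({i : Fin n // (i : ℕ) + m < (t : ℕ) - k ∨ (t : ℕ) + k + 1 + m ≤ (i : ℕ)} → E) →
      Fin n → E :=
    fun x i => if hi : i ∈ nbhd t (k + m) then 0 else
      x ⟨i, by rw [mem_nbhd] at hi; omega⟩
  have hφ : Measurable φ := measurable_pi_lambda _ fun i => by
    by_cases hi : i ∈ nbhd t k
    · simp only [φ, hi, dif_pos]; fun_prop
    · simp only [φ, hi, dif_neg, not_false_eq_true]; fun_prop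
  have hψ : Measurable ψ := measurable_pi_lambda _ fun i => by
    by_cases hi : i ∈ nbhd t (k + m)
    · simp only [ψ, hi, dif_pos]; fun_prop
    · simp only [ψ, hi, dif_neg, not_false_eq_true]; fun_prop
  refine (h1.comp hφ hψ).symm.congr (Filter.Eventually.of_forall fun ω => ?_)
    (Filter.Eventually.of_forall fun ω => ?_)
  · ext i
    by_cases hi : i ∈ nbhd t (k + m) <;> simp [ψ, hi]
  · ext i
    by_cases hi : i ∈ nbhd t k <;> simp [φ, hi]

variable {X : Fin n → Ω → EuclideanSpace ℝ (Fin p)}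

lemma normalizedSum_apply (ω : Ω) (j : Fin p) :
    normalizedSum X ω j = (Real.sqrt n)⁻¹ * ∑ t, X t ω j := by
  simp [normalizedSum]

lemma measurable_coord (hX : ∀ t, Measurable (X t)) (t : Fin n) (j : Fin p) :
    Measurable fun ω => X t ω j :=
  (by fun_prop : Measurable fun x : EuclideanSpace ℝ (Fin p) => x j).comp (hX t)

lemma measurable_normalizedSum_apply (hX : ∀ t, Measurable (X t)) (j : Fin p) :
    Measurable fun ω => normalizedSum X ω j := by
  simp only [normalizedSum_apply]
  exact (Finset.measurable_sum _ fun t _ => measurable_coord hX t j).const_mul _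

/-- The sum without a neighbourhood of `t` is independent of a smaller neighbourhood of `t`. -/
lemma IsMDependent.indepFun_sum_far (h : IsMDependent m X P) (hX : ∀ t, Measurable (X t))
    (t : Fin n) (k : ℕ) (s : ℝ) (u : Fin p → ℝ) {β : Type*} [MeasurableSpace β]
    {Y : Ω → β} {ψ : (Fin n → EuclideanSpace ℝ (Fin p)) → β} (hψ : Measurable ψ)
    (hY : ∀ ω, Y ω = ψ fun i => if i ∈ nbhd t k then X i ω else 0) :
    IndepFun (fun ω j => s * normalizedSum X ω j - u j
      - s * (Real.sqrt n)⁻¹ * ∑ i ∈ nbhd t (k + m), X i ω j) Y P := by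
  let φ : (Fin n → EuclideanSpace ℝ (Fin p)) → Fin p → ℝ := fun x j =>
    s * ((Real.sqrt n)⁻¹ * ∑ i, x i j) - u j
  have hφ : Measurable φ := by
    refine measurable_pi_lambda _ fun j => ?_
    simp only [φ]
    fun_prop
  refine ((h.indepFun_padded hX t k).comp hφ hψ).congr
    (Filter.Eventually.of_forall fun ω => ?_) (Filter.Eventually.of_forall fun ω => (hY ω).symm)
  ext j
  simp only [Function.comp_apply, φ, normalizedSum_apply]
  have e : ∑ i, (if i ∈ nbhd t (k + m) then (0 : EuclideanSpace ℝ (Fin p)) else X i ω) j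
      = ∑ i, X i ω j - ∑ i ∈ nbhd t (k + m), X i ω j := by
    rw [eq_sub_iff_add_eq, ← Finset.sum_filter_add_sum_filter_not Finset.univ
      (· ∈ nbhd t (k + m)) (fun i => X i ω j), add_comm]
    congr 1
    · congr 1; ext; simp
    · rw [Finset.sum_filter]
      exact Finset.sum_congr rfl fun i _ => by split_ifs <;> simp_all
  rw [e]
  ring

/-- Some coordinate of some summand exceeds `r`. -/
def exceedSet (X : Fin n → Ω → EuclideanSpace ℝ (Fin p)) (r : ℝ) : Set Ω :=
  {ω | ∃ t j, r < |X t ω j|}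

lemma exceedSet_eq (r : ℝ) : exceedSet X r = ⋃ t, ⋃ j, {ω | r < |X t ω j|} := by
  ext ω; simp [exceedSet]

lemma measurableSet_exceedSet (hX : ∀ t, Measurable (X t)) (r : ℝ) :
    MeasurableSet (exceedSet X r) := by
  rw [exceedSet_eq]
  exact MeasurableSet.iUnion fun t => MeasurableSet.iUnion fun j =>
    measurableSet_lt measurable_const (measurable_abs.comp (measurable_coord hX t j))

lemma measureReal_exceedSet_le {b : ℝ} (hb : 0 < b)
    (hs : ∀ t j, SubExp b (fun ω => X t ω j) P) (r : ℝ) :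
    P.real (exceedSet X r) ≤ 6 * (n * p) * Real.exp (-(r / b)) := by
  rw [exceedSet_eq]
  calc P.real (⋃ t, ⋃ j, {ω | r < |X t ω j|})
      ≤ ∑ t, P.real (⋃ j, {ω | r < |X t ω j|}) := measureReal_iUnion_fintype_le _
    _ ≤ ∑ _t : Fin n, ∑ _j : Fin p, 6 * Real.exp (-(r / b)) :=
        Finset.sum_le_sum fun t _ => (measureReal_iUnion_fintype_le _).trans
          (Finset.sum_le_sum fun j _ => (hs t j).measureReal_lt_abs_le hb r)
    _ = _ := by simp; ring

variable {δ K : ℝ} (c : SmoothCutoff δ K)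

lemma abs_sum_nbhd_le {r : ℝ} {ω : Ω} (hω : ω ∉ exceedSet X r) (t : Fin n) (k : ℕ) {M : ℝ}
    (hM : (nbhd t k).card ≤ M) (j : Fin p) :
    |∑ i ∈ nbhd t k, X i ω j| ≤ M * r := by
  have h : ∀ i, |X i ω j| ≤ r := fun i => by
    by_contra hc
    exact hω ⟨i, j, not_le.1 hc⟩
  have hr : 0 ≤ r := (abs_nonneg _).trans (h t)
  calc |∑ i ∈ nbhd t k, X i ω j| ≤ ∑ i ∈ nbhd t k, |X i ω j| := Finset.abs_sum_le_sum_abs _ _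
    _ ≤ ∑ i ∈ nbhd t k, r := Finset.sum_le_sum fun i _ => h i
    _ = (nbhd t k).card * r := by simp
    _ ≤ M * r := mul_le_mul_of_nonneg_right hM hr

/-- The single-index expansion for an `m`-dependent sequence. -/
lemma IsMDependent.expansion_at (h : IsMDependent m X P) (hX : ∀ t, Measurable (X t))
    [Nonempty (Fin p)] (hδ : 0 < δ) (hK : 0 ≤ K) {β : ℝ} (hβ : 1 ≤ β * δ) {b ε : ℝ} (hb : 0 < b)
    (hε : 0 < ε) (hs : ∀ t j, SubExp b (fun ω => X t ω j) P) (h0 : ∀ t j, ∫ ω, X t ω j ∂P = 0)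
    {M : ℝ} (hM : 6 * (m : ℝ) + 1 ≤ M) {s : ℝ} (hs0 : 0 ≤ s) (hs1 : s ≤ 1) (u : Fin p → ℝ)
    (hA : P.real (exceedSet X (Real.sqrt n / (2 * M * β))) ≤ ε ^ 2) (t : Fin n) :
    |∫ ω, smoothD1 c β (fun j => s * normalizedSum X ω j - u j) (fun j => X t ω j) ∂P
        - s * (Real.sqrt n)⁻¹ * M * ∫ ω, ∫ ω',
          smoothD2 c β (fun j => s * normalizedSum X ω j - u j) (fun j => X t ω' j)
            (fun j => (∑ i ∈ nbhd t m, X i ω' j) / M) ∂P ∂P|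
      ≤ 3 * (s * (Real.sqrt n)⁻¹ * M) ^ 2 * (5 * K * δ⁻¹ * β ^ 2) * (4 * (66 * b ^ 3) *
        (8 * P.real {ω | softmax β (fun j => s * normalizedSum X ω j - u j)
          ∈ Set.Icc (-δ) (4 * δ)} + 9 * (p * ε))) := by
  have hβ0 : 0 < β := pos_of_mul_pos_left (zero_lt_one.trans_le hβ) hδ.le
  have hm0 : (0 : ℝ) ≤ m := Nat.cast_nonneg m
  have hM0 : 0 < M := by linarith
  have hn : (0 : ℝ) < n := by exact_mod_cast t.pos
  have hsn : 0 < Real.sqrt n := Real.sqrt_pos.2 hn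
  have hcard : ∀ k ≤ 3 * m, ((nbhd t k).card : ℝ) ≤ M := fun k hk => by
    have h1 : ((nbhd t k).card : ℝ) ≤ 2 * k + 1 := by exact_mod_cast card_nbhd_le t k
    have h2 : (k : ℝ) ≤ 3 * m := by exact_mod_cast hk
    linarith
  have hne : ∀ k, (nbhd t k).Nonempty := fun k => ⟨t, self_mem_nbhd t k⟩
  -- At this threshold a local sum of at most M terms, divided by √n, is at most 1/(2β). Two such
  -- shifts together stay within the 1/β needed for the stability of the weights.
  set ρ := Real.sqrt n / (2 * M * β) with hρ
  set η := s * (Real.sqrt n)⁻¹ with hη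
  have hη0 : 0 ≤ η := by positivity
  have hηM : η * (M * ρ) ≤ β⁻¹ / 2 := by
    have e : η * (M * ρ) = s * (β⁻¹ / 2) := by rw [hη, hρ]; field_simp
    rw [e]
    exact mul_le_of_le_one_left (by positivity) hs1
  have hsum : ∀ k ≤ 3 * m, ∀ ω ∉ exceedSet X ρ, ∀ j,
      |η * ∑ i ∈ nbhd t k, X i ω j| ≤ β⁻¹ / 2 := fun k hk ω hω j => by
    rw [abs_mul, abs_of_nonneg hη0]
    exact (mul_le_mul_of_nonneg_left (abs_sum_nbhd_le hω t k (hcard k hk) j) hη0).trans hηM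
  have hβi : β⁻¹ ≤ δ := by rwa [inv_le_iff_one_le_mul₀' hβ0]
  have hx0 : Measurable fun ω (j : Fin p) => s * normalizedSum X ω j - u j :=
    measurable_pi_lambda _ fun j =>
      ((measurable_normalizedSum_apply hX j).const_mul s).sub_const (u j)
  have hsumm : ∀ k j, Measurable fun ω => ∑ i ∈ nbhd t k, X i ω j := fun k j =>
    Finset.measurable_sum _ fun i _ => measurable_coord hX i j
  have hz : Measurable fun ω (j : Fin p) => s * normalizedSum X ω j - u j
      - η * ∑ i ∈ nbhd t (2 * m + m), X i ω j :=
    measurable_pi_lambda _ fun j =>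
      ((measurable_pi_apply j).comp hx0).sub ((hsumm _ j).const_mul η)
  have hre : ∀ k ω j, η * M * ((∑ i ∈ nbhd t k, X i ω j) / M) = η * ∑ i ∈ nbhd t k, X i ω j :=
    fun k ω j => by field_simp
  have hpad : ∀ k l, l ≤ k → ∀ ω (j : Fin p), ∑ i ∈ nbhd t l,
      (if i ∈ nbhd t k then X i ω else (0 : EuclideanSpace ℝ (Fin p))) j
        = ∑ i ∈ nbhd t l, X i ω j := by
    intro k l hkl ω j
    refine Finset.sum_congr rfl fun i hi => ?_
    have : i ∈ nbhd t k := by rw [mem_nbhd] at *; omega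
    rw [if_pos this]
  -- Removing radius m frees the sum from X_t, radius 2m also from the block f, and radius 3m from
  -- a, f and g together. The largest block has at most 6m + 1 indices.
  have i1 := h.indepFun_sum_far hX t 0 s u (Y := fun ω j => X t ω j)
    (ψ := fun x j => x t j) (by fun_prop) (fun ω => by simp [self_mem_nbhd])
  have i2 := h.indepFun_sum_far hX t m s u
    (Y := fun ω => (fun j => X t ω j, fun j => (∑ i ∈ nbhd t m, X i ω j) / M))
    (ψ := fun x => (fun j => x t j, fun j => (∑ i ∈ nbhd t m, x i j) / M)) (by fun_prop)
    (fun ω => by simp only [self_mem_nbhd, if_true, hpad m m le_rfl])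
  have i3 := h.indepFun_sum_far hX t (2 * m) s u
    (Y := fun ω => (fun j => X t ω j, fun j => (∑ i ∈ nbhd t m, X i ω j) / M,
      fun j => (∑ i ∈ nbhd t (2 * m), X i ω j) / M))
    (ψ := fun x => (fun j => x t j, fun j => (∑ i ∈ nbhd t m, x i j) / M,
      fun j => (∑ i ∈ nbhd t (2 * m), x i j) / M)) (by fun_prop)
    (fun ω => by
      simp only [self_mem_nbhd, if_true, hpad (2 * m) m (by omega), hpad (2 * m) (2 * m) le_rfl])
  have key := local_expansion c (P := P) hδ hK hβ hb (r := η * M) (by positivity) hε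
    (x0 := fun ω j => s * normalizedSum X ω j - u j)
    (z := fun ω j => s * normalizedSum X ω j - u j - η * ∑ i ∈ nbhd t (2 * m + m), X i ω j)
    (a := fun ω j => X t ω j) (f := fun ω j => (∑ i ∈ nbhd t m, X i ω j) / M)
    (g := fun ω j => (∑ i ∈ nbhd t (2 * m), X i ω j) / M) hx0 hz (hs t)
    (fun j => SubExp.sum_div (hne m) (hcard m (by omega)) hb fun i => hs i j)
    (fun j => SubExp.sum_div (hne (2 * m)) (hcard (2 * m) (by omega)) hb fun i => hs i j)
    (h0 t) (by simpa only [hre, zero_add] using i1)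
    (by simp only [hre, two_mul]; exact i2) i3
    (measurableSet_exceedSet hX ρ) hA
    (N := {ω | softmax β (fun j => s * normalizedSum X ω j - u j) ∈ Set.Icc (-δ) (4 * δ)})
    (((continuous_softmax β).measurable.comp hx0) measurableSet_Icc) ?_ ?_ ?_
  · simpa only [Fintype.card_fin] using key
  · intro ω hω
    by_cases hωA : ω ∈ exceedSet X ρ
    · exact Or.inr hωA
    · left
      -- Returning from z to the full sum moves the soft maximum by at most 1/β ≤ δ, which turns [0,
      -- 3δ] into [-δ, 4δ].
      have hd : ∀ j, |(s * normalizedSum X ω j - u j - η * ∑ i ∈ nbhd t (2 * m + m), X i ω j)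
          - (s * normalizedSum X ω j - u j)| ≤ β⁻¹ := fun j => by
        rw [sub_sub_cancel_left, abs_neg]
        have := hsum (2 * m + m) (by omega) ω hωA j
        have : 0 < β⁻¹ := by positivity
        linarith
      have h1 := softmax_le_add hβ0 hd
      have h2 := softmax_le_add hβ0 (fun j => (abs_sub_comm _ _).trans_le (hd j))
      exact ⟨by linarith [hω.1], by linarith [hω.2]⟩
  all_goals
    intro ω hω τ hτ j
    rw [hre]
    have h1 := abs_le.1 (hsum (2 * m + m) (by omega) ω hω j)
  · have h2 := hsum m (by omega) ω hω j
    have h3 : |τ * (η * ∑ i ∈ nbhd t m, X i ω j)| ≤ β⁻¹ / 2 := by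
      rw [abs_mul, abs_of_nonneg hτ.1]
      exact (mul_le_of_le_one_left (abs_nonneg _) hτ.2).trans h2
    rw [abs_le] at *
    constructor <;> linarith
  · have h2 := hsum (2 * m) (by omega) ω hω j
    have h3 : |τ * (η * ∑ i ∈ nbhd t (2 * m), X i ω j)| ≤ β⁻¹ / 2 := by
      rw [abs_mul, abs_of_nonneg hτ.1]
      exact (mul_le_of_le_one_left (abs_nonneg _) hτ.2).trans h2
    rw [abs_le] at *
    constructor <;> linarith

/-- Coordinates at distance more than `m` are uncorrelated. -/
lemma IsMDependent.integral_mul_eq_zero (h : IsMDependent m X P) (hX : ∀ t, Measurable (X t))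
    (h0 : ∀ t j, ∫ ω, X t ω j ∂P = 0) {t i : Fin n} (hi : i ∉ nbhd t m) (j k : Fin p) :
    ∫ ω, X t ω j * X i ω k ∂P = 0 := by
  have hind : IndepFun (fun ω => X i ω k) (fun ω => X t ω j) P := by
    refine ((h.indepFun_padded hX t 0).comp (φ := fun x => x i k) (ψ := fun x => x t j)
      (by fun_prop) (by fun_prop)).congr (Filter.Eventually.of_forall fun ω => ?_)
      (Filter.Eventually.of_forall fun ω => ?_)
    · simp [hi]
    · simp [self_mem_nbhd]
  have := hind.symm.integral_fun_mul_eq_mul_integral (measurable_coord hX t j).aestronglyMeasurable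
    (measurable_coord hX i k).aestronglyMeasurable
  rw [this, h0 t j, zero_mul]

lemma integrable_coord_mul {b : ℝ} (hb : 0 < b) (hs : ∀ t j, SubExp b (fun ω => X t ω j) P)
    (t i : Fin n) (j k : Fin p) : Integrable (fun ω => X t ω j * X i ω k) P :=
  ((hs t j).memLp hb).integrable_mul ((hs i k).memLp hb)

lemma memLp_normalizedSum {b : ℝ} (hb : 0 < b) (hs : ∀ t j, SubExp b (fun ω => X t ω j) P)
    (j : Fin p) : MemLp (fun ω => normalizedSum X ω j) 2 P := by
  simp only [normalizedSum_apply]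
  exact (memLp_finsetSum _ fun t _ => (hs t j).memLp hb).const_mul _

lemma integral_normalizedSum {b : ℝ} (hb : 0 < b) (hs : ∀ t j, SubExp b (fun ω => X t ω j) P)
    (h0 : ∀ t j, ∫ ω, X t ω j ∂P = 0) (j : Fin p) : ∫ ω, normalizedSum X ω j ∂P = 0 := by
  simp only [normalizedSum_apply]
  rw [integral_const_mul, integral_finsetSum _ fun t _ => (hs t j).integrable hb]
  simp [h0]

/-- The long-run covariance as a sum over neighbourhoods. -/
lemma IsMDependent.longRunCov_eq (h : IsMDependent m X P) (hX : ∀ t, Measurable (X t)) {b : ℝ}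
    (hb : 0 < b) (hs : ∀ t j, SubExp b (fun ω => X t ω j) P) (h0 : ∀ t j, ∫ ω, X t ω j ∂P = 0)
    (j k : Fin p) :
    longRunCov X P j k = (Real.sqrt n)⁻¹ * ((Real.sqrt n)⁻¹ *
      ∑ t, ∫ ω, X t ω j * ∑ i ∈ nbhd t m, X i ω k ∂P) := by
  rw [longRunCov, Matrix.of_apply, covariance_eq_sub (memLp_normalizedSum hb hs j)
    (memLp_normalizedSum hb hs k), integral_normalizedSum hb hs h0 j, zero_mul, sub_zero]
  have e : (fun ω => normalizedSum X ω j) * (fun ω => normalizedSum X ω k)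
      = fun ω => (Real.sqrt n)⁻¹ * ((Real.sqrt n)⁻¹ * ∑ t, ∑ i, X t ω j * X i ω k) := by
    ext ω
    simp only [Pi.mul_apply, normalizedSum_apply, ← Finset.sum_mul_sum]
    ring
  rw [e, integral_const_mul, integral_const_mul, integral_finsetSum _ fun t _ =>
    integrable_finsetSum _ fun i _ => integrable_coord_mul hb hs t i j k]
  congr 2
  refine Finset.sum_congr rfl fun t _ => ?_
  simp only [Finset.mul_sum]
  rw [integral_finsetSum _ fun i _ => integrable_coord_mul hb hs t i j k,
    integral_finsetSum _ fun i _ => integrable_coord_mul hb hs t i j k]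
  exact (Finset.sum_subset (Finset.subset_univ _)
    fun i _ hi => h.integral_mul_eq_zero hX h0 hi j k).symm

/-- Expansion of `E[D f(s S - u)[S]]` to second order. -/
lemma IsMDependent.expansion (h : IsMDependent m X P) (hX : ∀ t, Measurable (X t))
    [Nonempty (Fin p)] (hn : 1 ≤ n) (hδ : 0 < δ) (hK : 0 ≤ K) {β : ℝ} (hβ : 1 ≤ β * δ) {b ε : ℝ}
    (hb : 0 < b) (hε : 0 < ε) (hs : ∀ t j, SubExp b (fun ω => X t ω j) P)
    (h0 : ∀ t j, ∫ ω, X t ω j ∂P = 0)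
    {M : ℝ} (hM : 6 * (m : ℝ) + 1 ≤ M) {s : ℝ} (hs0 : 0 ≤ s) (hs1 : s ≤ 1) (u : Fin p → ℝ)
    (hA : P.real (exceedSet X (Real.sqrt n / (2 * M * β))) ≤ ε ^ 2) :
    |∫ ω, smoothD1 c β (fun j => s * normalizedSum X ω j - u j) (fun j => normalizedSum X ω j) ∂P
        - s * ∫ ω, ∑ j, ∑ k, smoothHess c β (fun j => s * normalizedSum X ω j - u j) j k
            * longRunCov X P j k ∂P|
      ≤ (Real.sqrt n)⁻¹ * (3 * M ^ 2 * (5 * K * δ⁻¹ * β ^ 2) * (4 * (66 * b ^ 3) *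
        (8 * P.real {ω | softmax β (fun j => s * normalizedSum X ω j - u j)
          ∈ Set.Icc (-δ) (4 * δ)} + 9 * (p * ε)))) := by
  have hβ0 : 0 < β := pos_of_mul_pos_left (zero_lt_one.trans_le hβ) hδ.le
  have hm0 : (0 : ℝ) ≤ m := Nat.cast_nonneg m
  have hM0 : 0 < M := by linarith
  have hn' : (0 : ℝ) < n := by exact_mod_cast hn
  have hsn : 0 < Real.sqrt n := Real.sqrt_pos.2 hn'
  set x0 : Ω → Fin p → ℝ := fun ω j => s * normalizedSum X ω j - u j with hx0d
  have hx0 : Measurable x0 := measurable_pi_lambda _ fun j =>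
      ((measurable_normalizedSum_apply hX j).const_mul s).sub_const (u j)
  set E := 4 * (66 * b ^ 3) *
        (8 * P.real {ω | softmax β (x0 ω) ∈ Set.Icc (-δ) (4 * δ)} + 9 * (p * ε)) with hE
  have hE0 : 0 ≤ E := by positivity
  set L := 5 * K * δ⁻¹ * β ^ 2 with hL
  have hL0 : 0 ≤ L := by positivity
  set f : Fin n → Ω → Fin p → ℝ := fun t ω j => (∑ i ∈ nbhd t m, X i ω j) / M with hf
  have key := fun t => h.expansion_at c hX hδ hK hβ hb hε hs h0 hM hs0 hs1 u hA t
  have hafi : ∀ t j k, Integrable (fun ω => X t ω j * f t ω k) P := fun t j k => by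
    simp only [hf, Finset.mul_sum, ← mul_div_assoc]
    exact (integrable_finsetSum _ fun i _ => integrable_coord_mul hb hs t i j k).div_const M
  have eS : ∀ ω, smoothD1 c β (x0 ω) (fun j => normalizedSum X ω j)
      = (Real.sqrt n)⁻¹ * ∑ t, smoothD1 c β (x0 ω) (fun j => X t ω j) := fun ω => by
    simp only [normalizedSum_apply]
    rw [smoothD1_mul_left, smoothD1_sum]
  have iD1 : ∀ t, Integrable (fun ω => smoothD1 c β (x0 ω) (fun j => X t ω j)) P := fun t =>
    integrable_smoothD1 c hδ hK β hx0 (measurable_pi_lambda _ fun j => measurable_coord hX t j)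
      fun j => (hs t j).integrable hb
  have iH : ∀ t, Integrable (fun ω => ∑ j, ∑ k, smoothHess c β (x0 ω) j k *
      ∫ ω', X t ω' j * f t ω' k ∂P) P := fun t =>
    integrable_finsetSum _ fun j _ => integrable_finsetSum _ fun k _ =>
      integrable_mul_of_bdd ((continuous_smoothHess c β j k).measurable.comp hx0)
        (fun ω => abs_smoothHess_le c hδ hK hβ0.le (x0 ω) j k) (integrable_const _)
  -- Pairs of indices more than m apart are uncorrelated, so the local covariances summed over t
  -- exhaust Ξ.
  have eC : ∀ ω, s * ∑ j, ∑ k, smoothHess c β (x0 ω) j k * longRunCov X P j k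
      = (Real.sqrt n)⁻¹ * ∑ t, s * (Real.sqrt n)⁻¹ * M *
          ∑ j, ∑ k, smoothHess c β (x0 ω) j k * ∫ ω', X t ω' j * f t ω' k ∂P := fun ω => by
    have e1 : ∀ j k, longRunCov X P j k = (Real.sqrt n)⁻¹ * ((Real.sqrt n)⁻¹ *
        (M * ∑ t, ∫ ω, X t ω j * f t ω k ∂P)) := fun j k => by
      have e0 : M * ∑ t, ∫ ω, X t ω j * f t ω k ∂P
          = ∑ t, ∫ ω, X t ω j * ∑ i ∈ nbhd t m, X i ω k ∂P := by
        rw [Finset.mul_sum]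
        refine Finset.sum_congr rfl fun t _ => ?_
        rw [← integral_const_mul]
        congr 1; ext ω; simp only [hf]; field_simp
      rw [h.longRunCov_eq hX hb hs h0, e0]
    have e2 : ∀ F : Fin n → Fin p → Fin p → ℝ,
        ∑ t, ∑ j, ∑ k, F t j k = ∑ j, ∑ k, ∑ t, F t j k := fun F => by
      rw [Finset.sum_comm]
      exact Finset.sum_congr rfl fun j _ => Finset.sum_comm
    simp only [e1, Finset.mul_sum]
    rw [e2]
    refine Finset.sum_congr rfl fun j _ => Finset.sum_congr rfl fun k _ =>
      Finset.sum_congr rfl fun t _ => by ring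
  have hint : ∫ ω, smoothD1 c β (x0 ω) (fun j => normalizedSum X ω j) ∂P
        - s * ∫ ω, ∑ j, ∑ k, smoothHess c β (x0 ω) j k * longRunCov X P j k ∂P
      = (Real.sqrt n)⁻¹ * ∑ t, (∫ ω, smoothD1 c β (x0 ω) (fun j => X t ω j) ∂P
        - s * (Real.sqrt n)⁻¹ * M * ∫ ω, ∫ ω',
          smoothD2 c β (x0 ω) (fun j => X t ω' j) (f t ω') ∂P ∂P) := by
    rw [← integral_const_mul]
    simp only [eS, eC, integral_smoothD2_dir c β _ (hafi _)]
    rw [integral_const_mul, integral_const_mul, integral_finsetSum _ fun t _ => iD1 t,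
      integral_finsetSum _ fun t _ => (iH t).const_mul _, ← mul_sub, ← Finset.sum_sub_distrib]
    simp only [integral_const_mul]
  rw [hint, abs_mul, abs_of_pos (inv_pos.2 hsn)]
  refine mul_le_mul_of_nonneg_left ?_ (inv_pos.2 hsn).le
  refine (Finset.abs_sum_le_sum_abs _ _).trans
    ((Finset.sum_le_sum fun t _ => key t).trans ?_)
  rw [Finset.sum_const, Finset.card_univ, Fintype.card_fin, nsmul_eq_mul]
  -- The n summands each contribute order 1/n, so only the outer factor n^{-1/2} from normalizing S
  -- remains.
  have e : (n : ℝ) * (3 * (s * (Real.sqrt n)⁻¹ * M) ^ 2 * L * E) = s ^ 2 * (3 * M ^ 2 * L * E) := by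
    have hinv : (n : ℝ) * ((Real.sqrt n)⁻¹) ^ 2 = 1 := by
      rw [inv_pow, Real.sq_sqrt hn'.le, mul_inv_cancel₀ hn'.ne']
    linear_combination (3 * s ^ 2 * M ^ 2 * L * E) * hinv
  rw [← hE, e]
  exact mul_le_of_le_one_left (by positivity) (pow_le_one₀ hs0 hs1)

end MDependent

/-! ### Gaussian integration by parts and interpolation -/

section Gaussian

variable {p : ℕ} {γ : Measure (EuclideanSpace ℝ (Fin p))} [IsGaussian γ] {δ K : ℝ}

lemma memLp_gaussian_coord (j : Fin p) :
    MemLp (fun g : EuclideanSpace ℝ (Fin p) => g j) 2 γ :=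
  (EuclideanSpace.proj j : EuclideanSpace ℝ (Fin p) →L[ℝ] ℝ).comp_memLp' IsGaussian.memLp_two_id

lemma integrable_gaussian_coord (j : Fin p) :
    Integrable (fun g : EuclideanSpace ℝ (Fin p) => g j) γ :=
  (memLp_gaussian_coord j).integrable one_le_two

lemma integral_gaussian_coord (h0 : γ[id] = 0) (j : Fin p) :
    ∫ g : EuclideanSpace ℝ (Fin p), g j ∂γ = 0 := by
  have h := (EuclideanSpace.proj j : EuclideanSpace ℝ (Fin p) →L[ℝ] ℝ).integral_comp_comm
    (IsGaussian.integrable_id (μ := γ))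
  rw [h0, map_zero] at h
  exact h

lemma integrable_gaussian_coord_mul (j k : Fin p) :
    Integrable (fun g : EuclideanSpace ℝ (Fin p) => g j * g k) γ :=
  (memLp_gaussian_coord j).integrable_mul (memLp_gaussian_coord k)

variable (c : SmoothCutoff δ K)

set_option maxHeartbeats 1000000 in
/-- Gaussian integration by parts for the first derivative of the smoothed indicator, obtained
by differentiating along rotations of two independent copies. -/
lemma integral_smoothD1_gaussian [Nonempty (Fin p)] (h0 : γ[id] = 0) (hδ : 0 < δ) (hK : 0 ≤ K)
    {β : ℝ} (hβ : 0 < β) (x : Fin p → ℝ) (r : ℝ) :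
    ∫ g, smoothD1 c β (fun j => x j + r * g j) (fun j => g j) ∂γ
      = r * ∫ g, ∑ j, ∑ k, smoothHess c β (fun j => x j + r * g j) j k
          * ∫ g', g' j * g' k ∂γ ∂γ := by
  let pt : ℝ → EuclideanSpace ℝ (Fin p) × EuclideanSpace ℝ (Fin p) → Fin p → ℝ := fun α z j =>
    x j + r * (Real.cos α * z.1 j + Real.sin α * z.2 j)
  let dr : ℝ → EuclideanSpace ℝ (Fin p) × EuclideanSpace ℝ (Fin p) → Fin p → ℝ := fun α z j => -Real.sin α * z.1 j + Real.cos α * z.2 j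
  let dr' : ℝ → EuclideanSpace ℝ (Fin p) × EuclideanSpace ℝ (Fin p) → Fin p → ℝ := fun α z j => -Real.cos α * z.1 j - Real.sin α * z.2 j
  let F : ℝ → EuclideanSpace ℝ (Fin p) × EuclideanSpace ℝ (Fin p) → ℝ := fun α z => smoothD1 c β (pt α z) (dr α z)
  let F' : ℝ → EuclideanSpace ℝ (Fin p) × EuclideanSpace ℝ (Fin p) → ℝ := fun α z =>
    smoothD2 c β (pt α z) (dr α z) (fun j => r * dr α z j) + smoothD1 c β (pt α z) (dr' α z)
  have hpt : ∀ α, Measurable (pt α) := fun α => measurable_pi_lambda _ fun j => by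
    simp only [pt]; fun_prop
  have hdr : ∀ α, Measurable (dr α) := fun α => measurable_pi_lambda _ fun j => by
    simp only [dr]; fun_prop
  have hdr' : ∀ α, Measurable (dr' α) := fun α => measurable_pi_lambda _ fun j => by
    simp only [dr']; fun_prop
  have i1 : ∀ j, Integrable (fun z : EuclideanSpace ℝ (Fin p) × EuclideanSpace ℝ (Fin p) => z.1 j) (γ.prod γ) := fun j =>
    (integrable_gaussian_coord j).comp_fst γ
  have i2 : ∀ j, Integrable (fun z : EuclideanSpace ℝ (Fin p) × EuclideanSpace ℝ (Fin p) => z.2 j) (γ.prod γ) := fun j =>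
    (integrable_gaussian_coord j).comp_snd γ
  have m1 : ∀ j, MemLp (fun z : EuclideanSpace ℝ (Fin p) × EuclideanSpace ℝ (Fin p) => z.1 j) 2 (γ.prod γ) := fun j =>
    (memLp_gaussian_coord j).comp_fst γ
  have m2 : ∀ j, MemLp (fun z : EuclideanSpace ℝ (Fin p) × EuclideanSpace ℝ (Fin p) => z.2 j) 2 (γ.prod γ) := fun j =>
    (memLp_gaussian_coord j).comp_snd γ
  have hFm : ∀ α, Measurable (F α) := fun α =>
    (continuous_smoothD1 c β).measurable.comp ((hpt α).prodMk (hdr α))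
  have hFi : ∀ α, Integrable (F α) (γ.prod γ) := fun α =>
    integrable_smoothD1 c hδ hK β (hpt α) (hdr α) fun j =>
      ((i1 j).const_mul _).add ((i2 j).const_mul _)
  let T : EuclideanSpace ℝ (Fin p) × EuclideanSpace ℝ (Fin p) → ℝ := fun z => ∑ j, (|z.1 j| + |z.2 j|)
  have hTi : Integrable T (γ.prod γ) := integrable_finsetSum _ fun j _ =>
    (i1 j).abs.add (i2 j).abs
  have hT2 : Integrable (fun z => T z * T z) (γ.prod γ) := by
    have : MemLp T 2 (γ.prod γ) := memLp_finsetSum _ fun j _ => (m1 j).abs.add (m2 j).abs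
    exact this.integrable_mul this
  have hcs : ∀ (α β' : ℝ) (s t : ℝ), |s| ≤ 1 → |t| ≤ 1 → |s * α + t * β'| ≤ |α| + |β'| := by
    intro α β' s t hs ht
    refine (abs_add_le _ _).trans ?_
    rw [abs_mul, abs_mul]
    exact add_le_add (mul_le_of_le_one_left (abs_nonneg _) hs)
      (mul_le_of_le_one_left (abs_nonneg _) ht)
  have hdrT : ∀ α z, ∑ j, |dr α z j| ≤ T z := fun α z => Finset.sum_le_sum fun j _ =>
    hcs _ _ _ _ (by rw [abs_neg]; exact Real.abs_sin_le_one α) (Real.abs_cos_le_one α)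
  have hdrT' : ∀ α z, ∑ j, |dr' α z j| ≤ T z := fun α z => Finset.sum_le_sum fun j _ => by
    have := hcs (z.1 j) (z.2 j) (-Real.cos α) (-Real.sin α)
      (by rw [abs_neg]; exact Real.abs_cos_le_one α) (by rw [abs_neg]; exact Real.abs_sin_le_one α)
    rwa [neg_mul (Real.sin α), ← sub_eq_add_neg] at this
  set C2 := K * δ⁻¹ ^ 2 + 2 * K * δ⁻¹ * β with hC2
  have hC20 : 0 ≤ C2 := by positivity
  -- The envelope is uniform in the angle because sines and cosines are at most one; it is
  -- integrable because Gaussian coordinates are square integrable.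
  have hbound : ∀ α z, ‖F' α z‖ ≤ |r| * (C2 * (T z * T z)) + K * δ⁻¹ * T z := fun α z => by
    have hs0 : 0 ≤ ∑ j, |dr α z j| := Finset.sum_nonneg fun _ _ => abs_nonneg _
    refine (norm_add_le _ _).trans (add_le_add ?_ ?_)
    · rw [smoothD2_mul_right, norm_mul, Real.norm_eq_abs, Real.norm_eq_abs]
      refine mul_le_mul_of_nonneg_left ?_ (abs_nonneg r)
      refine (abs_smoothD2_le c hδ hK hβ.le _ _ _).trans (mul_le_mul_of_nonneg_left ?_ hC20)
      exact mul_le_mul (hdrT α z) (hdrT α z) hs0 (hs0.trans (hdrT α z))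
    · rw [Real.norm_eq_abs]
      exact (abs_smoothD1_le c hδ hK β _ _).trans
        (mul_le_mul_of_nonneg_left (hdrT' α z) (by positivity))
  have hdiff : ∀ α z, HasDerivAt (fun α => F α z) (F' α z) α := fun α z => by
    have hc := Real.hasDerivAt_cos α
    have hs := Real.hasDerivAt_sin α
    refine hasDerivAt_smoothD1 c hβ (fun j => ?_) (fun j => ?_)
    · refine (((hc.mul_const (z.1 j)).add (hs.mul_const (z.2 j))).const_mul r).const_add (x j)
    · refine ((hs.neg.mul_const (z.1 j)).add (hc.mul_const (z.2 j))).congr_deriv ?_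
      simp only [dr']; ring
  obtain ⟨iF', hder⟩ := hasDerivAt_integral_of_dominated_loc_of_deriv_le (μ := γ.prod γ) (F := F)
    (F' := F') (x₀ := 0) (s := Set.univ) Filter.univ_mem
    (Filter.Eventually.of_forall fun α => (hFm α).aestronglyMeasurable) (hFi 0)
    (((continuous_smoothD2 c β).measurable.comp ((hpt 0).prodMk ((hdr 0).prodMk
      (measurable_pi_lambda _ fun j => ((measurable_pi_apply j).comp (hdr 0)).const_mul r)))).add
      ((continuous_smoothD1 c β).measurable.comp ((hpt 0).prodMk (hdr' 0)))).aestronglyMeasurable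
    (Filter.Eventually.of_forall fun z α _ => hbound α z)
    (((hT2.const_mul _).const_mul _).add (hTi.const_mul _))
    (Filter.Eventually.of_forall fun z α _ => hdiff α z)
  -- γ ⊗ γ is rotation invariant, so every angle gives the expectation at angle 0, where the
  -- direction is centred and independent of the point.
  have hzero : ∀ α, ∫ z, F α z ∂(γ.prod γ) = 0 := fun α => by
    let G : EuclideanSpace ℝ (Fin p) × EuclideanSpace ℝ (Fin p) → ℝ := fun z => smoothD1 c β (fun j => x j + r * z.1 j) (fun j => z.2 j)
    have hG : Measurable G := (continuous_smoothD1 c β).measurable.comp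
      ((measurable_pi_lambda _ fun j => by fun_prop).prodMk
        (measurable_pi_lambda _ fun j => by fun_prop))
    have e1 : ∫ z, F α z ∂(γ.prod γ) = ∫ z, G z ∂(γ.prod γ) := by
      conv_rhs => rw [← IsGaussian.map_rotation_eq_self h0 α]
      rw [integral_map (by fun_prop) hG.aestronglyMeasurable]
      congr 1
    rw [e1]
    simp only [G, smoothD1_eq_sum]
    rw [integral_finsetSum]
    · refine Finset.sum_eq_zero fun j _ => ?_
      rw [integral_prod_mul (μ := γ) (ν := γ)
        (fun g : EuclideanSpace ℝ (Fin p) => smoothGrad c β (fun j => x j + r * g j) j) (fun g : EuclideanSpace ℝ (Fin p) => g j),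
        integral_gaussian_coord h0 j, mul_zero]
    · intro j _
      exact integrable_mul_of_bdd ((continuous_smoothGrad c β j).measurable.comp
        (measurable_pi_lambda _ fun j => by fun_prop))
        (fun z => abs_smoothGrad_le c hδ hK β _ j) (i2 j)
  simp only [hzero] at hder
  have hfin := hder.unique (hasDerivAt_const (0 : ℝ) (0 : ℝ))
  -- The constant zero function has zero derivative at angle 0, and this derivative is exactly the
  -- difference of the two sides of the integration by parts formula.
  have eF' : ∀ z, F' 0 z = r * smoothD2 c β (fun j => x j + r * z.1 j) (fun j => z.2 j)
      (fun j => z.2 j) - smoothD1 c β (fun j => x j + r * z.1 j) (fun j => z.1 j) := fun z => by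
    simp only [F', pt, dr, dr', Real.sin_zero, Real.cos_zero, smoothD2_mul_right]
    have := smoothD1_mul_left c β (fun j => x j + r * z.1 j) (fun j => z.1 j) (-1)
    simp only [neg_mul, one_mul, zero_mul, neg_zero, zero_add, add_zero, sub_zero] at this ⊢
    rw [this]; ring
  simp only [eF'] at hfin
  have hp1 : Measurable fun (z : EuclideanSpace ℝ (Fin p) × EuclideanSpace ℝ (Fin p)) (j : Fin p) => x j + r * z.1 j :=
    measurable_pi_lambda _ fun j => by fun_prop
  have hz1 : Measurable fun (z : EuclideanSpace ℝ (Fin p) × EuclideanSpace ℝ (Fin p)) (j : Fin p) => z.1 j :=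
    measurable_pi_lambda _ fun j => by fun_prop
  have hz2 : Measurable fun (z : EuclideanSpace ℝ (Fin p) × EuclideanSpace ℝ (Fin p)) (j : Fin p) => z.2 j :=
    measurable_pi_lambda _ fun j => by fun_prop
  have k2 := integrable_smoothD2 c hδ hK (μ := γ.prod γ) hβ.le hp1 hz2 hz2
    fun j k => (m2 j).integrable_mul (m2 k)
  have k1 := integrable_smoothD1 c hδ hK (μ := γ.prod γ) β hp1 hz1 i1
  rw [integral_sub (k2.const_mul r) k1, integral_const_mul, integral_prod _ k2,
    integral_prod _ k1] at hfin
  simp only [integral_const, probReal_univ, one_smul,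
    integral_smoothD2_dir c β _ integrable_gaussian_coord_mul] at hfin
  linarith

end Gaussian

/-! ### Derivative along the path sin θ S + cos θ G. -/

section Interpolation

variable {Ω : Type*} [MeasurableSpace Ω] {P : Measure Ω} [IsProbabilityMeasure P] {p : ℕ}
  {γ : Measure (EuclideanSpace ℝ (Fin p))} [IsGaussian γ] {δ K : ℝ} (c : SmoothCutoff δ K)

/-- Derivative of the expectation of the smoothed indicator along the interpolation path. -/
lemma hasDerivAt_interpolation [Nonempty (Fin p)] (hδ : 0 < δ) (hK : 0 ≤ K) {β : ℝ} (hβ : 0 < β)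
    {S : Ω → Fin p → ℝ} (hS : Measurable S) (hSi : ∀ j, Integrable (fun ω => S ω j) P)
    (u : Fin p → ℝ) (θ : ℝ) :
    HasDerivAt (fun θ => ∫ z, smoothInd c β
        (fun j => Real.sin θ * S z.1 j + Real.cos θ * z.2 j - u j) ∂(P.prod γ))
      (∫ z, smoothD1 c β (fun j => Real.sin θ * S z.1 j + Real.cos θ * z.2 j - u j)
        (fun j => Real.cos θ * S z.1 j - Real.sin θ * z.2 j) ∂(P.prod γ)) θ := by
  let pt : ℝ → Ω × EuclideanSpace ℝ (Fin p) → Fin p → ℝ := fun θ z j =>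
    Real.sin θ * S z.1 j + Real.cos θ * z.2 j - u j
  let dr : ℝ → Ω × EuclideanSpace ℝ (Fin p) → Fin p → ℝ := fun θ z j => Real.cos θ * S z.1 j - Real.sin θ * z.2 j
  have hSj : ∀ j, Measurable fun ω => S ω j := fun j => (measurable_pi_apply j).comp hS
  have hpt : ∀ θ, Measurable (pt θ) := fun θ => measurable_pi_lambda _ fun j => by
    have := hSj j; simp only [pt]; fun_prop
  have hdr : ∀ θ, Measurable (dr θ) := fun θ => measurable_pi_lambda _ fun j => by
    have := hSj j; simp only [dr]; fun_prop
  let T : Ω × EuclideanSpace ℝ (Fin p) → ℝ := fun z => ∑ j, (|S z.1 j| + |z.2 j|)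
  have hTi : Integrable T (P.prod γ) := integrable_finsetSum _ fun j _ =>
    ((hSi j).comp_fst γ).abs.add ((integrable_gaussian_coord j).comp_snd P).abs
  have hdrT : ∀ θ z, ∑ j, |dr θ z j| ≤ T z := fun θ z => Finset.sum_le_sum fun j _ => by
    refine (abs_sub _ _).trans ?_
    rw [abs_mul, abs_mul]
    exact add_le_add (mul_le_of_le_one_left (abs_nonneg _) (Real.abs_cos_le_one θ))
      (mul_le_of_le_one_left (abs_nonneg _) (Real.abs_sin_le_one θ))
  have hm : ∀ θ, Measurable fun z => smoothInd c β (pt θ z) := fun θ =>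
    (continuous_smoothInd c β).measurable.comp (hpt θ)
  refine (hasDerivAt_integral_of_dominated_loc_of_deriv_le (μ := P.prod γ)
    (F := fun θ z => smoothInd c β (pt θ z)) (F' := fun θ z => smoothD1 c β (pt θ z) (dr θ z))
    (x₀ := θ) (s := Set.univ) (bound := fun z => K * δ⁻¹ * T z) Filter.univ_mem
    (Filter.Eventually.of_forall fun θ => (hm θ).aestronglyMeasurable) ?_ ?_ ?_
    (hTi.const_mul _) ?_).2
  · refine Integrable.of_bound (hm θ).aestronglyMeasurable 1 (Filter.Eventually.of_forall fun z => ?_)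
    rw [Real.norm_eq_abs, smoothInd, abs_of_nonneg (c.nonneg _)]
    exact c.le_one _
  · exact ((continuous_smoothD1 c β).measurable.comp
      ((hpt θ).prodMk (hdr θ))).aestronglyMeasurable
  · refine Filter.Eventually.of_forall fun z θ _ => ?_
    rw [Real.norm_eq_abs]
    exact (abs_smoothD1_le c hδ hK β _ _).trans
      (mul_le_mul_of_nonneg_left (hdrT θ z) (by positivity))
  · refine Filter.Eventually.of_forall fun z θ _ => hasDerivAt_smoothInd c hβ fun j => ?_
    refine ((((Real.hasDerivAt_sin θ).mul_const (S z.1 j)).add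
      ((Real.hasDerivAt_cos θ).mul_const (z.2 j))).sub_const (u j)).congr_deriv ?_
    simp only [dr]; ring

/-- If `E[D f(s S - v)[S]]` agrees with its Gaussian counterpart up to an error controlled by the
mass near the boundary, then the interpolation has small derivative. -/
lemma abs_deriv_interpolation_le [Nonempty (Fin p)] (h0 : γ[id] = 0) (hδ : 0 < δ) (hK : 0 ≤ K)
    {β : ℝ} (hβ : 0 < β) {S : Ω → Fin p → ℝ} (hS : Measurable S)
    (hSi : ∀ j, Integrable (fun ω => S ω j) P) {θ : ℝ} (hcos : 0 ≤ Real.cos θ) {A B : ℝ}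
    (H : ∀ v : Fin p → ℝ,
      |∫ ω, smoothD1 c β (fun j => Real.sin θ * S ω j - v j) (fun j => S ω j) ∂P
        - Real.sin θ * ∫ ω, ∑ j, ∑ k, smoothHess c β (fun j => Real.sin θ * S ω j - v j) j k
            * ∫ g, g j * g k ∂γ ∂P|
      ≤ A * P.real {ω | softmax β (fun j => Real.sin θ * S ω j - v j)
          ∈ Set.Icc (-δ) (4 * δ)} + B)
    (u : Fin p → ℝ) :
    |∫ z, smoothD1 c β (fun j => Real.sin θ * S z.1 j + Real.cos θ * z.2 j - u j)
        (fun j => Real.cos θ * S z.1 j - Real.sin θ * z.2 j) ∂(P.prod γ)|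
      ≤ A * (P.prod γ).real {z | softmax β
          (fun j => Real.sin θ * S z.1 j + Real.cos θ * z.2 j - u j) ∈ Set.Icc (-δ) (4 * δ)}
        + B := by
  have hSj : ∀ j, Measurable fun ω => S ω j := fun j => (measurable_pi_apply j).comp hS
  let pt : Ω × EuclideanSpace ℝ (Fin p) → Fin p → ℝ := fun z j => Real.sin θ * S z.1 j + Real.cos θ * z.2 j - u j
  have hpt : Measurable pt := measurable_pi_lambda _ fun j => by
    have := hSj j; simp only [pt]; fun_prop
  have hz2 : Measurable fun (z : Ω × EuclideanSpace ℝ (Fin p)) (j : Fin p) => z.2 j :=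
    measurable_pi_lambda _ fun j => by fun_prop
  have k1 : Integrable (fun z => smoothD1 c β (pt z) (fun j => S z.1 j)) (P.prod γ) :=
    integrable_smoothD1 c hδ hK β hpt (hS.comp measurable_fst) fun j => (hSi j).comp_fst γ
  have k2 : Integrable (fun z => smoothD1 c β (pt z) (fun j => z.2 j)) (P.prod γ) :=
    integrable_smoothD1 c hδ hK β hpt hz2 fun j => (integrable_gaussian_coord j).comp_snd P
  set V : Fin p → Fin p → ℝ := fun j k => ∫ g, g j * g k ∂γ with hV
  let Q : (Fin p → ℝ) → ℝ := fun x => ∑ j, ∑ k, smoothHess c β x j k * V j k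
  have kQ : Integrable (fun z => Q (pt z)) (P.prod γ) :=
    integrable_finsetSum _ fun j _ => integrable_finsetSum _ fun k _ =>
      integrable_mul_of_bdd ((continuous_smoothHess c β j k).measurable.comp hpt)
        (fun z => abs_smoothHess_le c hδ hK hβ.le (pt z) j k) (integrable_const _)
  -- Integration by parts in G, with the data held fixed as part of the base point.
  have ibp : ∫ z, smoothD1 c β (pt z) (fun j => z.2 j) ∂(P.prod γ)
      = Real.cos θ * ∫ z, Q (pt z) ∂(P.prod γ) := by
    rw [integral_prod _ k2, integral_prod _ kQ, ← integral_const_mul]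
    congr 1
    ext ω
    have := integral_smoothD1_gaussian c h0 hδ hK hβ
      (fun j => Real.sin θ * S ω j - u j) (Real.cos θ)
    simp only [sub_add_eq_add_sub] at this
    exact this
  have esub : ∀ z : Ω × EuclideanSpace ℝ (Fin p), smoothD1 c β (pt z) (fun j => Real.cos θ * S z.1 j - Real.sin θ * z.2 j)
      = Real.cos θ * smoothD1 c β (pt z) (fun j => S z.1 j)
        - Real.sin θ * smoothD1 c β (pt z) (fun j => z.2 j) := fun z => by
    rw [smoothD1_sub, smoothD1_mul_left, smoothD1_mul_left]
  -- The Gaussian term contributes sin θ cos θ, so cos θ factors out and leaves precisely the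
  -- difference controlled by the hypothesis `H`.
  have e1 : ∫ z, smoothD1 c β (pt z) (fun j => Real.cos θ * S z.1 j - Real.sin θ * z.2 j)
        ∂(P.prod γ)
      = Real.cos θ * ∫ z, (smoothD1 c β (pt z) (fun j => S z.1 j) - Real.sin θ * Q (pt z))
          ∂(P.prod γ) := by
    simp only [esub]
    rw [integral_sub (k1.const_mul _) (k2.const_mul _), integral_const_mul, integral_const_mul,
      ibp, integral_sub k1 (kQ.const_mul _), integral_const_mul]
    ring
  set N : Set (Ω × EuclideanSpace ℝ (Fin p)) := {z | softmax β (pt z) ∈ Set.Icc (-δ) (4 * δ)} with hN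
  have hNm : MeasurableSet N := ((continuous_softmax β).measurable.comp hpt) measurableSet_Icc
  have iN : Integrable (N.indicator (1 : Ω × EuclideanSpace ℝ (Fin p) → ℝ)) (P.prod γ) :=
    (integrable_const (1 : ℝ)).indicator hNm
  have eN : (P.prod γ).real N
      = ∫ g, P.real {ω | softmax β (pt (ω, g)) ∈ Set.Icc (-δ) (4 * δ)} ∂γ := by
    rw [← integral_indicator_one hNm, integral_prod_symm _ iN]
    congr 1
    ext g
    have hm : MeasurableSet {ω | softmax β (pt (ω, g)) ∈ Set.Icc (-δ) (4 * δ)} :=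
      measurable_prodMk_right hNm
    rw [← integral_indicator_one hm]
    rfl
  have iNg : Integrable (fun g => P.real {ω | softmax β (pt (ω, g)) ∈ Set.Icc (-δ) (4 * δ)}) γ := by
    have := iN.integral_prod_right
    refine this.congr (Filter.Eventually.of_forall fun g => ?_)
    have hm : MeasurableSet {ω | softmax β (pt (ω, g)) ∈ Set.Icc (-δ) (4 * δ)} :=
      measurable_prodMk_right hNm
    simp only
    rw [← integral_indicator_one hm]
    rfl
  have hmain : |∫ z, (smoothD1 c β (pt z) (fun j => S z.1 j) - Real.sin θ * Q (pt z))
      ∂(P.prod γ)| ≤ A * (P.prod γ).real N + B := by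
    have k3 : Integrable (fun z => smoothD1 c β (pt z) (fun j => S z.1 j)
        - Real.sin θ * Q (pt z)) (P.prod γ) := k1.sub (kQ.const_mul (Real.sin θ))
    have hre : A * (P.prod γ).real N + B = ∫ g, (A * P.real {ω | softmax β (pt (ω, g))
        ∈ Set.Icc (-δ) (4 * δ)} + B) ∂γ := by
      rw [integral_add (iNg.const_mul A) (integrable_const B), integral_const_mul, ← eN]
      simp
    rw [hre, integral_prod_symm _ k3, ← Real.norm_eq_abs]
    refine norm_integral_le_of_norm_le ((iNg.const_mul A).add (integrable_const B)) ?_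
    filter_upwards [k1.prod_left_ae, kQ.prod_left_ae] with g hg1 hg2
    -- With g fixed, the Gaussian part is absorbed into the threshold. This is why `H` is required
    -- for every v; integrating over g then restores the strip probability on the product space.
    have := H fun j => u j - Real.cos θ * g j
    have hp : ∀ ω, (fun j => Real.sin θ * S ω j - (u j - Real.cos θ * g j)) = pt (ω, g) :=
      fun ω => by ext j; simp only [pt]; ring
    simp only [hp] at this
    rw [integral_sub hg1 (hg2.const_mul _), integral_const_mul, Real.norm_eq_abs]
    exact this
  change |∫ z, smoothD1 c β (pt z) (fun j => Real.cos θ * S z.1 j - Real.sin θ * z.2 j)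
        ∂(P.prod γ)| ≤ A * (P.prod γ).real N + B
  rw [e1, abs_mul, abs_of_nonneg hcos]
  exact (mul_le_of_le_one_left (abs_nonneg _) (Real.cos_le_one θ)).trans hmain

end Interpolation

/-! ### Gaussian anti-concentration for maxima -/

section AntiConcentration

lemma gaussianPDFReal_std (s : ℝ) :
    gaussianPDFReal 0 1 s = (Real.sqrt (2 * Real.pi))⁻¹ * Real.exp (-(s ^ 2 / 2)) := by
  simp [gaussianPDFReal, neg_div]

lemma gaussianPDFReal_std_le (s : ℝ) : gaussianPDFReal 0 1 s ≤ Real.exp (-(s ^ 2 / 2)) := by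
  rw [gaussianPDFReal_std]
  refine mul_le_of_le_one_left (Real.exp_pos _).le (inv_le_one_of_one_le₀ ?_)
  rw [Real.one_le_sqrt]
  nlinarith [Real.pi_gt_three]

/-- Lower bound for the Gaussian tail in terms of the density. -/
lemma gaussianPDFReal_le_tail (s : ℝ) :
    ENNReal.ofReal (gaussianPDFReal 0 1 s)
      ≤ ENNReal.ofReal (Real.exp (3 / 2) * (1 + max s 0)) * gaussianReal 0 1 (Set.Ici s) := by
  set t := 1 + max s 0 with ht
  have ht1 : 1 ≤ t := by rw [ht]; linarith [le_max_right s 0]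
  have hst : s ≤ t - 1 := by rw [ht]; linarith [le_max_left s 0]
  have ht0 : 0 < t := by linarith
  have hti : t⁻¹ ≤ 1 := inv_le_one_of_one_le₀ ht1
  have hti0 : 0 < t⁻¹ := inv_pos.2 ht0
  -- On a window of length 1/t to the right of s the exponent x²/2 grows by at most 1, so the
  -- density stays comparable to its value at s.
  have key : ENNReal.ofReal (Real.exp (-(3 / 2)) * gaussianPDFReal 0 1 s) * ENNReal.ofReal t⁻¹
      ≤ gaussianReal 0 1 (Set.Ici s) := by
    calc ENNReal.ofReal (Real.exp (-(3 / 2)) * gaussianPDFReal 0 1 s) * ENNReal.ofReal t⁻¹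
        = ∫⁻ _ in Set.Icc s (s + t⁻¹),
            ENNReal.ofReal (Real.exp (-(3 / 2)) * gaussianPDFReal 0 1 s) := by
          rw [setLIntegral_const, Real.volume_Icc, add_sub_cancel_left]
      _ ≤ ∫⁻ x in Set.Icc s (s + t⁻¹), gaussianPDF 0 1 x := by
          refine setLIntegral_mono (measurable_gaussianPDF 0 1) fun x hx => ?_
          rw [gaussianPDF]
          refine ENNReal.ofReal_le_ofReal ?_
          rw [gaussianPDFReal_std, gaussianPDFReal_std, mul_left_comm, ← Real.exp_add]
          refine mul_le_mul_of_nonneg_left (Real.exp_le_exp.2 ?_) (by positivity)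
          have h1 : 0 ≤ x - s := by linarith [hx.1]
          have h2 : x - s ≤ t⁻¹ := by linarith [hx.2]
          have h3 : t⁻¹ * t = 1 := inv_mul_cancel₀ ht0.ne'
          have h4 : x + s ≤ 2 * t := by linarith
          have h5 : (x - s) * (x + s) ≤ (x - s) * (2 * t) := mul_le_mul_of_nonneg_left h4 h1
          have h6 : (x - s) * (2 * t) ≤ t⁻¹ * (2 * t) :=
            mul_le_mul_of_nonneg_right h2 (by linarith)
          nlinarith
      _ = gaussianReal 0 1 (Set.Icc s (s + t⁻¹)) := (gaussianReal_apply 0 one_ne_zero _).symm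
      _ ≤ gaussianReal 0 1 (Set.Ici s) := measure_mono fun x hx => hx.1
  calc ENNReal.ofReal (gaussianPDFReal 0 1 s)
      = ENNReal.ofReal (Real.exp (3 / 2) * t)
        * (ENNReal.ofReal (Real.exp (-(3 / 2)) * gaussianPDFReal 0 1 s) * ENNReal.ofReal t⁻¹) := by
        rw [← ENNReal.ofReal_mul (mul_nonneg (Real.exp_pos _).le (gaussianPDFReal_nonneg _ _ _)),
          ← ENNReal.ofReal_mul (by positivity)]
        congr 1
        rw [Real.exp_neg]
        field_simp
    _ ≤ _ := mul_le_mul_right key _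

/-- For x in U the half-line [x, ∞) lies in U, so the density at x is at most a multiple of the mass
of U. Keeping that mass as a factor is what makes the later sum over cells affordable. -/
lemma gaussianReal_Ioc_inter_le {U : Set ℝ} (hU : IsUpperSet U) (hUm : MeasurableSet U)
    (b : ℝ) {d L : ℝ} (hL : max (b + d) 0 ≤ L) :
    gaussianReal 0 1 (Set.Ioc b (b + d) ∩ U)
      ≤ ENNReal.ofReal d * (ENNReal.ofReal (Real.exp (3 / 2) * (1 + L)) * gaussianReal 0 1 U) := by
  rw [gaussianReal_apply 0 one_ne_zero]
  calc ∫⁻ x in Set.Ioc b (b + d) ∩ U, gaussianPDF 0 1 x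
      ≤ ∫⁻ _ in Set.Ioc b (b + d) ∩ U,
          ENNReal.ofReal (Real.exp (3 / 2) * (1 + L)) * gaussianReal 0 1 U := by
        refine setLIntegral_mono' (measurableSet_Ioc.inter hUm) fun x hx => ?_
        refine (gaussianPDFReal_le_tail x).trans (mul_le_mul' (ENNReal.ofReal_le_ofReal ?_)
          (measure_mono fun y hy => hU hy hx.2))
        refine mul_le_mul_of_nonneg_left ?_ (Real.exp_pos _).le
        have := max_le_max_right 0 hx.1.2
        linarith
    _ = (ENNReal.ofReal (Real.exp (3 / 2) * (1 + L)) * gaussianReal 0 1 U)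
          * volume (Set.Ioc b (b + d) ∩ U) := setLIntegral_const _ _
    _ ≤ (ENNReal.ofReal (Real.exp (3 / 2) * (1 + L)) * gaussianReal 0 1 U)
          * ENNReal.ofReal d := by
        refine mul_le_mul_right ((measure_mono Set.inter_subset_left).trans ?_) _
        rw [Real.volume_Ioc, add_sub_cancel_left]
    _ = _ := mul_comm _ _

lemma gaussianReal_Ioc_le {b : ℝ} (hb : 0 ≤ b) (d : ℝ) :
    gaussianReal 0 1 (Set.Ioc b (b + d))
      ≤ ENNReal.ofReal d * ENNReal.ofReal (Real.exp (-(b ^ 2 / 2))) := by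
  rw [gaussianReal_apply 0 one_ne_zero]
  calc ∫⁻ x in Set.Ioc b (b + d), gaussianPDF 0 1 x
      ≤ ∫⁻ _ in Set.Ioc b (b + d), ENNReal.ofReal (Real.exp (-(b ^ 2 / 2))) := by
        refine setLIntegral_mono' measurableSet_Ioc fun x hx => ENNReal.ofReal_le_ofReal ?_
        refine (gaussianPDFReal_std_le x).trans (Real.exp_le_exp.2 ?_)
        have : b ^ 2 ≤ x ^ 2 := pow_le_pow_left₀ hb hx.1.le 2
        linarith
    _ = _ := by rw [setLIntegral_const, Real.volume_Ioc, add_sub_cancel_left, mul_comm]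

variable {Ω : Type*} [MeasurableSpace Ω] {μ : Measure Ω} [IsProbabilityMeasure μ]

/-- The one-dimensional bound holds in each section with R fixed, and Fubini reassembles it. -/
lemma measure_gaussian_upperCell_le {E : Type*} [MeasurableSpace E] {N : Ω → ℝ} {R : Ω → E}
    (hNm : Measurable N) (hRm : Measurable R) (hNR : IndepFun N R μ)
    (hN : μ.map N = gaussianReal 0 1) {T : Set (ℝ × E)} (hT : MeasurableSet T)
    (hup : ∀ r, IsUpperSet {x | (x, r) ∈ T}) (b : ℝ) {d L : ℝ} (hL : max (b + d) 0 ≤ L) :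
    μ {ω | N ω ∈ Set.Ioc b (b + d) ∧ (N ω, R ω) ∈ T}
      ≤ ENNReal.ofReal d * (ENNReal.ofReal (Real.exp (3 / 2) * (1 + L))
        * μ {ω | (N ω, R ω) ∈ T}) := by
  have hmap : μ.map (fun ω => (N ω, R ω)) = (gaussianReal 0 1).prod (μ.map R) := by
    rw [(indepFun_iff_map_prod_eq_prod_map_map hNm.aemeasurable hRm.aemeasurable).1 hNR, hN]
  have : IsProbabilityMeasure (μ.map R) := Measure.isProbabilityMeasure_map hRm.aemeasurable
  have hI : MeasurableSet (Prod.fst ⁻¹' Set.Ioc b (b + d) ∩ T : Set (ℝ × E)) :=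
    (measurable_fst measurableSet_Ioc).inter hT
  have e1 : μ {ω | N ω ∈ Set.Ioc b (b + d) ∧ (N ω, R ω) ∈ T}
      = (gaussianReal 0 1).prod (μ.map R) (Prod.fst ⁻¹' Set.Ioc b (b + d) ∩ T) := by
    rw [← hmap, Measure.map_apply (hNm.prodMk hRm) hI]; rfl
  have e2 : μ {ω | (N ω, R ω) ∈ T} = (gaussianReal 0 1).prod (μ.map R) T := by
    rw [← hmap, Measure.map_apply (hNm.prodMk hRm) hT]; rfl
  rw [e1, e2, Measure.prod_apply_symm hI, Measure.prod_apply_symm hT,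
    ← lintegral_const_mul _ (measurable_measure_prodMk_right hT),
    ← lintegral_const_mul _ ((measurable_measure_prodMk_right hT).const_mul _)]
  refine lintegral_mono fun r => ?_
  exact gaussianReal_Ioc_inter_le (hup r) (measurable_prodMk_right hT) b hL

/-- Points at which the coordinate `j` is the first to maximize `x - b`. -/
def argmaxCell {p : ℕ} (b : Fin p → ℝ) (j : Fin p) : Set (Fin p → ℝ) :=
  {x | ∀ k, x k - b k ≤ x j - b j ∧ (k < j → x k - b k < x j - b j)}

variable {p : ℕ}

lemma exists_mem_argmaxCell [Nonempty (Fin p)] (b x : Fin p → ℝ) : ∃ j, x ∈ argmaxCell b j := by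
  classical
  obtain ⟨i, -, hi⟩ := Finset.exists_max_image Finset.univ (fun j => x j - b j)
    Finset.univ_nonempty
  let s : Finset (Fin p) := Finset.univ.filter fun j => ∀ k, x k - b k ≤ x j - b j
  have hs : s.Nonempty := ⟨i, by simpa [s] using hi⟩
  have hj : ∀ k, x k - b k ≤ x (s.min' hs) - b (s.min' hs) := by
    have := s.min'_mem hs
    simpa [s] using this
  refine ⟨s.min' hs, fun k => ⟨hj k, fun hk => lt_of_le_of_ne (hj k) fun he => ?_⟩⟩
  have : k ∈ s := by
    simp only [s, Finset.mem_filter, Finset.mem_univ, true_and]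
    exact fun l => (hj l).trans he.ge
  exact absurd (s.min'_le k this) (not_le.2 hk)

lemma disjoint_argmaxCell (b : Fin p → ℝ) :
    Pairwise (Function.onFun Disjoint (argmaxCell b)) := by
  have key : ∀ i j, i < j → Disjoint (argmaxCell b i) (argmaxCell b j) := fun i j hij =>
    Set.disjoint_left.2 fun x hi hj => absurd ((hi j).1) (not_le.2 ((hj i).2 hij))
  intro i j hij
  rcases lt_or_gt_of_ne hij with h | h
  · exact key i j h
  · exact (key j i h).symm

lemma measurableSet_argmaxCell (b : Fin p → ℝ) (j : Fin p) :
    MeasurableSet (argmaxCell b j) := by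
  have : argmaxCell b j = ⋂ k, ({x : Fin p → ℝ | x k - b k ≤ x j - b j}
      ∩ {x | k < j → x k - b k < x j - b j}) := by
    ext x; simp [argmaxCell]
  rw [this]
  refine MeasurableSet.iInter fun k => (measurableSet_le (by fun_prop) (by fun_prop)).inter ?_
  by_cases hk : k < j
  · simp only [hk, true_imp_iff]
    exact measurableSet_lt (by fun_prop) (by fun_prop)
  · simp [hk]

variable {G : Ω → Fin p → ℝ}

/-- Given the residuals G_k - ρ_k G_j, which are independent of G_j, raising G_j raises coordinate j
at rate 1 and the others at rate ρ_k ≤ 1. Coordinate j remains the maximizer, so the cell is an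
upper set in G_j. -/
lemma measure_argmaxCell_le (hG : HasGaussianLaw G μ) (hGm : Measurable G)
    (hG0 : ∀ j, ∫ ω, G ω j ∂μ = 0) (hG1 : ∀ j, Var[fun ω => G ω j; μ] = 1)
    (b : Fin p → ℝ) (j : Fin p) {d L : ℝ} (hL : max (b j + d) 0 ≤ L) :
    μ {ω | G ω j ∈ Set.Ioc (b j) (b j + d) ∧ G ω ∈ argmaxCell b j}
      ≤ ENNReal.ofReal d * (ENNReal.ofReal (Real.exp (3 / 2) * (1 + L))
        * μ {ω | G ω ∈ argmaxCell b j}) := by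
  have hGj : ∀ k, Measurable fun ω => G ω k := fun k => (measurable_pi_apply k).comp hGm
  have hm : ∀ k, MemLp (fun ω => G ω k) 2 μ := fun k =>
    (hG.map (ContinuousLinearMap.proj k : (Fin p → ℝ) →L[ℝ] ℝ)).memLp_two
  let ρ : Fin p → ℝ := fun k => cov[fun ω => G ω j, fun ω => G ω k; μ]
  have hρ : ∀ k, ρ k ≤ 1 := fun k => by
    -- With unit variances, Var(G_j - G_k) = 2 - 2ρ_k.
    have h := variance_nonneg (fun ω => G ω j - G ω k) μ
    rw [variance_fun_sub (hm j) (hm k), hG1, hG1] at h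
    simp only [ρ]
    linarith
  let R : Ω → Fin p → ℝ := fun ω k => G ω k - ρ k * G ω j
  have hR : Measurable R := measurable_pi_lambda _ fun k => (hGj k).sub ((hGj j).const_mul _)
  have hind : IndepFun (fun ω => G ω j) R μ := by
    have h := HasGaussianLaw.indepFun_of_covariance_eval (P := μ) (ι := Unit) (κ := Fin p)
      (X := fun _ ω => G ω j) (Y := fun k ω => R ω k) ?_ ?_
    · exact h.comp (φ := fun x : Unit → ℝ => x ()) (ψ := fun x : Fin p → ℝ => x)
        (measurable_pi_apply ()) measurable_id
    · exact hG.map ((ContinuousLinearMap.pi fun _ : Unit => ContinuousLinearMap.proj j).prod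
        (ContinuousLinearMap.pi fun k : Fin p =>
          (ContinuousLinearMap.proj k - ρ k • ContinuousLinearMap.proj j :
            (Fin p → ℝ) →L[ℝ] ℝ)))
    · intro _ k
      simp only [R]
      rw [covariance_fun_sub_right (hm j) (hm k) ((hm j).const_mul _), covariance_const_mul_right,
        covariance_self (hGj j).aemeasurable, hG1]
      simp [ρ]
  have hN : μ.map (fun ω => G ω j) = gaussianReal 0 1 := by
    have := (hG.map (ContinuousLinearMap.proj j : (Fin p → ℝ) →L[ℝ] ℝ)).map_eq_gaussianReal
    have e : (⇑(ContinuousLinearMap.proj j : (Fin p → ℝ) →L[ℝ] ℝ) ∘ G) = fun ω => G ω j := rfl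
    rw [e, hG0, hG1] at this
    simpa using this
  -- The second condition says that residual j vanishes, as it does for the actual residuals since
  -- ρ_j = 1; the reconstructed coordinate j is then the first variable itself.
  let T : Set (ℝ × (Fin p → ℝ)) := (fun z k => z.2 k + ρ k * z.1) ⁻¹' argmaxCell b j
    ∩ {z | z.2 j + ρ j * z.1 = z.1}
  have hjj : ρ j = 1 := by
    simp only [ρ]; rw [covariance_self (hGj j).aemeasurable, hG1]
  have hT : MeasurableSet T := by
    refine (measurableSet_argmaxCell b j).preimage
      (measurable_pi_lambda _ fun k => by fun_prop) |>.inter ?_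
    exact measurableSet_eq_fun (by fun_prop) (by fun_prop)
  have hTm : ∀ ω, (G ω j, R ω) ∈ T ↔ G ω ∈ argmaxCell b j := fun ω => by
    simp [T, R, hjj]
  have := measure_gaussian_upperCell_le (hGj j) hR hind hN hT ?_ (b j) hL
  · simpa only [hTm] using this
  · rintro r x y hxy ⟨hx, hx'⟩
    simp only [Set.mem_ofPred_eq, hjj, one_mul, add_eq_right] at hx'
    refine ⟨fun k => ?_, by simp [hjj, hx']⟩
    have h1 := hx k
    have h2 : ρ k * (y - x) ≤ y - x := mul_le_of_le_one_left (by linarith) (hρ k)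
    simp only [hjj, hx'] at h1 ⊢
    refine ⟨by linarith [h1.1], fun hk => by linarith [h1.2 hk]⟩

/-- Nazarov's inequality for standardized Gaussian vectors. -/
lemma measure_max_standardGaussian_le (hp : 2 ≤ p) (hG : HasGaussianLaw G μ) (hGm : Measurable G)
    (hG0 : ∀ j, ∫ ω, G ω j ∂μ = 0) (hG1 : ∀ j, Var[fun ω => G ω j; μ] = 1)
    (b : Fin p → ℝ) {d : ℝ} (hd : 0 ≤ d) (hd1 : d ≤ 1) :
    μ.real {ω | (∀ j, G ω j ≤ b j + d) ∧ ∃ j, b j < G ω j}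
      ≤ d * (1 + Real.exp (3 / 2) * (2 + Real.sqrt (2 * Real.log p))) := by
  have hp0 : (0 : ℝ) < p := by positivity
  have : Nonempty (Fin p) := ⟨⟨0, by omega⟩⟩
  set l := Real.sqrt (2 * Real.log p) with hl
  have hl0 : 0 ≤ l := Real.sqrt_nonneg _
  have hl2 : l ^ 2 = 2 * Real.log p :=
    Real.sq_sqrt (mul_nonneg zero_le_two (Real.log_natCast_nonneg p))
  set c := Real.exp (3 / 2) * (2 + l) with hc
  have hc0 : 0 ≤ c := by positivity
  have hGj : ∀ k, Measurable fun ω => G ω k := fun k => (measurable_pi_apply k).comp hGm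
  have hcm : ∀ j, MeasurableSet {ω | G ω ∈ argmaxCell b j} := fun j =>
    hGm (measurableSet_argmaxCell b j)
  have hcell : ∀ j, μ {ω | G ω j ∈ Set.Ioc (b j) (b j + d) ∧ G ω ∈ argmaxCell b j}
      ≤ ENNReal.ofReal (d * (1 / p)) + ENNReal.ofReal (d * c)
        * μ {ω | G ω ∈ argmaxCell b j} := fun j => by
    -- Below √(2 log p) the cell bound has a factor of order √(log p) times the mass of the cell.
    -- Above it the density is at most 1/p, so these coordinates add at most d in total.
    by_cases hbj : b j ≤ l
    · refine le_add_left ((measure_argmaxCell_le hG hGm hG0 hG1 b j (L := 1 + l) ?_).trans ?_)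
      · exact max_le (by linarith) (by linarith)
      · rw [← mul_assoc, ← ENNReal.ofReal_mul hd, hc]
        ring_nf
        exact le_rfl
    · refine le_add_right ?_
      have hN : μ.map (fun ω => G ω j) = gaussianReal 0 1 := by
        have := (hG.map (ContinuousLinearMap.proj j : (Fin p → ℝ) →L[ℝ] ℝ)).map_eq_gaussianReal
        have e : (⇑(ContinuousLinearMap.proj j : (Fin p → ℝ) →L[ℝ] ℝ) ∘ G) = fun ω => G ω j := rfl
        rw [e, hG0, hG1] at this
        simpa using this
      push Not at hbj
      calc μ {ω | G ω j ∈ Set.Ioc (b j) (b j + d) ∧ G ω ∈ argmaxCell b j}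
          ≤ μ ((fun ω => G ω j) ⁻¹' Set.Ioc (b j) (b j + d)) := measure_mono fun ω h => h.1
        _ = gaussianReal 0 1 (Set.Ioc (b j) (b j + d)) := by
          rw [← hN, Measure.map_apply (hGj j) measurableSet_Ioc]
        _ ≤ _ := gaussianReal_Ioc_le (hl0.trans hbj.le) d
        _ ≤ ENNReal.ofReal (d * (1 / p)) := by
          rw [← ENNReal.ofReal_mul hd]
          refine ENNReal.ofReal_le_ofReal (mul_le_mul_of_nonneg_left ?_ hd)
          have h2 : l ^ 2 ≤ b j ^ 2 := pow_le_pow_left₀ hl0 hbj.le 2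
          calc Real.exp (-(b j ^ 2 / 2)) ≤ Real.exp (-Real.log p) :=
                Real.exp_le_exp.2 (by linarith)
            _ = 1 / p := by rw [Real.exp_neg, Real.exp_log hp0, one_div]
  -- Breaking ties by the smallest index makes the cells disjoint, which removes the union-bound
  -- factor p.
  have hsum : ∑ j, μ {ω | G ω ∈ argmaxCell b j} ≤ 1 := by
    have h := measure_iUnion (μ := μ) (f := fun j => {ω | G ω ∈ argmaxCell b j})
      (fun i j hij => (disjoint_argmaxCell b hij).preimage G) hcm
    rw [tsum_fintype] at h
    rw [← h]
    exact prob_le_one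
  have hmain : μ {ω | (∀ j, G ω j ≤ b j + d) ∧ ∃ j, b j < G ω j}
      ≤ ENNReal.ofReal (d * (1 + c)) := by
    calc μ {ω | (∀ j, G ω j ≤ b j + d) ∧ ∃ j, b j < G ω j}
        ≤ μ (⋃ j, {ω | G ω j ∈ Set.Ioc (b j) (b j + d) ∧ G ω ∈ argmaxCell b j}) := by
          refine measure_mono fun ω hω => ?_
          obtain ⟨i, hi⟩ := hω.2
          obtain ⟨j, hj⟩ := exists_mem_argmaxCell b (G ω)
          refine Set.mem_iUnion.2 ⟨j, ⟨?_, hω.1 j⟩, hj⟩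
          linarith [(hj i).1]
      _ ≤ ∑ j, μ {ω | G ω j ∈ Set.Ioc (b j) (b j + d) ∧ G ω ∈ argmaxCell b j} :=
          measure_iUnion_fintype_le _ _
      _ ≤ ∑ j, (ENNReal.ofReal (d * (1 / p)) + ENNReal.ofReal (d * c)
            * μ {ω | G ω ∈ argmaxCell b j}) := Finset.sum_le_sum fun j _ => hcell j
      _ = p * ENNReal.ofReal (d * (1 / p)) + ENNReal.ofReal (d * c)
            * ∑ j, μ {ω | G ω ∈ argmaxCell b j} := by
          rw [Finset.sum_add_distrib, ← Finset.mul_sum]; simp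
      _ ≤ ENNReal.ofReal d + ENNReal.ofReal (d * c) * 1 := by
          refine add_le_add (le_of_eq ?_) (mul_le_mul_right hsum _)
          rw [← ENNReal.ofReal_natCast, ← ENNReal.ofReal_mul hp0.le]
          congr 1
          field_simp
      _ = ENNReal.ofReal (d * (1 + c)) := by
          rw [mul_one, ← ENNReal.ofReal_add hd (by positivity)]
          congr 1; ring
  exact ENNReal.toReal_le_of_le_ofReal (by positivity) hmain

/-- Nazarov's inequality: the maximum of a centred Gaussian vector with variances bounded below
does not concentrate. -/
lemma measureReal_gaussian_shift_le (hp : 2 ≤ p) {K₃ : ℝ} (hK₃ : 0 < K₃)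
    {γ : Measure (EuclideanSpace ℝ (Fin p))} [IsGaussian γ] (h0 : γ[id] = 0)
    (hV : ∀ j, K₃ ≤ ∫ g, g j * g j ∂γ) (u : Fin p → ℝ) {δ : ℝ} (hδ : 0 ≤ δ) :
    γ.real {g | ∀ j, g j ≤ u j + δ}
      ≤ γ.real {g | ∀ j, g j ≤ u j} + 30 * (Real.sqrt K₃)⁻¹ * δ * Real.sqrt (Real.log p) := by
  set l := Real.sqrt (Real.log p) with hl
  have hp2 : Real.log 2 ≤ Real.log p := Real.log_le_log two_pos (by exact_mod_cast hp)
  have hl45 : 4 / 5 ≤ l := Real.le_sqrt_of_sq_le (by linarith [Real.log_two_gt_d9])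
  have hK : 0 < Real.sqrt K₃ := Real.sqrt_pos.2 hK₃
  set d := (Real.sqrt K₃)⁻¹ * δ with hd
  have hd0 : 0 ≤ d := by positivity
  rw [mul_assoc 30, ← hd]
  -- For d > 1 the added term already exceeds one, because √(log p) ≥ 4/5.
  rcases le_or_gt d 1 with hd1 | hd1
  swap
  · have h1 : γ.real {g | ∀ j, g j ≤ u j + δ} ≤ 1 := measureReal_le_one
    have h2 : (0 : ℝ) ≤ γ.real {g | ∀ j, g j ≤ u j} := measureReal_nonneg
    nlinarith
  -- Each coordinate is scaled to unit variance; the lower variance bound keeps every rescaled shift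
  -- at most d.
  let a : Fin p → ℝ := fun j => (Real.sqrt (∫ g, g j * g j ∂γ))⁻¹
  have hV0 : ∀ j, 0 < ∫ g, g j * g j ∂γ := fun j => hK₃.trans_le (hV j)
  have ha0 : ∀ j, 0 < a j := fun j => inv_pos.2 (Real.sqrt_pos.2 (hV0 j))
  have haK : ∀ j, a j ≤ (Real.sqrt K₃)⁻¹ := fun j =>
    inv_anti₀ hK (Real.sqrt_le_sqrt (hV j))
  let G : EuclideanSpace ℝ (Fin p) → Fin p → ℝ := fun g j => a j * g j
  have hG : HasGaussianLaw G γ := by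
    have h := (IsGaussian.hasGaussianLaw_id (μ := γ)).map
      (ContinuousLinearMap.pi fun j : Fin p =>
        (a j • EuclideanSpace.proj j : EuclideanSpace ℝ (Fin p) →L[ℝ] ℝ))
    exact h.congr (ae_of_all _ fun g => by ext j; simp [G])
  have hGm : Measurable G := measurable_pi_lambda _ fun j => by simp only [G]; fun_prop
  have hG0 : ∀ j, ∫ g, G g j ∂γ = 0 := fun j => by
    simp only [G]
    rw [integral_const_mul, integral_gaussian_coord h0, mul_zero]
  have hG1 : ∀ j, Var[fun g => G g j; γ] = 1 := fun j => by
    simp only [G]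
    rw [variance_const_mul, variance_of_integral_eq_zero (by fun_prop)
      (integral_gaussian_coord h0 j)]
    simp only [pow_two, a]
    rw [← mul_inv, Real.mul_self_sqrt (hV0 j).le, inv_mul_cancel₀ (hV0 j).ne']
  have hmax := measure_max_standardGaussian_le hp hG hGm hG0 hG1 (fun j => a j * u j) hd0 hd1
  have hsub : {g : EuclideanSpace ℝ (Fin p) | ∀ j, g j ≤ u j + δ} ⊆ {g | ∀ j, g j ≤ u j}
      ∪ {g | (∀ j, G g j ≤ a j * u j + d) ∧ ∃ j, a j * u j < G g j} := by
    intro g hg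
    by_cases h : ∀ j, g j ≤ u j
    · exact Or.inl h
    · push Not at h
      obtain ⟨i, hi⟩ := h
      refine Or.inr ⟨fun j => ?_, i, mul_lt_mul_of_pos_left hi (ha0 i)⟩
      calc a j * g j ≤ a j * (u j + δ) := mul_le_mul_of_nonneg_left (hg j) (ha0 j).le
        _ = a j * u j + a j * δ := mul_add _ _ _
        _ ≤ _ := add_le_add le_rfl (mul_le_mul_of_nonneg_right (haK j) hδ)
  refine (measureReal_mono hsub).trans ((measureReal_union_le _ _).trans
    (add_le_add le_rfl (hmax.trans ?_)))
  have he : Real.exp (3 / 2) ≤ 4.5 := by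
    have h1 : Real.exp (3 / 2) * Real.exp (3 / 2) = Real.exp 1 ^ 3 := by
      rw [← Real.exp_add, ← Real.exp_nat_mul]; norm_num
    have h2 : Real.exp 1 ^ 3 ≤ 2.72 ^ 3 := by
      refine pow_le_pow_left₀ (Real.exp_pos _).le ?_ 3
      linarith [Real.exp_one_lt_d9]
    nlinarith [Real.exp_pos (3 / 2)]
  have hs2 : Real.sqrt (2 * Real.log p) ≤ 1.5 * l := by
    rw [Real.sqrt_mul zero_le_two, ← hl]
    refine mul_le_mul_of_nonneg_right ?_ (by linarith)
    exact Real.sqrt_le_iff.2 ⟨by norm_num, by norm_num⟩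
  have h3 : Real.exp (3 / 2) * (2 + Real.sqrt (2 * Real.log p)) ≤ 4.5 * (2 + 1.5 * l) :=
    mul_le_mul he (by linarith) (by positivity) (by norm_num)
  calc d * (1 + Real.exp (3 / 2) * (2 + Real.sqrt (2 * Real.log p)))
      ≤ d * (30 * l) := mul_le_mul_of_nonneg_left (by linarith) hd0
    _ = 30 * d * l := by ring

end AntiConcentration

/-! ### Comparison of rectangle probabilities along the interpolation -/

section Comparison

variable {Ω : Type*} [MeasurableSpace Ω] {P : Measure Ω} [IsProbabilityMeasure P] {p : ℕ}
  {γ : Measure (EuclideanSpace ℝ (Fin p))} [IsProbabilityMeasure γ] {δ K : ℝ}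

/-- Probability that the interpolation at angle `θ` is dominated by `u`. -/
def pathProb (S : Ω → Fin p → ℝ) (P : Measure Ω) (γ : Measure (EuclideanSpace ℝ (Fin p)))
    (θ : ℝ) (u : Fin p → ℝ) : ℝ :=
  (P.prod γ).real {z | ∀ j, Real.sin θ * S z.1 j + Real.cos θ * z.2 j ≤ u j}

lemma measurable_path {S : Ω → Fin p → ℝ} (hS : Measurable S) (θ : ℝ) (u : Fin p → ℝ) :
    Measurable fun (z : Ω × EuclideanSpace ℝ (Fin p)) (j : Fin p) =>
      Real.sin θ * S z.1 j + Real.cos θ * z.2 j - u j :=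
  measurable_pi_lambda _ fun j => by
    have := (measurable_pi_apply j).comp hS
    simp only [Function.comp_def] at this
    fun_prop

lemma measurableSet_path {S : Ω → Fin p → ℝ} (hS : Measurable S) (θ : ℝ) (u : Fin p → ℝ) :
    MeasurableSet {z : Ω × EuclideanSpace ℝ (Fin p) |
      ∀ j, Real.sin θ * S z.1 j + Real.cos θ * z.2 j ≤ u j} := by
  have : {z : Ω × EuclideanSpace ℝ (Fin p) |
      ∀ j, Real.sin θ * S z.1 j + Real.cos θ * z.2 j ≤ u j}
      = ⋂ j, {z | Real.sin θ * S z.1 j + Real.cos θ * z.2 j - u j ≤ 0} := by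
    ext z; simp
  rw [this]
  exact MeasurableSet.iInter fun j => measurableSet_le
    ((measurable_pi_apply j).comp (measurable_path hS θ u)) measurable_const

lemma pathProb_zero (S : Ω → Fin p → ℝ) (u : Fin p → ℝ) :
    pathProb S P γ 0 u = γ.real {g | ∀ j, g j ≤ u j} := by
  have : {z : Ω × EuclideanSpace ℝ (Fin p) |
      ∀ j, Real.sin 0 * S z.1 j + Real.cos 0 * z.2 j ≤ u j}
      = Set.univ ×ˢ {g | ∀ j, g j ≤ u j} := by
    ext z; simp
  rw [pathProb, this, measureReal_prod_prod, probReal_univ, one_mul]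

lemma abs_pathProb_sub_le_one (S : Ω → Fin p → ℝ) (θ : ℝ) (u : Fin p → ℝ) :
    |pathProb S P γ θ u - γ.real {g | ∀ j, g j ≤ u j}| ≤ 1 := by
  have h1 : pathProb S P γ θ u ≤ 1 := measureReal_le_one
  have h2 : 0 ≤ pathProb S P γ θ u := measureReal_nonneg
  have h3 : γ.real {g | ∀ j, g j ≤ u j} ≤ 1 := measureReal_le_one
  have h4 : 0 ≤ γ.real {g | ∀ j, g j ≤ u j} := measureReal_nonneg
  exact abs_le.2 ⟨by linarith, by linarith⟩

variable (c : SmoothCutoff δ K)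

lemma integrable_smoothInd_path [Nonempty (Fin p)] {S : Ω → Fin p → ℝ} (hS : Measurable S)
    (β θ : ℝ) (u : Fin p → ℝ) :
    Integrable (fun z => smoothInd c β
      (fun j => Real.sin θ * S z.1 j + Real.cos θ * z.2 j - u j)) (P.prod γ) := by
  refine Integrable.of_bound ((continuous_smoothInd c β).measurable.comp
    (measurable_path hS θ u)).aestronglyMeasurable 1 (Filter.Eventually.of_forall fun z => ?_)
  rw [Real.norm_eq_abs, smoothInd, abs_of_nonneg (c.nonneg _)]
  exact c.le_one _

/-- On the orthant the soft maximum is at most log p / β ≤ δ, where the cutoff is still 1. -/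
lemma pathProb_le_integral_smoothInd [Nonempty (Fin p)] {S : Ω → Fin p → ℝ} (hS : Measurable S)
    {β : ℝ} (hβ : 0 < β) (hβδ : Real.log p / β ≤ δ) (θ : ℝ) (u : Fin p → ℝ) :
    pathProb S P γ θ u ≤ ∫ z, smoothInd c β
      (fun j => Real.sin θ * S z.1 j + Real.cos θ * z.2 j - u j) ∂(P.prod γ) := by
  rw [pathProb, ← integral_indicator_one (measurableSet_path hS θ u)]
  refine integral_mono ((integrable_const (1 : ℝ)).indicator (measurableSet_path hS θ u))
    (integrable_smoothInd_path c hS β θ u) fun z => ?_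
  by_cases hz : ∀ j, Real.sin θ * S z.1 j + Real.cos θ * z.2 j ≤ u j
  · rw [Set.indicator_of_mem (by exact hz)]
    refine (c.eq_one _ ?_).ge
    have := softmax_le hβ (x := fun j => Real.sin θ * S z.1 j + Real.cos θ * z.2 j - u j) (c := 0)
      fun j => sub_nonpos.2 (hz j)
    rw [Fintype.card_fin] at this
    linarith
  · rw [Set.indicator_of_notMem (by exact hz)]
    exact c.nonneg _

/-- A coordinate exceeding its threshold by 2δ pushes the soft maximum above 2δ, where the cutoff
vanishes. -/
lemma integral_smoothInd_le_pathProb [Nonempty (Fin p)] {S : Ω → Fin p → ℝ} (hS : Measurable S)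
    {β : ℝ} (hβ : 0 < β) (θ : ℝ) (u : Fin p → ℝ) :
    ∫ z, smoothInd c β (fun j => Real.sin θ * S z.1 j + Real.cos θ * z.2 j - u j) ∂(P.prod γ)
      ≤ pathProb S P γ θ (fun j => u j + 2 * δ) := by
  rw [pathProb, ← integral_indicator_one (measurableSet_path hS θ _)]
  refine integral_mono (integrable_smoothInd_path c hS β θ u)
    ((integrable_const (1 : ℝ)).indicator (measurableSet_path hS θ _)) fun z => ?_
  by_cases hz : ∀ j, Real.sin θ * S z.1 j + Real.cos θ * z.2 j ≤ u j + 2 * δ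
  · rw [Set.indicator_of_mem (by exact hz)]
    exact c.le_one _
  · rw [Set.indicator_of_notMem (by exact hz)]
    push Not at hz
    obtain ⟨j, hj⟩ := hz
    refine (c.eq_zero _ ?_).le
    refine le_trans ?_ (le_softmax hβ _ j)
    simp only
    linarith

/-- If every coordinate were below its threshold by 2δ, the soft maximum would be strictly below -δ;
this is where the strict inequality log p / β < δ is needed. -/
lemma measureReal_softmax_mem_le [Nonempty (Fin p)] {S : Ω → Fin p → ℝ} (hS : Measurable S)
    {β : ℝ} (hβ : 0 < β) (hδ : 0 < δ) (hβδ : Real.log p / β < δ) (θ : ℝ) (u : Fin p → ℝ) :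
    (P.prod γ).real {z | softmax β (fun j => Real.sin θ * S z.1 j + Real.cos θ * z.2 j - u j)
        ∈ Set.Icc (-δ) (4 * δ)}
      ≤ pathProb S P γ θ (fun j => u j + 4 * δ) - pathProb S P γ θ (fun j => u j - 2 * δ) := by
  rw [pathProb, pathProb, ← measureReal_sdiff _ (measurableSet_path hS θ _)]
  · refine measureReal_mono fun z hz => ⟨fun j => ?_, fun h => ?_⟩
    · have := (le_softmax hβ _ j).trans hz.2
      simp only at this
      linarith
    · have := softmax_le hβ (x := fun j => Real.sin θ * S z.1 j + Real.cos θ * z.2 j - u j)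
        (c := -(2 * δ)) fun j => by have := h j; linarith
      rw [Fintype.card_fin] at this
      linarith [hz.1]
  · intro z hz j
    have := hz j
    simp only at this
    linarith

/-- Rectangle probabilities along the interpolation stay close to the Gaussian ones, provided the
smoothed expectations vary slowly; the discrepancy `r` is allowed to enter the hypothesis. -/
lemma abs_pathProb_sub_le [IsGaussian γ] (h0 : γ[id] = 0) (hp : 2 ≤ p) {K₃ : ℝ} (hK₃ : 0 < K₃)
    (hV : ∀ j, K₃ ≤ ∫ g, g j * g j ∂γ) (hδ : 0 < δ) (hK : 0 ≤ K) {β : ℝ} (hβ : 0 < β)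
    (hβδ : Real.log p / β < δ) {S : Ω → Fin p → ℝ} (hS : Measurable S)
    (hSi : ∀ j, Integrable (fun ω => S ω j) P) {A B : ℝ} (hA : 0 ≤ A)
    (H : ∀ θ ∈ Set.Icc 0 (Real.pi / 2), ∀ v : Fin p → ℝ,
      |∫ ω, smoothD1 c β (fun j => Real.sin θ * S ω j - v j) (fun j => S ω j) ∂P
        - Real.sin θ * ∫ ω, ∑ j, ∑ k, smoothHess c β (fun j => Real.sin θ * S ω j - v j) j k
            * ∫ g, g j * g k ∂γ ∂P|
      ≤ A * P.real {ω | softmax β (fun j => Real.sin θ * S ω j - v j)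
          ∈ Set.Icc (-δ) (4 * δ)} + B)
    {r : ℝ} (hr : ∀ θ ∈ Set.Icc 0 (Real.pi / 2), ∀ u : Fin p → ℝ,
      |pathProb S P γ θ u - γ.real {g | ∀ j, g j ≤ u j}| ≤ r)
    {θ : ℝ} (hθ : θ ∈ Set.Icc 0 (Real.pi / 2)) (u : Fin p → ℝ) :
    |pathProb S P γ θ u - γ.real {g | ∀ j, g j ≤ u j}|
      ≤ 2 * (30 * (Real.sqrt K₃)⁻¹ * δ * Real.sqrt (Real.log p))
        + 2 * (A * (2 * r + 6 * (30 * (Real.sqrt K₃)⁻¹ * δ * Real.sqrt (Real.log p))) + B) := by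
  have : Nonempty (Fin p) := ⟨⟨0, by omega⟩⟩
  set a := 30 * (Real.sqrt K₃)⁻¹ * δ * Real.sqrt (Real.log p) with ha
  have hN : ∀ (v : Fin p → ℝ) (i : ℝ), 0 ≤ i → γ.real {g | ∀ j, g j ≤ v j + i * δ}
      ≤ γ.real {g | ∀ j, g j ≤ v j} + i * a := fun v i hi => by
    refine (measureReal_gaussian_shift_le hp hK₃ h0 hV v (mul_nonneg hi hδ.le)).trans (le_of_eq ?_)
    rw [ha]; ring
  have hE : ∀ v : Fin p → ℝ,
      |∫ z, smoothInd c β (fun j => Real.sin θ * S z.1 j + Real.cos θ * z.2 j - v j) ∂(P.prod γ)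
        - ∫ z, smoothInd c β (fun j => Real.sin 0 * S z.1 j + Real.cos 0 * z.2 j - v j)
          ∂(P.prod γ)| ≤ 2 * (A * (2 * r + 6 * a) + B) := fun v => by
    have hder : ∀ t ∈ Set.Icc (0 : ℝ) (Real.pi / 2),
        ‖∫ z, smoothD1 c β (fun j => Real.sin t * S z.1 j + Real.cos t * z.2 j - v j)
          (fun j => Real.cos t * S z.1 j - Real.sin t * z.2 j) ∂(P.prod γ)‖
        ≤ A * (2 * r + 6 * a) + B := fun t ht => by
      rw [Real.norm_eq_abs]
      refine (abs_deriv_interpolation_le c h0 hδ hK hβ hS hSi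
        (Real.cos_nonneg_of_mem_Icc ⟨by linarith [ht.1, Real.pi_pos], ht.2⟩) (H t ht) v).trans ?_
      refine add_le_add (mul_le_mul_of_nonneg_left ?_ hA) le_rfl
      refine (measureReal_softmax_mem_le hS hβ hδ hβδ t v).trans ?_
      have h1 := (abs_le.1 (hr t ht fun j => v j + 4 * δ)).2
      have h2 := (abs_le.1 (hr t ht fun j => v j - 2 * δ)).1
      -- The strip is a difference of two path probabilities; each is within r of its Gaussian
      -- value, and the Gaussian values differ by a shift of 6δ.
      have h3 := hN (fun j => v j - 2 * δ) 6 (by norm_num)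
      have h4 : (fun g : EuclideanSpace ℝ (Fin p) => ∀ j, g j ≤ v j - 2 * δ + 6 * δ)
          = fun g => ∀ j, g j ≤ v j + 4 * δ := by
        ext g; exact forall_congr' fun j => by rw [show v j - 2 * δ + 6 * δ = v j + 4 * δ by ring]
      have h5 : {g : EuclideanSpace ℝ (Fin p) | ∀ j, g j ≤ v j - 2 * δ + 6 * δ}
          = {g | ∀ j, g j ≤ v j + 4 * δ} := congrArg Set.ofPred h4
      rw [h5] at h3
      linarith
    have := (convex_Icc (0 : ℝ) (Real.pi / 2)).norm_image_sub_le_of_norm_hasDerivWithin_le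
      (fun t _ => (hasDerivAt_interpolation c hδ hK hβ hS hSi v t).hasDerivWithinAt) hder
      ⟨le_rfl, by positivity⟩ hθ
    rw [Real.norm_eq_abs, Real.norm_eq_abs, sub_zero, abs_of_nonneg hθ.1] at this
    refine this.trans ?_
    rw [mul_comm]
    refine mul_le_mul_of_nonneg_right ?_ ((norm_nonneg _).trans (hder θ hθ))
    -- The path has length at most π/2 ≤ 2, the source of the outer factor 2.
    linarith [hθ.2, Real.pi_le_four]
  refine abs_le.2 ⟨?_, ?_⟩
  · have h1 := (abs_le.1 (hE fun j => u j - 2 * δ)).1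
    have h2 := integral_smoothInd_le_pathProb (P := P) (γ := γ) c hS hβ θ (fun j => u j - 2 * δ)
    have h3 := pathProb_le_integral_smoothInd (P := P) (γ := γ) c hS hβ hβδ.le 0
      (fun j => u j - 2 * δ)
    have h4 := hN (fun j => u j - 2 * δ) 2 (by norm_num)
    rw [pathProb_zero] at h3
    simp only [sub_add_cancel] at h2 h4
    linarith
  · have h1 := (abs_le.1 (hE u)).2
    have h2 := pathProb_le_integral_smoothInd (P := P) (γ := γ) c hS hβ hβδ.le θ u
    have h3 := integral_smoothInd_le_pathProb (P := P) (γ := γ) c hS hβ 0 u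
    have h4 := hN u 2 (by norm_num)
    rw [pathProb_zero] at h3
    linarith

end Comparison

/-! ### The matrix Ξ as the covariance of the comparison Gaussian. -/

section Covariance

variable {Ω : Type*} [MeasurableSpace Ω] {P : Measure Ω} [IsProbabilityMeasure P] {n p : ℕ}
  {X : Fin n → Ω → EuclideanSpace ℝ (Fin p)}

/-- The quadratic form at x is the variance of Σ x_j S_j. Positive semidefiniteness is what
identifies the covariance of `multivariateGaussian 0 Ξ` with Ξ. -/
lemma posSemidef_longRunCov (hS : ∀ j, MemLp (fun ω => normalizedSum X ω j) 2 P) :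
    (longRunCov X P).PosSemidef := by
  refine Matrix.PosSemidef.of_dotProduct_mulVec_nonneg ?_ fun x => ?_
  · ext j k
    simp [longRunCov, covariance_comm]
  · have h : star x ⬝ᵥ (longRunCov X P).mulVec x
        = Var[fun ω => ∑ j, x j * normalizedSum X ω j; P] := by
      have hm : AEMeasurable (fun ω => ∑ j, x j * normalizedSum X ω j) P :=
        (memLp_finsetSum _ fun j _ => (hS j).const_mul (x j)).aestronglyMeasurable.aemeasurable
      rw [← covariance_self hm, covariance_fun_sum_fun_sum (fun j => (hS j).const_mul (x j))
        (fun j => (hS j).const_mul (x j))]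
      simp only [covariance_const_mul_left, covariance_const_mul_right, dotProduct,
        Matrix.mulVec, longRunCov, Matrix.of_apply, Pi.star_apply, star_trivial, Finset.mul_sum]
      exact Finset.sum_congr rfl fun j _ => Finset.sum_congr rfl fun k _ => by ring
    rw [h]
    exact variance_nonneg _ _

lemma integral_mul_multivariateGaussian {V : Matrix (Fin p) (Fin p) ℝ} (hS : V.PosSemidef)
    (j k : Fin p) : ∫ g, g j * g k ∂(multivariateGaussian 0 V) = V j k := by
  have h0 : (multivariateGaussian 0 V)[id] = 0 := integral_id_multivariateGaussian'
  rw [← covariance_eval_multivariateGaussian (μ := 0) hS j k,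
    covariance_eq_sub (memLp_gaussian_coord j) (memLp_gaussian_coord k),
    integral_gaussian_coord h0 j]
  simp

end Covariance

/-! ### Choice of the smoothing parameters -/

section Parameters

variable {Ω : Type*} [MeasurableSpace Ω] {P : Measure Ω} [IsProbabilityMeasure P] {n p m : ℕ}
  {X : Fin n → Ω → EuclideanSpace ℝ (Fin p)}

/-- The angle θ = arcsin √ν translates between the parameter of `varrho` and the trigonometric path.
-/
lemma varrho_le {r : ℝ} (h : ∀ θ ∈ Set.Icc 0 (Real.pi / 2), ∀ u : Fin p → ℝ,
    |pathProb (fun ω j => normalizedSum X ω j) P (multivariateGaussian 0 (longRunCov X P)) θ u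
      - (multivariateGaussian 0 (longRunCov X P)).real {g | ∀ j, g j ≤ u j}| ≤ r) :
    varrho X P ≤ r := by
  have : Nonempty (Set.Icc (0 : ℝ) 1) := ⟨⟨0, by simp⟩⟩
  refine ciSup_le fun q => ?_
  have hν := q.2.2
  have hs0 : 0 ≤ Real.sqrt q.2 := Real.sqrt_nonneg _
  have hs1 : Real.sqrt q.2 ≤ 1 := Real.sqrt_le_one.2 hν.2
  have := h (Real.arcsin (Real.sqrt q.2))
    ⟨Real.arcsin_nonneg.2 hs0, Real.arcsin_le_pi_div_two _⟩ fun j => q.1 j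
  rw [pathProb, Real.sin_arcsin (by linarith) hs1, Real.cos_arcsin, Real.sq_sqrt hν.1] at this
  exact this

lemma abs_pathProb_sub_le_varrho {θ : ℝ} (hθ : θ ∈ Set.Icc 0 (Real.pi / 2)) (u : Fin p → ℝ) :
    |pathProb (fun ω j => normalizedSum X ω j) P (multivariateGaussian 0 (longRunCov X P)) θ u
      - (multivariateGaussian 0 (longRunCov X P)).real {g | ∀ j, g j ≤ u j}| ≤ varrho X P := by
  have hsin : 0 ≤ Real.sin θ := Real.sin_nonneg_of_nonneg_of_le_pi hθ.1
    (by linarith [hθ.2, Real.pi_pos])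
  have hcos : 0 ≤ Real.cos θ := Real.cos_nonneg_of_mem_Icc ⟨by linarith [hθ.1, Real.pi_pos], hθ.2⟩
  have hb : BddAbove (Set.range fun q : EuclideanSpace ℝ (Fin p) × Set.Icc (0 : ℝ) 1 =>
      |(P.prod (multivariateGaussian 0 (longRunCov X P))).real
        {z | ∀ j, (Real.sqrt q.2 • normalizedSum X z.1 + Real.sqrt (1 - q.2) • z.2) j ≤ q.1 j}
      - (multivariateGaussian 0 (longRunCov X P)).real {g | ∀ j, g j ≤ q.1 j}|) := by
    refine ⟨1, ?_⟩
    rintro _ ⟨q, rfl⟩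
    exact abs_sub_le_of_nonneg_of_le measureReal_nonneg measureReal_le_one measureReal_nonneg
      measureReal_le_one
  have h := le_ciSup hb (WithLp.toLp 2 u, ⟨Real.sin θ ^ 2, sq_nonneg _, Real.sin_sq_le_one θ⟩)
  simp only [Real.sqrt_sq hsin, ← Real.cos_sq', Real.sqrt_sq hcos] at h
  exact h

lemma varrho_le_one : varrho X P ≤ 1 := varrho_le fun _ _ _ => abs_pathProb_sub_le_one _ _ _

lemma varrho_nonneg : 0 ≤ varrho X P :=
  (abs_nonneg _).trans (abs_pathProb_sub_le_varrho (θ := 0)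
    ⟨le_rfl, by positivity⟩ fun _ => 0)

/-- The scale of the smoothing, up to the factor depending on the data. -/
def smoothingConst (κ K : ℝ) : ℝ := 8 * (49674240 * K) + 112 * (3 + 4 / (3 * κ))

/-- Here p ≥ n^κ enters: with n = q⁶ it converts 8 log q into a multiple of log p. The exponent then
yields p⁻³ q⁻⁸, which outweighs the union bound over np coordinates and leaves the square of order
1/(pq). -/
lemma exceed_bound {κ : ℝ} (hκ : 0 < κ) {q L : ℝ} (hq : 0 < q) {p : ℝ} (hp : 0 < p)
    (hL : L = Real.log p) (hqp : κ * (6 * Real.log q) ≤ L) {x : ℝ}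
    (hx : (3 + 4 / (3 * κ)) * L ≤ x) :
    6 * (q ^ 6 * p) * Real.exp (-x) ≤ (3 * q⁻¹ * p⁻¹) ^ 2 := by
  have h1 : 8 * Real.log q ≤ 4 / (3 * κ) * L := by
    calc 8 * Real.log q = 4 / (3 * κ) * (κ * (6 * Real.log q)) := by field_simp; ring
      _ ≤ _ := mul_le_mul_of_nonneg_left hqp (by positivity)
  have h2 : Real.exp (-x) ≤ (p ^ 3)⁻¹ * (q ^ 8)⁻¹ := by
    calc Real.exp (-x) ≤ Real.exp (-(3 * Real.log p) + -(8 * Real.log q)) :=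
          Real.exp_le_exp.2 (by rw [← hL]; linarith)
      _ = _ := by
        rw [Real.exp_add, Real.exp_neg, Real.exp_neg, mul_comm (3 : ℝ), mul_comm (8 : ℝ),
          ← Real.rpow_def_of_pos hp, ← Real.rpow_def_of_pos hq]
        norm_cast
  calc 6 * (q ^ 6 * p) * Real.exp (-x) ≤ 6 * (q ^ 6 * p) * ((p ^ 3)⁻¹ * (q ^ 8)⁻¹) :=
        mul_le_mul_of_nonneg_left h2 (by positivity)
    _ = 6 * (q⁻¹ * p⁻¹) ^ 2 := by field_simp
    _ ≤ (3 * q⁻¹ * p⁻¹) ^ 2 := by nlinarith [sq_nonneg (q⁻¹ * p⁻¹)]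

/-- The bound in terms of `q = n^{1/6}`, `w = (m ∨ 1)^{1/3}` and `l = (log p)^{1/6}`. -/
lemma IsMDependent.varrho_le {K : ℝ} (hK : 1 ≤ K)
    (hcut : ∀ δ : ℝ, 0 < δ → Nonempty (SmoothCutoff δ K)) {κ γ₁ K₃ B : ℝ} (hκ : 0 < κ)
    (hγ₁ : 1 ≤ γ₁) (hK₃ : 0 < K₃) (hn : 1 ≤ n) (hp : 2 ≤ p) (hnp : (n : ℝ) ^ κ ≤ p) (hB : 1 ≤ B)
    (hX : ∀ t, Measurable (X t)) (h0 : ∀ t j, ∫ ω, X t ω j ∂P = 0) (h : IsMDependent m X P)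
    (hψ : ∀ t j, psiNorm γ₁ (fun ω => X t ω j) P ≤ ENNReal.ofReal B)
    (hvar : ∀ j, K₃ ≤ longRunVar X P j) {q w l : ℝ} (hq : 0 < q) (hw : 0 < w) (hl : 0 < l)
    (hqn : q ^ 6 = n) (hwm : w ^ 3 = max (m : ℝ) 1) (hlp : l ^ 6 = Real.log p) :
    varrho X P ≤ (210 * (Real.sqrt K₃)⁻¹ * smoothingConst κ K + 7) * (B * w ^ 2 * l ^ 7 / q) := by
  set c₀ := smoothingConst κ K with hc₀
  have hκ' : 0 < 4 / (3 * κ) := by positivity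
  -- The first part of c₀ makes the coefficient of ϱ in the recursion small; the second makes the
  -- exceedance event negligible.
  have hc1 : 8 * (49674240 * K) ≤ c₀ := by rw [hc₀, smoothingConst]; linarith
  have hc2 : 112 * (3 + 4 / (3 * κ)) ≤ c₀ := by rw [hc₀, smoothingConst]; linarith
  have hc3 : 1 ≤ c₀ := by linarith
  have hc0 : 0 < c₀ := by linarith
  have hB0 : 0 < B := by linarith
  have hp0 : (0 : ℝ) < p := by positivity
  have hn0 : (0 : ℝ) < n := by positivity
  have : Nonempty (Fin p) := ⟨⟨0, by omega⟩⟩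
  set τ := B * w ^ 2 * l ^ 7 / q with hτ
  have hτ0 : 0 < τ := by positivity
  -- For τ ≥ 1 the bound is trivial because ϱ ≤ 1; otherwise τ < 1 says that q dominates B w² l⁷.
  rcases le_or_gt 1 τ with hτ1 | hτ1
  · have : 0 ≤ 210 * (Real.sqrt K₃)⁻¹ * c₀ := by positivity
    exact varrho_le_one.trans (by nlinarith)
  have hl6 : 1 / 2 ≤ l ^ 6 := by
    have : Real.log 2 ≤ Real.log p := Real.log_le_log two_pos (by exact_mod_cast hp)
    rw [hlp]; linarith [Real.log_two_gt_d9]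
  have hw1 : 1 ≤ w := by
    by_contra! hlt
    have : w ^ 3 < 1 := pow_lt_one₀ hw.le hlt (by norm_num)
    linarith [le_max_right (m : ℝ) 1]
  have hl7 : 1 / 4 ≤ l ^ 7 := by
    rcases le_or_gt 1 l with h1 | h1
    · linarith [one_le_pow₀ h1 (n := 7)]
    · have : l ^ 12 ≤ l ^ 7 := pow_le_pow_of_le_one hl.le h1.le (by norm_num)
      nlinarith
  have hqτ : q⁻¹ ≤ 4 * τ := by
    have h1 : 1 ≤ B * w ^ 2 := by nlinarith [one_le_pow₀ hw1 (n := 2)]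
    have h2 : 1 / 4 ≤ B * w ^ 2 * l ^ 7 := by nlinarith
    rw [hτ, div_eq_mul_inv]
    have := inv_pos.2 hq
    nlinarith
  -- The remainder coefficient scales as B³ w⁶ l¹² / (q³ δ³), so this is the smallest δ, up to the
  -- constant, at which it is bounded.
  set δ := c₀ * B * w ^ 2 * l ^ 4 / q with hδ
  have hδ0 : 0 < δ := by positivity
  -- The factor 2 makes log p / β = δ/2 < δ, and βδ = 2 log p ≥ 1 because log p ≥ 1/2.
  set β := 2 * l ^ 6 / δ with hβ
  have hβ0 : 0 < β := by positivity
  have hβδ : β * δ = 2 * l ^ 6 := div_mul_cancel₀ _ hδ0.ne'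
  have hsn : Real.sqrt n = q ^ 3 := by
    rw [← hqn, show q ^ 6 = (q ^ 3) ^ 2 by ring, Real.sqrt_sq (by positivity)]
  have hsl : Real.sqrt (Real.log p) = l ^ 3 := by
    rw [← hlp, show l ^ 6 = (l ^ 3) ^ 2 by ring, Real.sqrt_sq (by positivity)]
  have hs : ∀ t j, SubExp (2 * B) (fun ω => X t ω j) P := fun t j =>
    subExp_of_psiNorm_le hγ₁ hB0 (measurable_coord hX t j) (hψ t j)
  have hb0 : 0 < 2 * B := by positivity
  have hM : 6 * (m : ℝ) + 1 ≤ 7 * w ^ 3 := by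
    rw [hwm]; linarith [le_max_left (m : ℝ) 1, le_max_right (m : ℝ) 1]
  set ε := 3 * q⁻¹ * (p : ℝ)⁻¹ with hε
  have hε0 : 0 < ε := by positivity
  have hexc : P.real (exceedSet X (Real.sqrt n / (2 * (7 * w ^ 3) * β))) ≤ ε ^ 2 := by
    refine (measureReal_exceedSet_le hb0 hs _).trans ?_
    rw [← hqn]
    refine exceed_bound hκ hq hp0 hlp ?_ ?_
    · have := Real.log_le_log (Real.rpow_pos_of_pos hn0 κ) hnp
      rwa [Real.log_rpow hn0, ← hqn, Real.log_pow, ← hlp] at this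
    · rw [hqn, hsn]
      have e : q ^ 3 / (2 * (7 * w ^ 3) * β) / (2 * B) = c₀ * q ^ 2 / (56 * w * l ^ 2) := by
        rw [hβ, hδ]; field_simp; ring
      rw [e, le_div_iff₀ (by positivity)]
      have h1 : w ^ 2 * l ^ 7 ≤ q := by
        rw [hτ, div_lt_one hq] at hτ1
        have : w ^ 2 * l ^ 7 ≤ B * (w ^ 2 * l ^ 7) := le_mul_of_one_le_left (by positivity) hB
        linarith
      have h2 : (w ^ 2 * l ^ 7) ^ 2 ≤ q ^ 2 := pow_le_pow_left₀ (by positivity) h1 2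
      have h3 : w * l ^ 8 * (1 / 2) ≤ (w ^ 2 * l ^ 7) ^ 2 := by
        have h4 : w * l ^ 8 ≤ w ^ 4 * l ^ 8 :=
          mul_le_mul_of_nonneg_right (le_self_pow₀ hw1 (by norm_num)) (by positivity)
        calc w * l ^ 8 * (1 / 2) ≤ w ^ 4 * l ^ 8 * l ^ 6 := mul_le_mul h4 hl6 (by norm_num)
              (by positivity)
          _ = _ := by ring
      calc (3 + 4 / (3 * κ)) * l ^ 6 * (56 * w * l ^ 2)
          = 112 * (3 + 4 / (3 * κ)) * (w * l ^ 8 * (1 / 2)) := by ring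
        _ ≤ c₀ * q ^ 2 := mul_le_mul hc2 (h3.trans h2) (by positivity) hc0.le
  obtain ⟨c⟩ := hcut δ hδ0
  have hS2 := fun j => memLp_normalizedSum (P := P) hb0 hs j
  have hpsd := posSemidef_longRunCov hS2
  set γ := multivariateGaussian 0 (longRunCov X P) with hγ
  have hγ0 : γ[id] = 0 := integral_id_multivariateGaussian'
  have hcov : ∀ j k, ∫ g, g j * g k ∂γ = longRunCov X P j k :=
    integral_mul_multivariateGaussian hpsd
  have hV : ∀ j, K₃ ≤ ∫ g, g j * g j ∂γ := fun j => by
    rw [hcov, longRunCov, Matrix.of_apply, covariance_self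
      (measurable_normalizedSum_apply hX j).aemeasurable]
    exact hvar j
  set E := (Real.sqrt n)⁻¹ * (3 * (7 * w ^ 3) ^ 2 * (5 * K * δ⁻¹ * β ^ 2)
    * (4 * (66 * (2 * B) ^ 3))) with hE
  have hE0 : 0 ≤ E := by positivity
  -- All parameters cancel in E except c₀⁻³; the number is 3 · 7² · 5 · 2² · 4 · 66 · 2³ · 8.
  have hE8 : E * 8 ≤ 1 / 8 := by
    have e : E * 8 = 49674240 * K / c₀ ^ 3 := by
      rw [hE, hsn, hβ, hδ]; field_simp; ring
    rw [e, div_le_iff₀ (by positivity)]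
    have : c₀ ≤ c₀ ^ 3 := le_self_pow₀ hc3 (by norm_num)
    linarith
  have H : ∀ θ ∈ Set.Icc 0 (Real.pi / 2), ∀ v : Fin p → ℝ,
      |∫ ω, smoothD1 c β (fun j => Real.sin θ * normalizedSum X ω j - v j)
          (fun j => normalizedSum X ω j) ∂P
        - Real.sin θ * ∫ ω, ∑ j, ∑ k,
            smoothHess c β (fun j => Real.sin θ * normalizedSum X ω j - v j) j k
            * ∫ g, g j * g k ∂γ ∂P|
      ≤ E * 8 * P.real {ω | softmax β (fun j => Real.sin θ * normalizedSum X ω j - v j)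
          ∈ Set.Icc (-δ) (4 * δ)} + E * 9 * (p * ε) := fun θ hθ v => by
    simp only [hcov]
    refine (h.expansion c hX hn hδ0 (by linarith) (by linarith) hb0 hε0 hs h0 hM
      (Real.sin_nonneg_of_nonneg_of_le_pi hθ.1 (by linarith [hθ.2, Real.pi_pos]))
      (Real.sin_le_one θ) v hexc).trans (le_of_eq ?_)
    rw [hE]; ring
  -- The comparison is fed with ϱ itself as the a priori discrepancy, so the result bounds ϱ in
  -- terms of ϱ.
  have hrec := HighDimCLT.varrho_le fun θ hθ u => abs_pathProb_sub_le c hγ0 hp hK₃ hV hδ0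
    (by linarith) hβ0 (by
      rw [div_lt_iff₀ hβ0, mul_comm, hβδ, ← hlp]; linarith)
    (measurable_pi_lambda _ fun j => measurable_normalizedSum_apply hX j)
    (fun j => (hS2 j).integrable one_le_two) (by positivity) H
    (fun θ hθ u => abs_pathProb_sub_le_varrho hθ u) hθ u
  have hδl : δ * l ^ 3 = c₀ * τ := by rw [hδ, hτ]; field_simp
  have ha : 30 * (Real.sqrt K₃)⁻¹ * δ * Real.sqrt (Real.log p)
      = 30 * (Real.sqrt K₃)⁻¹ * c₀ * τ := by rw [hsl, mul_assoc, hδl]; ring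
  have hpε : (p : ℝ) * ε = 3 * q⁻¹ := by rw [hε]; field_simp
  rw [ha, hpε] at hrec
  set a := 30 * (Real.sqrt K₃)⁻¹ * c₀ * τ with ha'
  have ha0 : 0 ≤ a := by positivity
  have hρ := varrho_nonneg (X := X) (P := P)
  have h1 : E * 8 * (2 * varrho X P + 6 * a) ≤ 1 / 8 * (2 * varrho X P + 6 * a) :=
    mul_le_mul_of_nonneg_right hE8 (by linarith)
  have h2 : E * 9 * (3 * q⁻¹) ≤ 9 / 64 * (3 * (4 * τ)) :=
    mul_le_mul (by linarith) (by linarith) (by positivity) (by norm_num)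
  -- The recursion reads ϱ ≤ 2a + ϱ/2 + 3a/2 + 27τ/8; absorbing ϱ/2 gives 7a + 27τ/4, and 210 = 7 ·
  -- 30.
  have e : (210 * (Real.sqrt K₃)⁻¹ * c₀ + 7) * τ = 7 * a + 7 * τ := by rw [ha']; ring
  rw [e]
  linarith

end Parameters

end HighDimCLT

end

/-! ### The theorem, with fractional powers restored. -/

theorem corollary1 (κ γ₁ K₃ : ℝ) (hκ : 0 < κ) (hγ₁ : 1 ≤ γ₁) (hK₃ : 0 < K₃) :
    ∃ C : ℝ, 0 < C ∧
      ∀ (n p m : ℕ) (B : ℝ) (Ω : Type*) [MeasurableSpace Ω] (P : Measure Ω)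
        [IsProbabilityMeasure P] (X : Fin n → Ω → EuclideanSpace ℝ (Fin p)),
        1 ≤ n → 2 ≤ p → (n : ℝ) ^ κ ≤ (p : ℝ) → 1 ≤ B →
        (∀ t, Measurable (X t)) →
        (∀ t j, ∫ ω, X t ω j ∂P = 0) →
        HighDimCLT.IsMDependent m X P →
        (∀ t j, HighDimCLT.psiNorm γ₁ (fun ω => X t ω j) P ≤ ENNReal.ofReal B) →
        (∀ j, K₃ ≤ HighDimCLT.longRunVar X P j) →
        HighDimCLT.varrho X P ≤
          C * (B * (max (m : ℝ) 1) ^ (2 / 3 : ℝ) * Real.log p ^ (7 / 6 : ℝ)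
            / (n : ℝ) ^ (1 / 6 : ℝ)) := by
  obtain ⟨K, hK, hcut⟩ := HighDimCLT.exists_smoothCutoff
  have hc0 : 0 < HighDimCLT.smoothingConst κ K := by
    rw [HighDimCLT.smoothingConst]; positivity
  refine ⟨210 * (Real.sqrt K₃)⁻¹ * HighDimCLT.smoothingConst κ K + 7, by positivity, ?_⟩
  intro n p m B Ω _ P _ X hn hp hnp hB hX h0 hdep hψ hvar
  have hn0 : (0 : ℝ) < n := by positivity
  have hm0 : (0 : ℝ) < max (m : ℝ) 1 := lt_max_of_lt_right one_pos
  have hp0 : 0 < Real.log p := Real.log_pos (by exact_mod_cast hp)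
  have hroot : ∀ {x a : ℝ} {k : ℕ}, 0 ≤ x → (x ^ a) ^ k = x ^ (a * k) := fun hx => by
    rw [Real.rpow_mul_natCast hx]
  have key := hdep.varrho_le hK hcut hκ hγ₁ hK₃ hn hp hnp hB hX h0 hψ hvar
    (Real.rpow_pos_of_pos hn0 (1 / 6)) (Real.rpow_pos_of_pos hm0 (1 / 3))
    (Real.rpow_pos_of_pos hp0 (1 / 6))
    (by rw [hroot hn0.le]; norm_num) (by rw [hroot hm0.le]; norm_num)
    (by rw [hroot hp0.le]; norm_num)
  rw [hroot hm0.le, hroot hp0.le] at key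
  norm_num at key ⊢
  exact key
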